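/- **Theorem.** Let $\omega$ be the exponent of matrix multiplication, i.e. the infimum of all real $\tau$ such that the rank (bilinear complexity) over $\mathbb{Q}$ of the multiplication of $m\times m$ matrices is $O(m^{\tau})$. The Euclidean 2-means problem is the following: given $n$ points $x_1,\dots,x_n\in\mathbb{Z}^d$, find a partition of the points into two clusters $C_1,C_2$ (both non-empty if $n\ge 2$) and centers $\mu_1,\mu_2\in\mathbb{R}^d$ that minimize $$\sum_{j=1}^{2}\ \sum_{x\in C_j}\|x-\mu_j\|^2 .$$ The 2-means problem can be solved exactly in time $2^{\omega n/3}\cdot\mathrm{poly}(n,d)$ if the coordinates are bounded in absolute value by a polynomial in $n$ and $d$. Precisely: for every $\varepsilon>0$ there are a deterministic random access machine program and constants $C,e\in\mathbb{N}$ such that, for all $n,d,M\in\mathbb{N}$ and all points $x_1,\dots,x_n\in\mathbb{Z}^d$ whose coordinates have absolute value at most $M$, the program halts with an optimal clustering and its (rational) centers after at most $$2^{(\omega+\varepsilon)n/3}\cdot C\,(n+d+M+1)^{e}$$ steps, where time is measured by the logarithmic cost criterion (every operation is charged for the bit lengths of the addresses and integers involved, a multiplication or division for the product of the lengths of its operands).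 -/

import Mathlib

open scoped BigOperators

/-! ## The exponent of matrix multiplication -/

/-- The multiplication of `m × m` matrices over `K` has bilinear complexity at most `r`: it is a sum
of `r` products of a linear form in the left factor and a linear form in the right factor, i.e.
the matrix multiplication tensor `⟨m, m, m⟩` is a sum of `r` tensors of rank one. -/
def HasMatMulDecomposition (K : Type) [Field K] (m r : ℕ) : Prop :=
  ∃ (f g : Fin r → Module.Dual K (Matrix (Fin m) (Fin m) K))
    (W : Fin r → Matrix (Fin m) (Fin m) K),
    ∀ A B : Matrix (Fin m) (Fin m) K, A * B = ∑ l, (f l A * g l B) • W l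

/-- The rank of the `m × m` matrix multiplication tensor over `K`. -/
noncomputable def matMulRank (K : Type) [Field K] (m : ℕ) : ℕ :=
  sInf {r : ℕ | HasMatMulDecomposition K m r}

/-- The exponent `ω` of matrix multiplication over `K`: the infimum of all `τ` such that the rank
of the `m × m` matrix multiplication tensor is `O(m ^ τ)`. -/
noncomputable def matMulExponent (K : Type) [Field K] : ℝ :=
  sInf {τ : ℝ | (fun m : ℕ => (matMulRank K m : ℝ)) =O[Filter.atTop] fun m : ℕ => (m : ℝ) ^ τ}

/-! ## Random access machines with logarithmic cost

A program uses finitely many integer variables and finitely many integer arrays with indirect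
addressing; the time counts bit operations (logarithmic cost criterion). -/

namespace RAM

/-- The contents of the variables and of the arrays. -/
structure Store where
  var : ℕ → ℤ
  arr : ℕ → ℤ → ℤ

/-- The arithmetic operations; `div` is division with remainder, rounding down for a positive
divisor. -/
inductive Op where
  | add
  | sub
  | mul
  | div

/-- The length of an integer in binary, with its sign. -/
def len (z : ℤ) : ℕ := z.natAbs.size + 1

def Op.eval : Op → ℤ → ℤ → ℤ
  | .add, a, b => a + b
  | .sub, a, b => a - b
  | .mul, a, b => a * b
  | .div, a, b => a / b

/-- Addition and subtraction cost the lengths of the operands, multiplication and division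
the product of the lengths (the schoolbook methods). -/
def Op.cost : Op → ℤ → ℤ → ℕ
  | .add, a, b => len a + len b
  | .sub, a, b => len a + len b
  | .mul, a, b => len a * len b
  | .div, a, b => len a * len b

/-- Terms: constants, variables, array cells with a computed address, arithmetic. -/
inductive Term where
  | const (z : ℤ)
  | var (x : ℕ)
  | read (a : ℕ) (i : Term)
  | op (o : Op) (u v : Term)

def Term.eval (s : Store) : Term → ℤ
  | .const z => z
  | .var x => s.var x
  | .read a i => s.arr a (i.eval s)
  | .op o u v => o.eval (u.eval s) (v.eval s)

/-- The time for evaluating a term: every access costs the length of the address and of the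
contents, every operation its cost. -/
def Term.cost (s : Store) : Term → ℕ
  | .const z => len z
  | .var x => len (s.var x)
  | .read a i => i.cost s + len (i.eval s) + len (s.arr a (i.eval s))
  | .op o u v => u.cost s + v.cost s + o.cost (u.eval s) (v.eval s)

/-- Programs. The tests of `ite` and `loop` ask whether the value of the term is positive. -/
inductive Prog where
  | skip
  | assign (x : ℕ) (u : Term)
  | write (a : ℕ) (i u : Term)
  | seq (p q : Prog)
  | ite (u : Term) (p q : Prog)
  | loop (u : Term) (p : Prog)

def Store.setVar (s : Store) (x : ℕ) (z : ℤ) : Store :=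
  { s with var := Function.update s.var x z }

def Store.setArr (s : Store) (a : ℕ) (i z : ℤ) : Store :=
  { s with arr := Function.update s.arr a (Function.update (s.arr a) i z) }

/-- `Runs p s s' t`: started in the store `s`, the program `p` halts in the store `s'` after
time `t`. -/
inductive Runs : Prog → Store → Store → ℕ → Prop where
  | skip (s : Store) : Runs .skip s s 1
  | assign (s : Store) (x : ℕ) (u : Term) :
      Runs (.assign x u) s (s.setVar x (u.eval s)) (u.cost s + len (u.eval s))
  | write (s : Store) (a : ℕ) (i u : Term) :
      Runs (.write a i u) s (s.setArr a (i.eval s) (u.eval s))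
        (i.cost s + u.cost s + len (i.eval s) + len (u.eval s))
  | seq {p q : Prog} {s s' s'' : Store} {t t' : ℕ} (hp : Runs p s s' t) (hq : Runs q s' s'' t') :
      Runs (.seq p q) s s'' (t + t')
  | ite_pos {u : Term} {p q : Prog} {s s' : Store} {t : ℕ} (hu : 0 < u.eval s)
      (hp : Runs p s s' t) : Runs (.ite u p q) s s' (u.cost s + len (u.eval s) + t)
  | ite_neg {u : Term} {p q : Prog} {s s' : Store} {t : ℕ} (hu : ¬ 0 < u.eval s)
      (hq : Runs q s s' t) : Runs (.ite u p q) s s' (u.cost s + len (u.eval s) + t)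
  | loop_stop {u : Term} {p : Prog} {s : Store} (hu : ¬ 0 < u.eval s) :
      Runs (.loop u p) s s (u.cost s + len (u.eval s))
  | loop_step {u : Term} {p : Prog} {s s' s'' : Store} {t t' : ℕ} (hu : 0 < u.eval s)
      (hp : Runs p s s' t) (hl : Runs (.loop u p) s' s'' t') :
      Runs (.loop u p) s s'' (u.cost s + len (u.eval s) + t + t')

end RAM

/-! ## The Euclidean `k`-means problem -/

/-- The `k`-means cost of the clusters `C_j = {i | c i = j}` with centers `μ j`. -/
noncomputable def kMeansCost {n d k : ℕ} (p : Fin n → EuclideanSpace ℝ (Fin d))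
    (c : Fin n → Fin k) (μ : Fin k → EuclideanSpace ℝ (Fin d)) : ℝ :=
  ∑ j, ∑ i with c i = j, ‖p i - μ j‖ ^ 2

/-- The clusters given by `c`, with centers `μ`, solve the `k`-means problem for the points `p`:
they have minimal cost among all choices of `k` clusters and centers, and no cluster is empty
if there are at least `k` points. -/
structure IsKMeansSolution {n d k : ℕ} (p : Fin n → EuclideanSpace ℝ (Fin d))
    (c : Fin n → Fin k) (μ : Fin k → EuclideanSpace ℝ (Fin d)) : Prop where
  nonempty : k ≤ n → Function.Surjective c
  optimal : ∀ (c' : Fin n → Fin k) (μ' : Fin k → EuclideanSpace ℝ (Fin d)),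
    kMeansCost p c μ ≤ kMeansCost p c' μ'

/-- The points of an integral instance, in Euclidean space. -/
noncomputable def toPoints {n d : ℕ} (x : Fin n → Fin d → ℤ) :
    Fin n → EuclideanSpace ℝ (Fin d) :=
  fun i => WithLp.toLp 2 fun j => (x i j : ℝ)

/-- The input: variable `0` holds `n`, variable `1` holds `d`, the cell `i * d + j` of array `0`
holds the `j`-th coordinate of the `i`-th point; everything else is `0`. -/
def inputStore {n d : ℕ} (x : Fin n → Fin d → ℤ) : RAM.Store where
  var v := if v = 0 then n else if v = 1 then d else 0
  arr a k :=
    if h : a = 0 ∧ 0 ≤ k ∧ k.toNat < n * d then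
      x (finProdFinEquiv.symm ⟨k.toNat, h.2.2⟩).1 (finProdFinEquiv.symm ⟨k.toNat, h.2.2⟩).2
    else 0

/-- The output: the cell `i` of array `1` holds the cluster of the `i`-th point; the `j`-th center
is rational, with positive common denominator in the cell `j` of array `2`, and with the numerator
of its `l`-th coordinate in the cell `j * d + l` of array `3`. -/
structure IsOutput {n d k : ℕ} (s : RAM.Store) (c : Fin n → Fin k)
    (μ : Fin k → EuclideanSpace ℝ (Fin d)) : Prop where
  label : ∀ i : Fin n, s.arr 1 (i : ℕ) = ((c i : ℕ) : ℤ)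
  denom_pos : ∀ j : Fin k, 0 < s.arr 2 (j : ℕ)
  center : ∀ (j : Fin k) (l : Fin d),
    μ j l = (s.arr 3 (((j : ℕ) * d + (l : ℕ) : ℕ) : ℤ) : ℝ) / (s.arr 2 (j : ℕ) : ℝ)

/-! Up to terms that do not depend on the clustering, minimizing the 2-means cost means maximizing
`‖∑ c i • y i‖² / (k (n - k))`, where `y i = n x i - ∑ x` are the centered points, `c` is the
indicator of the second cluster and `k` its size (`clusterGain_eq`, `isKMeansSolution_of_spread`).

The points are split into three parts of `g`, about `n / 3`, points each, and `A`, `B`, `C` denote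
the sums of the selected points of the parts. The identity `2‖A+B+C‖² = ‖2A+C‖² + ‖C+2B‖² - 2‖A-B‖²`
(`two_mul_tripleWeight`) expresses the numerator by weights of pairs of parts. Let one matrix carry
the weight of `(A, C)` and a second one that of `(C, B)`, both written as exponents of a large base.
The entry of the product at `(A, B)` is then a sum of powers of the base with fewer summands than
the base, so its size reveals the maximal exponent, that is, the best `C` for given `A` and `B`
(`pow_le_sum_pow_iff`, `productEntry_decode`). The denominator is under control because one product
is formed for every possible number `κ` of selected points in the third part: then `k` is the same
for all third parts that compete (`Best.update`). This takes `g + 1` products of matrices of size `2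
^ g`. The third part itself is recovered by one further scan (`thirdStmt_spec`), and every
clustering is covered (`exists_cand`).

The products are computed with a fixed bilinear scheme for `2 ^ p × 2 ^ p` matrices whose number `r`
of products is at most `(2 ^ p) ^ (ω + ε)`. It is scaled to integer coefficients
(`HasMatMulDecomposition.exists_integral`) and raised to its `K`-th tensor power, `K = ⌈n / (3 p)⌉`
(`sum_tensorPow`, `mulTensorPow_two_pow`). The three linear maps of the power are applied digit by
digit as in Yates' algorithm (`partialTransform_succ`), in `K` passes over at most `r ^ K` numbers.
The rounding in `K` costs a constant factor, so `r ^ K` is `O(2 ^ ((ω + ε) n / 3))`. The weights are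
polynomial in `n`, `d`, `M` (`maxExp_le`), hence so are the bit lengths of all numbers.

For the machine model, a small language with bounded loops and bounded sums is compiled to random
access programs (`Expr.compile_spec`, `Stmt.compile_spec`). The logarithmic cost is a polynomial in
the bit length and in a bound for a few small variables, times the number of executed statements;
the algorithm is verified in this language by rules in the style of Hoare logic (`Spec.loop`,
`Spec.fill`). -/

namespace RAM

/-! ## Bit lengths -/

/-- The number of binary digits of the absolute value. -/
def bits (z : ℤ) : ℕ := z.natAbs.size

theorem len_eq (z : ℤ) : len z = bits z + 1 := rfl

theorem bits_le {z : ℤ} {n : ℕ} : bits z ≤ n ↔ z.natAbs < 2 ^ n := Nat.size_le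

theorem bits_le_of_abs_le {z y : ℤ} {n : ℕ} (h : |z| ≤ y) (hy : y < 2 ^ n) : bits z ≤ n := by
  rw [bits_le]
  zify
  exact lt_of_le_of_lt h hy

theorem bits_mono {a b : ℤ} (h : a.natAbs ≤ b.natAbs) : bits a ≤ bits b :=
  Nat.size_le_size h

theorem natAbs_lt_two_pow_bits (z : ℤ) : z.natAbs < 2 ^ bits z := Nat.lt_size_self _

/-- One bound serves all operations: sums gain a single bit, the lengths of factors add, and a
quotient is no larger than its dividend. -/
theorem Op.bits_eval_le (o : Op) (a b : ℤ) : bits (o.eval a b) ≤ bits a + bits b + 1 := by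
  have ha := natAbs_lt_two_pow_bits a
  have hb := natAbs_lt_two_pow_bits b
  have key : a.natAbs + b.natAbs < 2 ^ (bits a + bits b + 1) := by
    have h1 : 2 ^ bits a ≤ 2 ^ (bits a + bits b) := Nat.pow_le_pow_right (by norm_num) (by omega)
    have h2 : 2 ^ bits b ≤ 2 ^ (bits a + bits b) := Nat.pow_le_pow_right (by norm_num) (by omega)
    rw [pow_succ]
    omega
  cases o with
  | add => exact bits_le.2 (lt_of_le_of_lt (Int.natAbs_add_le a b) key)
  | sub => exact bits_le.2 (lt_of_le_of_lt (Int.natAbs_sub_le a b) key)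
  | mul =>
    refine bits_le.2 ?_
    simp only [Op.eval, Int.natAbs_mul]
    calc a.natAbs * b.natAbs < 2 ^ bits a * 2 ^ bits b := Nat.mul_lt_mul'' ha hb
      _ = 2 ^ (bits a + bits b) := (pow_add _ _ _).symm
      _ ≤ _ := Nat.pow_le_pow_right (by norm_num) (by omega)
  | div =>
    have : bits (a / b) ≤ bits a := bits_mono (Int.natAbs_ediv_le_natAbs a b)
    simp only [Op.eval]
    omega

theorem Op.cost_le (o : Op) {a b : ℤ} {q : ℕ} (hq : 1 ≤ q) (ha : len a ≤ q) (hb : len b ≤ q) :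
    o.cost a b ≤ 2 * q ^ 2 := by
  have h1 : len a * len b ≤ q * q := Nat.mul_le_mul ha hb
  have h2 : q ≤ q * q := Nat.le_mul_of_pos_left q hq
  cases o <;> simp only [Op.cost] <;> nlinarith

/-! ## Expressions with bounded sums -/

@[simp] theorem Store.setVar_var (s : Store) (x : ℕ) (z : ℤ) (y : ℕ) :
    (s.setVar x z).var y = if y = x then z else s.var y := by
  simp [Store.setVar, Function.update_apply]

@[simp] theorem Store.setVar_arr (s : Store) (x : ℕ) (z : ℤ) : (s.setVar x z).arr = s.arr := rfl

@[simp] theorem Store.setArr_var (s : Store) (a : ℕ) (i z : ℤ) : (s.setArr a i z).var = s.var := rfl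

theorem Store.setArr_arr (s : Store) (a : ℕ) (i z : ℤ) (b : ℕ) (j : ℤ) :
    (s.setArr a i z).arr b j = if b = a ∧ j = i then z else s.arr b j := by
  by_cases hb : b = a
  · subst hb
    by_cases hj : j = i <;> simp [Store.setArr, hj]
  · simp [Store.setArr, hb]

/-- Terms extended by sums `∑ x < w, u`, where the bound `w` is a variable. -/
inductive Expr where
  | const (z : ℤ)
  | var (x : ℕ)
  | read (a : ℕ) (i : Expr)
  | op (o : Op) (u v : Expr)
  | sum (x w : ℕ) (u : Expr)

/-- The value of an expression. -/
def Expr.eval : Expr → Store → ℤ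
  | .const z, _ => z
  | .var x, s => s.var x
  | .read a i, s => s.arr a (i.eval s)
  | .op o u v, s => o.eval (u.eval s) (v.eval s)
  | .sum x w u, s => ∑ i ∈ Finset.range (s.var w).toNat, u.eval (s.setVar x i)

/-- All variables are below `64`, the bounds of the sums are variables below `8`, the summation
variables are not. -/
def Expr.Fits : Expr → Prop
  | .const _ => True
  | .var x => x < 64
  | .read _ i => i.Fits
  | .op _ u v => u.Fits ∧ v.Fits
  | .sum x w u => 8 ≤ x ∧ x < 64 ∧ w < 8 ∧ u.Fits

/-- The program that computes the value of an expression into the variable `t`. It uses the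
variables from `t` on as temporary ones. -/
def Expr.compile : Expr → ℕ → Prog
  | .const z, t => .assign t (.const z)
  | .var x, t => .assign t (.var x)
  | .read a i, t => .seq (i.compile t) (.assign t (.read a (.var t)))
  | .op o u v, t =>
    .seq (u.compile t) (.seq (v.compile (t + 1)) (.assign t (.op o (.var t) (.var (t + 1)))))
  | .sum x w u, t =>
    .seq (.assign t (.const 0)) (.seq (.assign (t + 1) (.var x)) (.seq (.assign x (.const 0)) (.seq
      (.loop (.op .sub (.var w) (.var x)) (.seq (u.compile (t + 2))
        (.seq (.assign t (.op .add (.var t) (.var (t + 2))))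
          (.assign x (.op .add (.var x) (.const 1))))))
      (.assign x (.var (t + 1))))))

/-- All entries of the store have at most `ℓ` bits, the variables below `8` are at most `Y`. -/
structure Good (ℓ Y : ℕ) (s : Store) : Prop where
  var : ∀ x, bits (s.var x) ≤ ℓ
  arr : ∀ a i, bits (s.arr a i) ≤ ℓ
  small : ∀ x < 8, s.var x ≤ Y

theorem Good.setVar {ℓ Y : ℕ} {s : Store} (h : Good ℓ Y s) {x : ℕ} {z : ℤ} (hz : bits z ≤ ℓ)
    (hx : x < 8 → z ≤ Y) : Good ℓ Y (s.setVar x z) where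
  var y := by
    rw [Store.setVar_var]
    split_ifs
    exacts [hz, h.var y]
  arr := h.arr
  small y hy := by
    rw [Store.setVar_var]
    split_ifs with e
    exacts [hx (e ▸ hy), h.small y hy]

theorem Good.setArr {ℓ Y : ℕ} {s : Store} (h : Good ℓ Y s) {a : ℕ} {i z : ℤ} (hz : bits z ≤ ℓ) :
    Good ℓ Y (s.setArr a i z) where
  var := h.var
  arr b j := by
    rw [Store.setArr_arr]
    split_ifs
    exacts [hz, h.arr b j]
  small := h.small

theorem bits_natCast_le_of_lt_toNat {z : ℤ} {i ℓ : ℕ} (hi : i ≤ z.toNat) (hz : bits z ≤ ℓ) :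
    bits (i : ℤ) ≤ ℓ :=
  (bits_mono (by omega)).trans hz

/-- A sum of fewer than `2 ^ ℓ` terms adds at most `ℓ` bits, so bounded sums keep all lengths linear
in `ℓ`. -/
theorem bits_sum_le {f : ℕ → ℤ} {i N ℓ c : ℕ} (hi : i ≤ N) (hN : bits (N : ℤ) ≤ ℓ)
    (hf : ∀ j < N, bits (f j) ≤ c) : bits (∑ j ∈ Finset.range i, f j) ≤ ℓ + c := by
  rw [bits_le] at *
  have h1 : (∑ j ∈ Finset.range i, f j).natAbs ≤ ∑ j ∈ Finset.range i, (f j).natAbs :=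
    Int.natAbs_sum_le _ _
  have h2 : ∑ j ∈ Finset.range i, (f j).natAbs ≤ i * 2 ^ c := by
    rw [← smul_eq_mul]
    refine (Finset.sum_le_card_nsmul _ _ (2 ^ c) fun j hj => ?_).trans (by simp)
    exact (bits_le.1 (hf j (by have := Finset.mem_range.1 hj; omega))).le
  rw [pow_add]
  have h3 : i < 2 ^ ℓ := by simp at hN; omega
  calc _ ≤ i * 2 ^ c := h1.trans h2
    _ < _ := Nat.mul_lt_mul_of_pos_right h3 (by positivity)

theorem le_poly_of_le {a C C' D D' Y ℓ : ℕ} (h : a ≤ C * (Y + 1) ^ D * ℓ ^ 2) (hC : C ≤ C')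
    (hD : D ≤ D') : a ≤ C' * (Y + 1) ^ D' * ℓ ^ 2 :=
  h.trans (Nat.mul_le_mul_right _ (Nat.mul_le_mul hC (Nat.pow_le_pow_right (by omega) hD)))

theorem sq_le_poly (C D Y ℓ : ℕ) : (C * ℓ) ^ 2 ≤ C ^ 2 * (Y + 1) ^ D * ℓ ^ 2 := by
  rw [mul_pow]
  exact Nat.mul_le_mul_right _ (Nat.le_mul_of_pos_right _ (by positivity))

/-- The loop in the program for a sum. -/
theorem Expr.runs_sum_loop {x w t C D ℓ Y : ℕ} {u : Expr} {s : Store} (hx : x < 64) (hx8 : 8 ≤ x)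
    (hw : w < 8) (ht : 64 ≤ t) (hℓ : 1 ≤ ℓ) (hs : Good ℓ Y s)
    (hu : ∀ s' σ : Store, Good ℓ Y s' → (∀ y < 64, σ.var y = s'.var y) → σ.arr = s'.arr →
      bits (u.eval s') ≤ C * ℓ ∧ ∃ σ' τ, Runs (u.compile (t + 2)) σ σ' τ ∧ σ'.arr = σ.arr ∧
        (∀ y < t + 2, σ'.var y = σ.var y) ∧ σ'.var (t + 2) = u.eval s' ∧
        τ ≤ C * (Y + 1) ^ D * ℓ ^ 2) (k : ℕ) :
    ∀ (i : ℕ) (σ : Store), i + k = (s.var w).toNat → (∀ y < 64, σ.var y = (s.setVar x i).var y) →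
      σ.arr = s.arr → σ.var t = ∑ j ∈ Finset.range i, u.eval (s.setVar x j) →
      ∃ σ' τ, Runs (.loop (.op .sub (.var w) (.var x)) (.seq (u.compile (t + 2))
        (.seq (.assign t (.op .add (.var t) (.var (t + 2))))
          (.assign x (.op .add (.var x) (.const 1)))))) σ σ' τ ∧ σ'.arr = σ.arr ∧
        (∀ y < t, y ≠ x → σ'.var y = σ.var y) ∧ σ'.var (t + 1) = σ.var (t + 1) ∧
        σ'.var t = ∑ j ∈ Finset.range (s.var w).toNat, u.eval (s.setVar x j) ∧
        τ ≤ k * (C * (Y + 1) ^ D * ℓ ^ 2 + 15 * ((C + 4) * ℓ) ^ 2) + 5 * ((C + 4) * ℓ) ^ 2 := by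
  -- A common bound for the lengths that occur in one iteration; the additions cost a multiple of
  -- `q`, which is relaxed to a multiple of `q ^ 2`.
  set q := (C + 4) * ℓ with hq
  have hq1 : 4 * ℓ + C * ℓ = q := by rw [hq]; ring
  have hqq : q ≤ q ^ 2 := Nat.le_self_pow (by norm_num) q
  have hN : bits ((s.var w).toNat : ℤ) ≤ ℓ := bits_natCast_le_of_lt_toNat le_rfl (hs.var w)
  have hgood : ∀ j : ℕ, j ≤ (s.var w).toNat → Good ℓ Y (s.setVar x j) := fun j hj =>
    hs.setVar (bits_natCast_le_of_lt_toNat hj (hs.var w)) (by omega)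
  induction k with
  | zero =>
    intro i σ hi hσ harr hacc
    have hvx : σ.var x = i := by rw [hσ x hx]; simp
    have hvw : σ.var w = s.var w := by
      rw [hσ w (by omega)]; simp only [Store.setVar_var]; rw [if_neg (by omega)]
    refine ⟨σ, _, Runs.loop_stop ?_, rfl, fun _ _ _ => rfl, rfl, ?_, ?_⟩
    · simp only [Term.eval, Op.eval, hvx, hvw]; omega
    · rw [hacc]; simp at hi; rw [hi]
    · simp only [Term.eval, Term.cost, hvx, hvw]
      have h1 := hs.var w
      have h2 : bits (i : ℤ) ≤ ℓ := bits_natCast_le_of_lt_toNat (by omega) (hs.var w)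
      have h3 := Op.bits_eval_le .sub (s.var w) i
      simp only [Op.cost, len_eq] at *
      omega
  | succ k ih =>
    intro i σ hi hσ harr hacc
    have hvx : σ.var x = i := by rw [hσ x hx]; simp
    have hvw : σ.var w = s.var w := by
      rw [hσ w (by omega)]; simp only [Store.setVar_var]; rw [if_neg (by omega)]
    obtain ⟨hb, σ₁, τ₁, hr, ha₁, hv₁, ht₁, hτ₁⟩ := hu _ σ (hgood i (by omega)) hσ harr
    have hvx₁ : σ₁.var x = i := by rw [hv₁ x (by omega), hvx]
    set σ₂ := σ₁.setVar t (Term.eval σ₁ (.op .add (.var t) (.var (t + 2)))) with hσ₂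
    set σ₃ := σ₂.setVar x (Term.eval σ₂ (.op .add (.var x) (.const 1))) with hσ₃
    have e2 : Term.eval σ₁ (.op .add (.var t) (.var (t + 2))) =
        ∑ j ∈ Finset.range (i + 1), u.eval (s.setVar x j) := by
      simp only [Term.eval, Op.eval]
      rw [hv₁ t (by omega), hacc, ht₁, Finset.sum_range_succ]
    have hvx₂ : σ₂.var x = i := by
      rw [hσ₂]; simp only [Store.setVar_var]; rw [if_neg (by omega), hvx₁]
    have e3 : Term.eval σ₂ (.op .add (.var x) (.const 1)) = ((i + 1 : ℕ) : ℤ) := by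
      simp only [Term.eval, Op.eval, hvx₂]; push_cast; ring
    have hother : ∀ y, y < t + 2 → y ≠ x → y ≠ t → σ₃.var y = σ.var y := by
      intro y h1 h2 h3
      simp only [hσ₃, hσ₂, Store.setVar_var, if_neg h2, if_neg h3, hv₁ y h1]
    obtain ⟨σ', τ, hl, hla, hlv, hl1, hlt, hτ⟩ := ih (i + 1) σ₃ (by omega) (by
        intro y hy
        by_cases hyx : y = x
        · subst hyx
          rw [hσ₃, e3]
          simp
        · rw [hother y (by omega) hyx (by omega), hσ y hy]
          simp [hyx]) (by rw [← harr, ← ha₁, hσ₃, hσ₂]; rfl) (by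
        have : t ≠ x := by omega
        rw [hσ₃]
        simp only [Store.setVar_var, if_neg this, hσ₂, e2, if_true])
    refine ⟨σ', _, Runs.loop_step ?_ (Runs.seq hr (Runs.seq (Runs.assign _ _ _)
      (Runs.assign _ _ _))) hl, ?_, ?_, ?_, hlt, ?_⟩
    · simp only [Term.eval, Op.eval, hvx, hvw]; omega
    · rw [hla, ← ha₁, hσ₃, hσ₂]; rfl
    · intro y hy hyx
      rw [hlv y hy hyx, hother y (by omega) hyx (by omega)]
    · rw [hl1, hother (t + 1) (by omega) (by omega) (by omega)]
    · have h1 := hs.var w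
      have h2 : bits (i : ℤ) ≤ ℓ := bits_natCast_le_of_lt_toNat (by omega) (hs.var w)
      have h2' : bits ((i + 1 : ℕ) : ℤ) ≤ ℓ := bits_natCast_le_of_lt_toNat (by omega) (hs.var w)
      have h3 := Op.bits_eval_le .sub (s.var w) i
      have hf : ∀ j < (s.var w).toNat, bits (u.eval (s.setVar x j)) ≤ C * ℓ := fun j hj =>
        (hu _ _ (hgood j hj.le) (fun _ _ => rfl) rfl).1
      have h4 := bits_sum_le (i := i) (by omega) hN hf
      have h4' := bits_sum_le (i := i + 1) (by omega) hN hf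
      have hc1 : bits 1 ≤ 1 := by decide
      rw [← hσ₂, e2, e3]
      have hat : σ₁.var t = ∑ j ∈ Finset.range i, u.eval (s.setVar x j) := by
        rw [hv₁ t (by omega), hacc]
      simp only [Term.eval, Term.cost, hvx, hvw, hvx₂, hat, ht₁, Op.cost, len_eq] at *
      rw [Nat.succ_mul]
      omega

/-- The constants depend on the expression alone. Lengths of intermediate values stay linear in `ℓ`,
schoolbook multiplication makes the cost quadratic, and every nested sum contributes a factor `Y +
1`, because its bound is one of the variables below `8`. The store `s` defines the value, whereas
`σ` is the machine, which may differ from `s` in the temporaries from `64` on. -/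
theorem Expr.compile_spec (u : Expr) (hu : u.Fits) : ∃ C D : ℕ, ∀ (t ℓ Y : ℕ) (s σ : Store),
    64 ≤ t → 1 ≤ ℓ → Good ℓ Y s → (∀ x < 64, σ.var x = s.var x) → σ.arr = s.arr →
    bits (u.eval s) ≤ C * ℓ ∧ ∃ σ' τ, Runs (u.compile t) σ σ' τ ∧ σ'.arr = σ.arr ∧
      (∀ x < t, σ'.var x = σ.var x) ∧ σ'.var t = u.eval s ∧ τ ≤ C * (Y + 1) ^ D * ℓ ^ 2 := by
  induction u with
  | const z =>
    refine ⟨2 * len z, 0, fun t ℓ Y s σ ht hℓ hs hσ harr => ⟨?_, _, _, Runs.assign _ _ _, rfl,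
      fun x hx => ?_, ?_, ?_⟩⟩
    · simp only [Expr.eval, len_eq]; nlinarith
    · simp only [Store.setVar_var]; rw [if_neg (by omega)]
    · simp [Term.eval, Expr.eval]
    · simp only [Term.eval, Term.cost]
      have : 1 ≤ ℓ ^ 2 := Nat.one_le_pow _ _ hℓ
      nlinarith
  | var x =>
    refine ⟨4, 0, fun t ℓ Y s σ ht hℓ hs hσ harr => ⟨?_, _, _, Runs.assign _ _ _, rfl,
      fun y hy => ?_, ?_, ?_⟩⟩
    · have := hs.var x; simp only [Expr.eval]; omega
    · simp only [Store.setVar_var]; rw [if_neg (by omega)]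
    · simp [Term.eval, Expr.eval, hσ x hu]
    · simp only [Term.eval, Term.cost, hσ x hu, len_eq]
      have := hs.var x
      nlinarith
  | read a i ih =>
    obtain ⟨C, D, h⟩ := ih hu
    refine ⟨C + 5 * (C + 2) ^ 2, D, fun t ℓ Y s σ ht hℓ hs hσ harr => ?_⟩
    obtain ⟨hb, σ', τ, hr, ha, hv, hvt, hτ⟩ := h t ℓ Y s σ ht hℓ hs hσ harr
    refine ⟨?_, _, _, Runs.seq hr (Runs.assign _ _ _), ha, fun y hy => ?_, ?_, ?_⟩
    · have := hs.arr a (i.eval s); simp only [Expr.eval]; nlinarith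
    · simp only [Store.setVar_var]; rw [if_neg (by omega), hv y hy]
    · simp [Term.eval, Expr.eval, hvt, ha, harr]
    · simp only [Term.eval, Term.cost, hvt, ha, harr, len_eq]
      have h1 := hs.arr a (i.eval s)
      have h2 := sq_le_poly (C + 2) D Y ℓ
      have h3 : (C + 2) * ℓ ≤ ((C + 2) * ℓ) ^ 2 := Nat.le_self_pow (by norm_num) _
      have h4 : (C + 2) * ℓ = C * ℓ + 2 * ℓ := by ring
      calc _ ≤ C * (Y + 1) ^ D * ℓ ^ 2 + 5 * ((C + 2) ^ 2 * (Y + 1) ^ D * ℓ ^ 2) := by omega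
        _ = _ := by ring
  | op o u v ihu ihv =>
    obtain ⟨C₁, D₁, h₁⟩ := ihu hu.1
    obtain ⟨C₂, D₂, h₂⟩ := ihv hu.2
    refine ⟨C₁ + C₂ + 5 * (C₁ + C₂ + 2) ^ 2, D₁ + D₂, fun t ℓ Y s σ ht hℓ hs hσ harr => ?_⟩
    obtain ⟨hb, σ', τ, hr, ha, hv, hvt, hτ⟩ := h₁ t ℓ Y s σ ht hℓ hs hσ harr
    obtain ⟨hb', σ'', τ', hr', ha', hv', hvt', hτ'⟩ := h₂ (t + 1) ℓ Y s σ' (by omega) hℓ hs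
      (fun x hx => by rw [hv x (by omega), hσ x hx]) (ha.trans harr)
    have hvt'' : σ''.var t = u.eval s := by rw [hv' t (by omega), hvt]
    have h0 := o.bits_eval_le (u.eval s) (v.eval s)
    refine ⟨?_, _, _, Runs.seq hr (Runs.seq hr' (Runs.assign _ _ _)), ha'.trans ha,
      fun y hy => ?_, ?_, ?_⟩
    · simp only [Expr.eval]; nlinarith
    · simp only [Store.setVar_var]; rw [if_neg (by omega), hv' y (by omega), hv y hy]
    · simp [Term.eval, Expr.eval, hvt'', hvt']
    · have h2 := sq_le_poly (C₁ + C₂ + 2) (D₁ + D₂) Y ℓ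
      have h3 : (C₁ + C₂ + 2) * ℓ ≤ ((C₁ + C₂ + 2) * ℓ) ^ 2 := Nat.le_self_pow (by norm_num) _
      have h4 : (C₁ + C₂ + 2) * ℓ = C₁ * ℓ + C₂ * ℓ + 2 * ℓ := by ring
      have h5 := le_poly_of_le hτ le_rfl (Nat.le_add_right D₁ D₂)
      have h6 := le_poly_of_le hτ' le_rfl (Nat.le_add_left D₂ D₁)
      have h7 := o.cost_le (q := (C₁ + C₂ + 2) * ℓ) (a := u.eval s) (b := v.eval s) (by omega)
        (by rw [len_eq]; omega) (by rw [len_eq]; omega)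
      simp only [Term.eval, Term.cost, hvt'', hvt', len_eq]
      calc _ ≤ C₁ * (Y + 1) ^ (D₁ + D₂) * ℓ ^ 2 + C₂ * (Y + 1) ^ (D₁ + D₂) * ℓ ^ 2 +
            5 * ((C₁ + C₂ + 2) ^ 2 * (Y + 1) ^ (D₁ + D₂) * ℓ ^ 2) := by omega
        _ = _ := by ring
  | sum x w u ih =>
    obtain ⟨hx8, hx, hw, hfu⟩ := hu
    obtain ⟨C, D, h⟩ := ih hfu
    refine ⟨C + 15 * (C + 4) ^ 2, D + 1, fun t ℓ Y s σ ht hℓ hs hσ harr => ?_⟩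
    have hN : bits ((s.var w).toNat : ℤ) ≤ ℓ := bits_natCast_le_of_lt_toNat le_rfl (hs.var w)
    have hf : ∀ j < (s.var w).toNat, bits (u.eval (s.setVar x j)) ≤ C * ℓ := fun j hj =>
      (h 64 ℓ Y _ _ le_rfl hℓ (hs.setVar (bits_natCast_le_of_lt_toNat hj.le (hs.var w))
        (by omega)) (fun _ _ => rfl) rfl).1
    set σ₁ := σ.setVar t (Term.eval σ (.const 0)) with hσ₁
    set σ₂ := σ₁.setVar (t + 1) (Term.eval σ₁ (.var x)) with hσ₂
    set σ₃ := σ₂.setVar x (Term.eval σ₂ (.const 0)) with hσ₃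
    have hx1 : σ₁.var x = s.var x := by
      rw [hσ₁]; simp only [Store.setVar_var]; rw [if_neg (by omega), hσ x hx]
    have h31 : σ₃.var (t + 1) = s.var x := by
      rw [hσ₃]; simp only [Store.setVar_var]
      rw [if_neg (by omega), hσ₂]; simp [Term.eval, hx1]
    obtain ⟨σ', τ, hl, hla, hlv, hl1, hlt, hτ⟩ := Expr.runs_sum_loop hx hx8 hw ht hℓ hs
      (fun s' σ => h (t + 2) ℓ Y s' σ (by omega) hℓ) (s.var w).toNat 0 σ₃ (by omega) (by
        intro y hy
        simp only [hσ₃, hσ₂, hσ₁, Store.setVar_var, Term.eval]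
        split_ifs <;> first | omega | simp [hσ y hy])
        (by rw [← harr]; rfl) (by
        simp only [hσ₃, hσ₂, hσ₁, Store.setVar_var, Term.eval]
        rw [if_neg (by omega), if_neg (by omega)]
        simp)
    refine ⟨?_, _, _, Runs.seq (Runs.assign _ _ _) (Runs.seq (Runs.assign _ _ _)
      (Runs.seq (Runs.assign _ _ _) (Runs.seq hl (Runs.assign _ _ _)))), hla, fun y hy => ?_,
      ?_, ?_⟩
    · have := bits_sum_le le_rfl hN hf
      simp only [Expr.eval]
      nlinarith
    · simp only [Store.setVar_var]
      split_ifs with hyx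
      · simp only [Term.eval]
        rw [hl1, h31, hyx, hσ x hx]
      · rw [hlv y hy hyx]
        simp only [hσ₃, hσ₂, hσ₁, Store.setVar_var, Term.eval]
        rw [if_neg hyx, if_neg (by omega), if_neg (by omega)]
    · simp only [Store.setVar_var]
      rw [if_neg (by omega), hlt]
      rfl
    · have h1 := hs.var x
      have h2 : (s.var w).toNat ≤ Y := by have := hs.small w hw; omega
      have h3 : (C + 4) * ℓ ≤ ((C + 4) * ℓ) ^ 2 := Nat.le_self_pow (by norm_num) _
      have h4 : (C + 4) * ℓ = C * ℓ + 4 * ℓ := by ring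
      have hc0 : bits 0 = 0 := by decide
      have h31' : σ'.var (t + 1) = s.var x := hl1.trans h31
      have hx1' : (σ.setVar t 0).var x = s.var x := hx1
      have h5 := Nat.mul_le_mul_right (C * (Y + 1) ^ D * ℓ ^ 2 + 15 * ((C + 4) * ℓ) ^ 2) h2
      simp only [Term.eval, Term.cost, len_eq, hc0, hx1', h31']
      have h6 := sq_le_poly (C + 4) D Y ℓ
      calc _ ≤ (Y + 1) * (C * (Y + 1) ^ D * ℓ ^ 2 + 15 * ((C + 4) * ℓ) ^ 2) := by
            rw [Nat.add_mul]; omega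
        _ ≤ (Y + 1) * (C * (Y + 1) ^ D * ℓ ^ 2 + 15 * ((C + 4) ^ 2 * (Y + 1) ^ D * ℓ ^ 2)) := by
            gcongr
        _ = _ := by ring

end RAM

namespace RAM

/-! ## Programs with bounded loops -/

/-- Programs with bounded loops and with bounded sums in the expressions. -/
inductive Stmt where
  | assign (x : ℕ) (u : Expr)
  | write (a : ℕ) (i u : Expr)
  | seq (p q : Stmt)
  | loop (x : ℕ) (b : Expr) (p : Stmt)

/-- Executing the program `p` leads from `s` to `s'` in at most `n` steps, and all values that it
stores have at most `ℓ` bits; those in the variables below `8` are at most `Y`. -/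
def Stmt.Exec (ℓ Y : ℕ) : Stmt → Store → Store → ℕ → Prop
  | .assign x u, s, s', n =>
    bits (u.eval s) ≤ ℓ ∧ (x < 8 → u.eval s ≤ Y) ∧ s' = s.setVar x (u.eval s) ∧ 1 ≤ n
  | .write a i u, s, s', n => bits (u.eval s) ≤ ℓ ∧ s' = s.setArr a (i.eval s) (u.eval s) ∧ 1 ≤ n
  | .seq p q, s, s', n => ∃ s₁ n₁ n₂, p.Exec ℓ Y s s₁ n₁ ∧ q.Exec ℓ Y s₁ s' n₂ ∧ n₁ + n₂ ≤ n
  | .loop x b p, s, s', n => ∃ (f : ℕ → Store) (m : ℕ), f 0 = s ∧ f (b.eval s).toNat = s' ∧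
      bits ((b.eval s).toNat : ℤ) ≤ ℓ ∧
      (∀ i < (b.eval s).toNat, p.Exec ℓ Y ((f i).setVar x i) (f (i + 1)) m) ∧
      1 + (b.eval s).toNat * (m + 1) ≤ n

/-- The variables are below `64`; those of loops are not below `8`. -/
def Stmt.Fits : Stmt → Prop
  | .assign x u => x < 64 ∧ u.Fits
  | .write _ i u => i.Fits ∧ u.Fits
  | .seq p q => p.Fits ∧ q.Fits
  | .loop x b p => 8 ≤ x ∧ x < 64 ∧ b.Fits ∧ p.Fits

/-- The variables that a program may change. -/
def Stmt.vars : Stmt → List ℕ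
  | .assign x _ => [x]
  | .write _ _ _ => []
  | .seq p q => p.vars ++ q.vars
  | .loop x _ p => x :: p.vars

/-- The arrays that a program may change. -/
def Stmt.arrs : Stmt → List ℕ
  | .assign _ _ => []
  | .write a _ _ => [a]
  | .seq p q => p.arrs ++ q.arrs
  | .loop _ _ p => p.arrs

/-- The translation to random access machines. -/
def Stmt.compile : Stmt → ℕ → Prog
  | .assign x u, t => .seq (u.compile t) (.assign x (.var t))
  | .write a i u, t =>
    .seq (i.compile t) (.seq (u.compile (t + 1)) (.write a (.var t) (.var (t + 1))))
  | .seq p q, t => .seq (p.compile t) (q.compile t)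
  | .loop x b p, t =>
    .seq (b.compile t) (.seq (.assign (t + 1) (.const 0))
      (.loop (.op .sub (.var t) (.var (t + 1)))
        (.seq (.assign x (.var (t + 1))) (.seq (p.compile (t + 2))
          (.assign (t + 1) (.op .add (.var (t + 1)) (.const 1)))))))

theorem Stmt.Exec.mono {ℓ Y : ℕ} {p : Stmt} {s s' : Store} {n n' : ℕ} (h : p.Exec ℓ Y s s' n)
    (hn : n ≤ n') : p.Exec ℓ Y s s' n' := by
  cases p with
  | assign x u => exact ⟨h.1, h.2.1, h.2.2.1, h.2.2.2.trans hn⟩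
  | write a i u => exact ⟨h.1, h.2.1, h.2.2.trans hn⟩
  | seq p q =>
    obtain ⟨s₁, n₁, n₂, h1, h2, h3⟩ := h
    exact ⟨s₁, n₁, n₂, h1, h2, h3.trans hn⟩
  | loop x b p =>
    obtain ⟨f, m, h1, h2, h3, h4, h5⟩ := h
    exact ⟨f, m, h1, h2, h3, h4, h5.trans hn⟩

/-- The store `s'` agrees with `s` outside the variables `vs` and the arrays `as`. -/
def Frame (vs as : List ℕ) (s s' : Store) : Prop :=
  (∀ x, x ∉ vs → s'.var x = s.var x) ∧ ∀ a, a ∉ as → s'.arr a = s.arr a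

theorem Frame.refl (vs as : List ℕ) (s : Store) : Frame vs as s s :=
  ⟨fun _ _ => rfl, fun _ _ => rfl⟩

theorem Frame.trans {vs as vs' as' : List ℕ} {s s' s'' : Store} (h : Frame vs as s s')
    (h' : Frame vs' as' s' s'') : Frame (vs ++ vs') (as ++ as') s s'' := by
  constructor
  · intro x hx
    rw [List.mem_append, not_or] at hx
    rw [h'.1 x hx.2, h.1 x hx.1]
  · intro x hx
    rw [List.mem_append, not_or] at hx
    rw [h'.2 x hx.2, h.2 x hx.1]

theorem Frame.mono {vs as vs' as' : List ℕ} {s s' : Store} (h : Frame vs as s s')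
    (hv : vs ⊆ vs') (ha : as ⊆ as') : Frame vs' as' s s' :=
  ⟨fun x hx => h.1 x fun hx' => hx (hv hx'), fun x hx => h.2 x fun hx' => hx (ha hx')⟩

theorem Frame.trans_self {vs as : List ℕ} {s s' s'' : Store} (h : Frame vs as s s')
    (h' : Frame vs as s' s'') : Frame vs as s s'' :=
  (h.trans h').mono (by simp) (by simp)

/-- Only variables and arrays that occur as targets in the program text can change. Facts about all
others are therefore transported later by a purely syntactic check. -/
theorem Stmt.Exec.good_frame {ℓ Y : ℕ} {p : Stmt} (hp : p.Fits) {s s' : Store} {n : ℕ}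
    (h : p.Exec ℓ Y s s' n) (hs : Good ℓ Y s) : Good ℓ Y s' ∧ Frame p.vars p.arrs s s' := by
  induction p generalizing s s' n with
  | assign x u =>
    obtain ⟨h1, h2, rfl, -⟩ := h
    refine ⟨hs.setVar h1 h2, fun y hy => ?_, fun _ _ => rfl⟩
    simp only [Stmt.vars, List.mem_singleton] at hy
    simp [hy]
  | write a i u =>
    obtain ⟨h1, rfl, -⟩ := h
    refine ⟨hs.setArr h1, fun _ _ => rfl, fun b hb => ?_⟩
    simp only [Stmt.arrs, List.mem_singleton] at hb
    funext j
    simp [Store.setArr_arr, hb]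
  | seq p q ihp ihq =>
    obtain ⟨s₁, n₁, n₂, h1, h2, -⟩ := h
    have a := ihp hp.1 h1 hs
    have b := ihq hp.2 h2 a.1
    exact ⟨b.1, a.2.trans b.2⟩
  | loop x b p ih =>
    obtain ⟨f, m, h1, rfl, h3, h4, -⟩ := h
    have key : ∀ i ≤ (b.eval s).toNat, Good ℓ Y (f i) ∧ Frame (x :: p.vars) p.arrs s (f i) := by
      intro i
      induction i with
      | zero => exact fun _ => by rw [h1]; exact ⟨hs, Frame.refl _ _ _⟩
      | succ i ihi =>
        intro hi
        obtain ⟨g, fr⟩ := ihi (by omega)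
        have h8 := hp.1
        have := ih hp.2.2.2 (h4 i (by omega)) (g.setVar
          ((bits_mono (by omega)).trans h3) (by omega))
        refine ⟨this.1, (fr.trans_self (s' := f i) (s'' := (f i).setVar x i) ⟨fun y hy => ?_,
          fun _ _ => rfl⟩).trans_self (this.2.mono (by simp) (by simp))⟩
        simp only [List.mem_cons, not_or] at hy
        simp [hy.1]
    exact key _ le_rfl

/-- The machine counts in the temporary `t + 1` and copies the count to `x` at the start of each
iteration, so the body is free to overwrite `x`. The bound is evaluated once, into `t`, and the body
works from `t + 2` on. The stores `f i` are those between the iterations. -/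
theorem Stmt.runs_loop {x t C D ℓ Y N m q : ℕ} {p : Stmt} {B : ℤ} {f : ℕ → Store} (hx : x < 64)
    (ht : 64 ≤ t) (hN : B.toNat = N) (hBq : bits B + 2 ≤ q) (hNq : ℓ + bits B + 2 ≤ q)
    (hNℓ : bits (N : ℤ) ≤ ℓ)
    (hf : ∀ i < N, ∀ σ : Store, (∀ y < 64, σ.var y = ((f i).setVar x i).var y) →
      σ.arr = (f i).arr → ∃ σ' τ, Runs (p.compile (t + 2)) σ σ' τ ∧
        (∀ y < 64, σ'.var y = (f (i + 1)).var y) ∧ σ'.arr = (f (i + 1)).arr ∧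
        (∀ y, 64 ≤ y → y < t + 2 → σ'.var y = σ.var y) ∧ τ ≤ C * (Y + 1) ^ D * ℓ ^ 2 * m) (k : ℕ) :
    ∀ (i : ℕ) (σ : Store), i + k = N → (∀ y < 64, σ.var y = (f i).var y) →
      σ.arr = (f i).arr → σ.var t = B → σ.var (t + 1) = i →
      ∃ σ' τ, Runs (.loop (.op .sub (.var t) (.var (t + 1)))
        (.seq (.assign x (.var (t + 1))) (.seq (p.compile (t + 2))
          (.assign (t + 1) (.op .add (.var (t + 1)) (.const 1)))))) σ σ' τ ∧
        (∀ y < 64, σ'.var y = (f N).var y) ∧ σ'.arr = (f N).arr ∧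
        (∀ y, 64 ≤ y → y < t → σ'.var y = σ.var y) ∧
        τ ≤ k * (C * (Y + 1) ^ D * ℓ ^ 2 * m + 15 * q ^ 2) + 5 * q ^ 2 := by
  have hqq : q ≤ q ^ 2 := Nat.le_self_pow (by norm_num) q
  have hc1 : bits 1 ≤ 1 := by decide
  induction k with
  | zero =>
    intro i σ hi hσ harr hB hc
    refine ⟨σ, _, Runs.loop_stop ?_, ?_, ?_, fun _ _ _ => rfl, ?_⟩
    · simp only [Term.eval, Op.eval, hB, hc]; omega
    · rw [← hi]; exact hσ
    · rw [← hi]; exact harr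
    · simp only [Term.eval, Term.cost, hB, hc]
      have h2 : bits (i : ℤ) ≤ ℓ := (bits_mono (by omega)).trans hNℓ
      have h3 := Op.bits_eval_le .sub B i
      simp only [Op.cost, len_eq] at *
      omega
  | succ k ih =>
    intro i σ hi hσ harr hB hc
    have hi1 : bits (i : ℤ) ≤ ℓ := (bits_mono (by omega)).trans hNℓ
    have hi2 : bits ((i + 1 : ℕ) : ℤ) ≤ ℓ := (bits_mono (by omega)).trans hNℓ
    set σ₁ := σ.setVar x (Term.eval σ (.var (t + 1))) with hσ₁
    have e1 : Term.eval σ (.var (t + 1)) = i := hc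
    obtain ⟨σ₂, τ₂, hr, hv₂, ha₂, hk₂, hτ₂⟩ := hf i (by omega) σ₁ (by
      intro y hy
      rw [hσ₁, e1]
      simp only [Store.setVar_var, hσ y hy]) harr
    have hk₂' : ∀ y, 64 ≤ y → y < t + 2 → σ₂.var y = σ.var y := by
      intro y hy hy'
      rw [hk₂ y hy hy', hσ₁]
      simp only [Store.setVar_var]
      rw [if_neg (by omega)]
    set σ₃ := σ₂.setVar (t + 1) (Term.eval σ₂ (.op .add (.var (t + 1)) (.const 1))) with hσ₃
    have e3 : Term.eval σ₂ (.op .add (.var (t + 1)) (.const 1)) = ((i + 1 : ℕ) : ℤ) := by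
      simp only [Term.eval, Op.eval]
      rw [hk₂' (t + 1) (by omega) (by omega), hc]
      push_cast; ring
    obtain ⟨σ', τ, hl, hlv, hla, hlk, hτ⟩ := ih (i + 1) σ₃ (by omega) (by
        intro y hy
        rw [hσ₃]
        simp only [Store.setVar_var]
        rw [if_neg (by omega), hv₂ y hy]) ha₂ (by
        rw [hσ₃]
        simp only [Store.setVar_var]
        rw [if_neg (by omega), hk₂' t (by omega) (by omega), hB]) (by
        rw [hσ₃, e3]
        simp)
    refine ⟨σ', _, Runs.loop_step ?_ (Runs.seq (Runs.assign _ _ _) (Runs.seq hr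
      (Runs.assign _ _ _))) hl, hlv, hla, ?_, ?_⟩
    · simp only [Term.eval, Op.eval, hB, hc]; omega
    · intro y hy hyt
      rw [hlk y hy hyt, hσ₃]
      simp only [Store.setVar_var]
      rw [if_neg (by omega), hk₂' y hy (by omega)]
    · have h3 := Op.bits_eval_le .sub B i
      have hct : σ₂.var (t + 1) = i := by rw [hk₂' (t + 1) (by omega) (by omega), hc]
      rw [e3]
      simp only [Term.eval, Term.cost, hB, hc, hct, Op.cost, len_eq] at *
      rw [Nat.succ_mul]
      omega

/-- The number of iterations of a loop enters only through `n`, not through the polynomial factor.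
Loops may thus be exponentially long, while sums inside expressions have to be short. -/
theorem Stmt.compile_spec (p : Stmt) (hp : p.Fits) : ∃ C D : ℕ, ∀ (t ℓ Y : ℕ) (s s' σ : Store)
    (n : ℕ), 64 ≤ t → 1 ≤ ℓ → Good ℓ Y s → (∀ x < 64, σ.var x = s.var x) → σ.arr = s.arr →
    p.Exec ℓ Y s s' n → ∃ σ' τ, Runs (p.compile t) σ σ' τ ∧ (∀ x < 64, σ'.var x = s'.var x) ∧
      σ'.arr = s'.arr ∧ (∀ x, 64 ≤ x → x < t → σ'.var x = σ.var x) ∧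
      τ ≤ C * (Y + 1) ^ D * ℓ ^ 2 * n := by
  induction p with
  | assign x u =>
    obtain ⟨C, D, h⟩ := u.compile_spec hp.2
    refine ⟨C + 2 * (C + 2) ^ 2, D, fun t ℓ Y s s' σ n ht hℓ hs hσ harr hE => ?_⟩
    obtain ⟨h1, h2, rfl, h3⟩ := hE
    obtain ⟨hb, σ', τ, hr, ha, hv, hvt, hτ⟩ := h t ℓ Y s σ ht hℓ hs hσ harr
    refine ⟨_, _, Runs.seq hr (Runs.assign _ _ _), fun y hy => ?_, ha.trans harr,
      fun y hy hy' => ?_, ?_⟩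
    · simp only [Store.setVar_var, Term.eval, hvt, hv y (by omega), hσ y hy]
    · have := hp.1
      simp only [Store.setVar_var]
      rw [if_neg (by omega), hv y hy']
    · simp only [Term.eval, Term.cost, hvt, len_eq]
      have h2 := sq_le_poly (C + 2) D Y ℓ
      have h3' : (C + 2) * ℓ ≤ ((C + 2) * ℓ) ^ 2 := Nat.le_self_pow (by norm_num) _
      have h4 : (C + 2) * ℓ = C * ℓ + 2 * ℓ := by ring
      calc _ ≤ C * (Y + 1) ^ D * ℓ ^ 2 + 2 * ((C + 2) ^ 2 * (Y + 1) ^ D * ℓ ^ 2) := by omega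
        _ = (C + 2 * (C + 2) ^ 2) * (Y + 1) ^ D * ℓ ^ 2 * 1 := by ring
        _ ≤ _ := by gcongr
  | write a i u =>
    obtain ⟨C₁, D₁, h₁⟩ := i.compile_spec hp.1
    obtain ⟨C₂, D₂, h₂⟩ := u.compile_spec hp.2
    refine ⟨C₁ + C₂ + 4 * (C₁ + C₂ + 2) ^ 2, D₁ + D₂, fun t ℓ Y s s' σ n ht hℓ hs hσ harr hE => ?_⟩
    obtain ⟨h1, rfl, h3⟩ := hE
    obtain ⟨hb, σ', τ, hr, ha, hv, hvt, hτ⟩ := h₁ t ℓ Y s σ ht hℓ hs hσ harr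
    obtain ⟨hb', σ'', τ', hr', ha', hv', hvt', hτ'⟩ := h₂ (t + 1) ℓ Y s σ' (by omega) hℓ hs
      (fun x hx => by rw [hv x (by omega), hσ x hx]) (ha.trans harr)
    have hvt'' : σ''.var t = i.eval s := by rw [hv' t (by omega), hvt]
    have ha'' : σ''.arr = s.arr := ha'.trans (ha.trans harr)
    refine ⟨_, _, Runs.seq hr (Runs.seq hr' (Runs.write _ _ _ _)), fun y hy => ?_, ?_,
      fun y hy hy' => ?_, ?_⟩
    · simp only [Store.setArr_var]
      rw [hv' y (by omega), hv y (by omega), hσ y hy]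
    · simp only [Store.setArr, Term.eval, hvt'', hvt', ha'']
    · simp only [Store.setArr_var]
      rw [hv' y (by omega), hv y (by omega)]
    · simp only [Term.eval, Term.cost, hvt'', hvt', len_eq]
      have h2 := sq_le_poly (C₁ + C₂ + 2) (D₁ + D₂) Y ℓ
      have h3' : (C₁ + C₂ + 2) * ℓ ≤ ((C₁ + C₂ + 2) * ℓ) ^ 2 := Nat.le_self_pow (by norm_num) _
      have h4 : (C₁ + C₂ + 2) * ℓ = C₁ * ℓ + C₂ * ℓ + 2 * ℓ := by ring
      have h5 := le_poly_of_le hτ le_rfl (Nat.le_add_right D₁ D₂)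
      have h6 := le_poly_of_le hτ' le_rfl (Nat.le_add_left D₂ D₁)
      calc _ ≤ C₁ * (Y + 1) ^ (D₁ + D₂) * ℓ ^ 2 + C₂ * (Y + 1) ^ (D₁ + D₂) * ℓ ^ 2 +
            4 * ((C₁ + C₂ + 2) ^ 2 * (Y + 1) ^ (D₁ + D₂) * ℓ ^ 2) := by omega
        _ = (C₁ + C₂ + 4 * (C₁ + C₂ + 2) ^ 2) * (Y + 1) ^ (D₁ + D₂) * ℓ ^ 2 * 1 := by ring
        _ ≤ _ := by gcongr
  | seq p q ihp ihq =>
    obtain ⟨C₁, D₁, h₁⟩ := ihp hp.1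
    obtain ⟨C₂, D₂, h₂⟩ := ihq hp.2
    refine ⟨C₁ + C₂, D₁ + D₂, fun t ℓ Y s s' σ n ht hℓ hs hσ harr hE => ?_⟩
    obtain ⟨s₁, n₁, n₂, e₁, e₂, hn⟩ := hE
    obtain ⟨σ₁, τ₁, r₁, v₁, a₁, k₁, t₁⟩ := h₁ t ℓ Y s s₁ σ n₁ ht hℓ hs hσ harr e₁
    obtain ⟨σ₂, τ₂, r₂, v₂, a₂, k₂, t₂⟩ := h₂ t ℓ Y s₁ s' σ₁ n₂ ht hℓ (e₁.good_frame hp.1 hs).1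
      v₁ a₁ e₂
    refine ⟨σ₂, _, Runs.seq r₁ r₂, v₂, a₂, fun y hy hy' => by rw [k₂ y hy hy', k₁ y hy hy'], ?_⟩
    have h5 : C₁ * (Y + 1) ^ D₁ * ℓ ^ 2 ≤ (C₁ + C₂) * (Y + 1) ^ (D₁ + D₂) * ℓ ^ 2 :=
      le_poly_of_le le_rfl (by omega) (by omega)
    have h6 : C₂ * (Y + 1) ^ D₂ * ℓ ^ 2 ≤ (C₁ + C₂) * (Y + 1) ^ (D₁ + D₂) * ℓ ^ 2 :=
      le_poly_of_le le_rfl (by omega) (by omega)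
    calc τ₁ + τ₂ ≤ (C₁ + C₂) * (Y + 1) ^ (D₁ + D₂) * ℓ ^ 2 * n₁ +
          (C₁ + C₂) * (Y + 1) ^ (D₁ + D₂) * ℓ ^ 2 * n₂ :=
          add_le_add (t₁.trans (Nat.mul_le_mul_right _ h5)) (t₂.trans (Nat.mul_le_mul_right _ h6))
      _ = (C₁ + C₂) * (Y + 1) ^ (D₁ + D₂) * ℓ ^ 2 * (n₁ + n₂) := by ring
      _ ≤ _ := Nat.mul_le_mul_left _ hn
  | loop x b p ih =>
    obtain ⟨C₁, D₁, h₁⟩ := b.compile_spec hp.2.2.1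
    obtain ⟨C₂, D₂, h₂⟩ := ih hp.2.2.2
    refine ⟨C₁ + C₂ + 15 * (C₁ + 3) ^ 2, D₁ + D₂, fun t ℓ Y s s' σ n ht hℓ hs hσ harr hE => ?_⟩
    have hE' := hE
    obtain ⟨f, m, hf0, rfl, hbN, hf, hn⟩ := hE
    obtain ⟨hb, σ₁, τ₁, r₁, a₁, v₁, vt₁, t₁⟩ := h₁ t ℓ Y s σ ht hℓ hs hσ harr
    set N := (b.eval s).toNat with hN
    have hgood : ∀ i ≤ N, Good ℓ Y (f i) := by
      intro i
      induction i with
      | zero => exact fun _ => hf0 ▸ hs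
      | succ i ihi =>
        intro hi
        exact ((hf i (by omega)).good_frame hp.2.2.2 ((ihi (by omega)).setVar
          ((bits_mono (by omega)).trans hbN) (by have := hp.1; omega))).1
    obtain ⟨σ', τ, hl, hlv, hla, hlk, hτ⟩ := Stmt.runs_loop (q := (C₁ + 3) * ℓ) hp.2.1 ht hN.symm
      (by nlinarith) (by nlinarith) hbN
      (fun i hi σ h1 h2 => h₂ (t + 2) ℓ Y _ _ σ m (by omega) hℓ ((hgood i hi.le).setVar
        ((bits_mono (by omega)).trans hbN) (by have := hp.1; omega)) h1 h2 (hf i hi)) N 0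
      (σ₁.setVar (t + 1) (Term.eval σ₁ (.const 0))) (by omega) (by
        intro y hy
        simp only [Store.setVar_var]
        rw [if_neg (by omega), v₁ y (by omega), hσ y hy, hf0]) (by
        rw [hf0]; exact a₁.trans harr) (by simp [vt₁]) (by simp [Term.eval])
    refine ⟨σ', _, Runs.seq r₁ (Runs.seq (Runs.assign _ _ _) hl), hlv, hla, fun y hy hy' => ?_, ?_⟩
    · rw [hlk y hy hy']
      simp only [Store.setVar_var]
      rw [if_neg (by omega), v₁ y (by omega)]
    · have hc0 : bits 0 = 0 := by decide
      simp only [Term.eval, Term.cost, len_eq, hc0]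
      set S := (Y + 1) ^ (D₁ + D₂) * ℓ ^ 2 with hS
      have h2 : ((C₁ + 3) * ℓ) ^ 2 ≤ (C₁ + 3) ^ 2 * S := by
        rw [hS, ← mul_assoc]; exact sq_le_poly (C₁ + 3) (D₁ + D₂) Y ℓ
      have h3 : (C₁ + 3) * ℓ ≤ ((C₁ + 3) * ℓ) ^ 2 := Nat.le_self_pow (by norm_num) _
      have h4 : (C₁ + 3) * ℓ = C₁ * ℓ + 3 * ℓ := by ring
      have h5 : τ₁ ≤ C₁ * S := by
        rw [hS, ← mul_assoc]; exact le_poly_of_le t₁ le_rfl (by omega)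
      have h6 : C₂ * (Y + 1) ^ D₂ * ℓ ^ 2 ≤ C₂ * S := by
        rw [hS, ← mul_assoc]; exact le_poly_of_le le_rfl le_rfl (by omega)
      have h7 : τ ≤ N * (C₂ * S * m + 15 * ((C₁ + 3) ^ 2 * S)) + 5 * ((C₁ + 3) ^ 2 * S) := by
        refine hτ.trans ?_
        gcongr
      calc _ ≤ C₁ * S + (2 * ((C₁ + 3) ^ 2 * S) + (N * (C₂ * S * m + 15 * ((C₁ + 3) ^ 2 * S)) +
              5 * ((C₁ + 3) ^ 2 * S))) := by omega
        _ ≤ (C₁ + C₂ + 15 * (C₁ + 3) ^ 2) * S * (1 + N * (m + 1)) := by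
            have e1 : 0 ≤ C₁ * S * (N * (m + 1)) := by positivity
            have e2 : 0 ≤ C₂ * S * (1 + N) := by positivity
            have e3 : 0 ≤ (C₁ + 3) ^ 2 * S * (N * m) := by positivity
            nlinarith
        _ ≤ (C₁ + C₂ + 15 * (C₁ + 3) ^ 2) * S * n := by gcongr
        _ = _ := by rw [hS]; ring

/-! ## Verification of programs -/

/-- Started in `s`, the program `p` ends in a store with the property `Q`, after at most `n` steps
with values of at most `ℓ` bits. -/
def Spec (ℓ Y : ℕ) (p : Stmt) (s : Store) (n : ℕ) (Q : Store → Prop) : Prop :=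
  ∃ s', p.Exec ℓ Y s s' n ∧ Q s'

theorem Spec.mono {ℓ Y : ℕ} {p : Stmt} {s : Store} {n n' : ℕ} {Q Q' : Store → Prop}
    (h : Spec ℓ Y p s n Q) (hn : n ≤ n') (hQ : ∀ s', Q s' → Q' s') : Spec ℓ Y p s n' Q' := by
  obtain ⟨s', h1, h2⟩ := h
  exact ⟨s', h1.mono hn, hQ _ h2⟩

theorem Spec.frame {ℓ Y : ℕ} {p : Stmt} {s : Store} {n : ℕ} {Q : Store → Prop} (hp : p.Fits)
    (hs : Good ℓ Y s) (h : Spec ℓ Y p s n Q) :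
    Spec ℓ Y p s n fun s' => Good ℓ Y s' ∧ Frame p.vars p.arrs s s' ∧ Q s' := by
  obtain ⟨s', h1, h2⟩ := h
  have := h1.good_frame hp hs
  exact ⟨s', h1, this.1, this.2, h2⟩

theorem Spec.assign {ℓ Y : ℕ} {s : Store} {x : ℕ} {u : Expr} {z : ℤ} {Q : Store → Prop}
    (hz : u.eval s = z) (h : bits z ≤ ℓ) (hx : x < 8 → z ≤ Y) (hQ : Q (s.setVar x z)) :
    Spec ℓ Y (.assign x u) s 1 Q := by
  subst hz
  exact ⟨_, ⟨h, hx, rfl, le_rfl⟩, hQ⟩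

theorem Spec.write {ℓ Y : ℕ} {s : Store} {a : ℕ} {i u : Expr} {j z : ℤ} {Q : Store → Prop}
    (hj : i.eval s = j) (hz : u.eval s = z) (h : bits z ≤ ℓ) (hQ : Q (s.setArr a j z)) :
    Spec ℓ Y (.write a i u) s 1 Q := by
  subst hz hj
  exact ⟨_, ⟨h, rfl, le_rfl⟩, hQ⟩

theorem Spec.seq {ℓ Y : ℕ} {s : Store} {p q : Stmt} {n₁ n₂ : ℕ} {Q₁ Q : Store → Prop}
    (hp : p.Fits) (hs : Good ℓ Y s) (h₁ : Spec ℓ Y p s n₁ Q₁)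
    (h₂ : ∀ s', Good ℓ Y s' → Frame p.vars p.arrs s s' → Q₁ s' → Spec ℓ Y q s' n₂ Q) :
    Spec ℓ Y (.seq p q) s (n₁ + n₂) Q := by
  obtain ⟨s', e, g, f, h⟩ := h₁.frame hp hs
  obtain ⟨s'', e', h'⟩ := h₂ s' g f h
  exact ⟨s'', ⟨s', n₁, n₂, e, e', le_rfl⟩, h'⟩

/-- The invariant rule. The loop variable is overwritten before each iteration, hence `hI`. The
frame relative to the initial store is supplied in every iteration, so an invariant has to mention
only what changes. -/
theorem Spec.loop {ℓ Y : ℕ} {s : Store} {x : ℕ} {b : Expr} {p : Stmt} {N n : ℕ}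
    (I : ℕ → Store → Prop) (hp : p.Fits) (hx : 8 ≤ x) (hs : Good ℓ Y s) (hN : b.eval s = N)
    (hb : bits (N : ℤ) ≤ ℓ) (hI : ∀ i s v, I i s → I i (s.setVar x v)) (h0 : I 0 s)
    (hstep : ∀ i < N, ∀ s', Good ℓ Y s' → Frame (x :: p.vars) p.arrs s s' → s'.var x = i →
      I i s' → Spec ℓ Y p s' n (I (i + 1))) :
    Spec ℓ Y (.loop x b p) s (1 + N * (n + 1)) (I N) := by
  have hN' : (b.eval s).toNat = N := by rw [hN]; simp
  have hbi : ∀ i : ℕ, i < N → bits (i : ℤ) ≤ ℓ := fun i hi => (bits_mono (by omega)).trans hb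
  have step : ∀ i : ℕ, i < N → ∀ s', Good ℓ Y s' ∧ Frame (x :: p.vars) p.arrs s s' ∧ I i s' →
      ∃ s'', p.Exec ℓ Y (s'.setVar x i) s'' n ∧
        Good ℓ Y s'' ∧ Frame (x :: p.vars) p.arrs s s'' ∧ I (i + 1) s'' := by
    rintro i hi s' ⟨hg, hf, hIs⟩
    have hg' := hg.setVar (x := x) (hbi i hi) (by omega)
    have hf' : Frame (x :: p.vars) p.arrs s (s'.setVar x i) := hf.trans_self
      ⟨fun y hy => by simp only [List.mem_cons, not_or] at hy; simp [hy.1], fun _ _ => rfl⟩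
    obtain ⟨s'', e, g, f, h⟩ := (hstep i hi (s'.setVar x i) hg' hf' (by simp)
      (hI _ _ _ hIs)).frame hp hg'
    exact ⟨s'', e, g, hf'.trans_self (f.mono (by simp) (by simp)), h⟩
  have : ∃ f : ℕ → Store, f 0 = s ∧ ∀ i : ℕ, i < N →
      p.Exec ℓ Y ((f i).setVar x i) (f (i + 1)) n ∧ Good ℓ Y (f (i + 1)) ∧
        Frame (x :: p.vars) p.arrs s (f (i + 1)) ∧ I (i + 1) (f (i + 1)) := by
    classical
    choose! F hF using step
    let f : ℕ → Store := fun k => Nat.rec s (fun i s' => F i s') k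
    have key : ∀ i ≤ N, Good ℓ Y (f i) ∧ Frame (x :: p.vars) p.arrs s (f i) ∧ I i (f i) := by
      intro i
      induction i with
      | zero => exact fun _ => ⟨hs, Frame.refl _ _ _, h0⟩
      | succ i ih => exact fun hi => (hF i (by omega) _ (ih (by omega))).2
    exact ⟨f, rfl, fun i hi => hF i hi _ (key i hi.le)⟩
  obtain ⟨f, hf0, hf⟩ := this
  refine ⟨f N, ⟨f, n, hf0, by rw [hN'], by rw [hN']; exact hb, fun i hi => (hf i (hN' ▸ hi)).1,
    by rw [hN']⟩, ?_⟩
  rcases Nat.eq_zero_or_pos N with h | h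
  · subst h; rw [hf0]; exact h0
  · have := (hf (N - 1) (by omega)).2.2.2
    rwa [Nat.sub_add_cancel h] at this

end RAM

/-! ## The rank of matrix multiplication -/

/-- Taking `B = 1` shows that the matrices `W l` span a space of dimension `m * m`. Consequently the
tables with one cell per matrix entry are never longer than `r ^ K`. -/
theorem HasMatMulDecomposition.sq_le {K : Type} [Field K] {m r : ℕ}
    (h : HasMatMulDecomposition K m r) : m * m ≤ r := by
  obtain ⟨f, g, W, h⟩ := h
  have hspan : Submodule.span K (Set.range W) = ⊤ := by
    rw [eq_top_iff]
    intro A _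
    rw [← mul_one A, h A 1]
    exact Submodule.sum_mem _ fun l _ =>
      Submodule.smul_mem _ _ (Submodule.subset_span (Set.mem_range_self l))
  have h1 := finrank_range_le_card (R := K) W
  rw [Set.finrank, hspan, finrank_top, Module.finrank_matrix] at h1
  simpa using h1

/-- The schoolbook scheme with one product for each triple of indices; it makes the sets in the
definitions of rank and exponent non-empty, so that their infima are meaningful. -/
theorem hasMatMulDecomposition_cube (K : Type) [Field K] (m : ℕ) :
    HasMatMulDecomposition K m (m ^ 3) := by
  have e : Fin (m ^ 3) ≃ Fin m × Fin m × Fin m :=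
    (Fintype.equivFinOfCardEq (by simp; ring)).symm
  refine ⟨fun l => Matrix.entryLinearMap K K (e l).1 (e l).2.1,
    fun l => Matrix.entryLinearMap K K (e l).2.1 (e l).2.2,
    fun l => Matrix.single (e l).1 (e l).2.2 1, fun A B => ?_⟩
  rw [Equiv.sum_comp e fun t => (Matrix.entryLinearMap K K t.1 t.2.1 A *
    Matrix.entryLinearMap K K t.2.1 t.2.2 B) • Matrix.single t.1 t.2.2 (1 : K)]
  ext i j
  simp only [Fintype.sum_prod_type, Matrix.mul_apply, Matrix.sum_apply, Matrix.smul_apply,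
    Matrix.entryLinearMap_apply, Matrix.single_apply, smul_eq_mul, mul_ite, mul_one, mul_zero]
  symm
  rw [Finset.sum_eq_single i (by
    intro b _ hb
    exact Finset.sum_eq_zero fun k _ => Finset.sum_eq_zero fun j _ => by simp [hb]) (by simp)]
  refine Finset.sum_congr rfl fun k _ => ?_
  simp

theorem hasMatMulDecomposition_matMulRank (K : Type) [Field K] (m : ℕ) :
    HasMatMulDecomposition K m (matMulRank K m) :=
  Nat.sInf_mem (s := {r | HasMatMulDecomposition K m r}) ⟨_, hasMatMulDecomposition_cube K m⟩

/-- There are decompositions with rank arbitrarily close to the exponent. -/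
theorem exists_hasMatMulDecomposition (K : Type) [Field K] {ε : ℝ} (hε : 0 < ε) :
    ∃ p r : ℕ, 1 ≤ p ∧ HasMatMulDecomposition K (2 ^ p) r ∧
      (r : ℝ) ≤ ((2 : ℝ) ^ p) ^ (matMulExponent K + ε) := by
  have hne : {τ : ℝ | (fun m : ℕ => (matMulRank K m : ℝ)) =O[Filter.atTop]
      fun m : ℕ => (m : ℝ) ^ τ}.Nonempty := by
    refine ⟨3, Asymptotics.isBigO_of_le _ fun m => ?_⟩
    have : matMulRank K m ≤ m ^ 3 := Nat.sInf_le (hasMatMulDecomposition_cube K m)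
    have h3 : ((m : ℝ) ^ (3 : ℝ)) = (m : ℝ) ^ 3 := by norm_cast
    rw [h3]
    simp only [norm_pow, RCLike.norm_natCast]
    exact_mod_cast this
  obtain ⟨τ, hτ, hlt⟩ := exists_lt_of_csInf_lt hne (lt_add_of_pos_right (matMulExponent K) hε)
  obtain ⟨c, hc⟩ := hτ.bound
  -- The gap between `τ` and `ω + ε` absorbs the constant of the `O`: once `m = 2 ^ p` is large, `c
  -- ≤ m ^ δ`.
  set δ := matMulExponent K + ε - τ with hδ
  have hδ0 : 0 < δ := by rw [hδ]; linarith
  have h2 : Filter.Tendsto (fun p : ℕ => 2 ^ p) Filter.atTop Filter.atTop :=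
    tendsto_pow_atTop_atTop_of_one_lt (by norm_num)
  have h3 : ∀ᶠ m : ℕ in Filter.atTop, c ≤ (m : ℝ) ^ δ :=
    ((tendsto_rpow_atTop hδ0).comp tendsto_natCast_atTop_atTop).eventually_ge_atTop c
  obtain ⟨p, ⟨hp1, hp2⟩, hp3⟩ := (((h2.eventually hc).and (h2.eventually h3)).and
    (Filter.eventually_ge_atTop 1)).exists
  refine ⟨p, matMulRank K (2 ^ p), hp3, hasMatMulDecomposition_matMulRank K _, ?_⟩
  have hpos : (0 : ℝ) < 2 ^ p := by positivity
  push_cast at hp1 hp2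
  rw [Real.norm_of_nonneg (by positivity), Real.norm_of_nonneg (by positivity)] at hp1
  calc _ ≤ c * ((2 : ℝ) ^ p) ^ τ := hp1
    _ ≤ ((2 : ℝ) ^ p) ^ δ * ((2 : ℝ) ^ p) ^ τ := by gcongr
    _ = _ := by rw [← Real.rpow_add hpos]; congr 1; rw [hδ]; ring

/-- The entry at `x, y, z` of the matrix multiplication tensor, where an index `x` stands for the
pair `x / m, x % m`. -/
def mulTensor (m x y z : ℕ) : ℤ := if z / m = x / m ∧ x % m = y / m ∧ y % m = z % m then 1 else 0

/-- All coefficients have a common denominator `D`, and each summand contains three of them, so the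
scaled identity carries the factor `D ^ 3`. The program can work with integers and remove the factor
by one exact division at the end. -/
theorem HasMatMulDecomposition.exists_integral {m r : ℕ} (h : HasMatMulDecomposition ℚ m r) :
    ∃ (F G W : ℕ → ℕ → ℤ) (Δ : ℤ), Δ ≠ 0 ∧ ∀ x < m * m, ∀ y < m * m, ∀ z < m * m,
      ∑ l ∈ Finset.range r, W z l * F l x * G l y = Δ * mulTensor m x y z := by
  obtain ⟨f, g, W, h⟩ := h
  have hm : ∀ {x}, x < m * m → x / m < m ∧ x % m < m := fun {x} hx => by
    have : 0 < m := Nat.pos_of_ne_zero fun h => by simp [h] at hx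
    exact ⟨Nat.div_lt_of_lt_mul hx, Nat.mod_lt _ this⟩
  let E : ℕ → Matrix (Fin m) (Fin m) ℚ := fun x =>
    fun i j => if (i : ℕ) = x / m ∧ (j : ℕ) = x % m then 1 else 0
  obtain ⟨D, hD⟩ := IsLocalization.exist_integer_multiples_of_finite (nonZeroDivisors ℤ)
    (S := ℚ) (fun t : (Fin r × Fin (m * m)) × Fin 3 => if t.2 = 0 then f t.1.1 (E t.1.2) else
      if t.2 = 1 then g t.1.1 (E t.1.2) else if hx : 0 < m then
        W t.1.1 ⟨t.1.2 / m, (hm t.1.2.2).1⟩ ⟨t.1.2 % m, (hm t.1.2.2).2⟩ else 0)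
  choose V hV using hD
  have hD0 : (D : ℤ) ≠ 0 := nonZeroDivisors.coe_ne_zero D
  let T : Fin 3 → ℕ → ℕ → ℤ := fun q l x =>
    if hl : l < r ∧ x < m * m then V ((⟨l, hl.1⟩, ⟨x, hl.2⟩), q) else 0
  refine ⟨T 0, T 1, fun z l => T 2 l z, (D : ℤ) ^ 3, pow_ne_zero 3 hD0, fun x hx y hy z hz => ?_⟩
  have hm0 : 0 < m := Nat.pos_of_ne_zero fun h => by simp [h] at hx
  -- On matrix units the bilinear identity becomes an identity of tensor entries.
  have key := congrFun (congrFun (h (E x) (E y)) ⟨z / m, (hm hz).1⟩) ⟨z % m, (hm hz).2⟩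
  rw [Matrix.sum_apply] at key
  have hL : (E x * E y) ⟨z / m, (hm hz).1⟩ ⟨z % m, (hm hz).2⟩ = (mulTensor m x y z : ℚ) := by
    rw [Matrix.mul_apply, Finset.sum_eq_single (⟨x % m, (hm hx).2⟩ : Fin m)]
    · simp only [E, mulTensor, and_true]
      by_cases h1 : z / m = x / m <;> by_cases h2 : x % m = y / m <;>
        by_cases h3 : y % m = z % m <;> simp [h1, h2, h3, eq_comm]
    · intro b _ hb
      have : ¬ ((b : ℕ) = x % m) := fun h => hb (Fin.ext h)
      simp [E, this]
    · simp
  rw [hL] at key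
  have : (((∑ l ∈ Finset.range r, T 2 l z * T 0 l x * T 1 l y : ℤ)) : ℚ) =
      ((D : ℤ) ^ 3 * mulTensor m x y z : ℤ) := by
    push_cast
    rw [key, Finset.sum_range, Finset.mul_sum]
    refine Finset.sum_congr rfl fun l _ => ?_
    have h0 := hV ((l, ⟨x, hx⟩), 0)
    have h1 := hV ((l, ⟨y, hy⟩), 1)
    have h2 := hV ((l, ⟨z, hz⟩), 2)
    simp only [hm0, algebraMap_int_eq, eq_intCast, if_true, one_ne_zero, if_false,
      dif_pos, show (2 : Fin 3) ≠ 0 by decide, show (2 : Fin 3) ≠ 1 by decide,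
      zsmul_eq_mul] at h0 h1 h2
    simp only [T, l.2, hx, hy, hz, and_self, dif_pos, Fin.eta]
    rw [h0, h1, h2]
    simp only [Matrix.smul_apply, smul_eq_mul]
    ring
  exact_mod_cast this

/-! ## Tensor powers -/

/-- The `s`-th tensor power of the matrix `T`, with rows and columns numbered in base `a` and
`b`. -/
def tensorPow (T : ℕ → ℕ → ℤ) (a b : ℕ) : ℕ → ℕ → ℕ → ℤ
  | 0, _, _ => 1
  | s + 1, u, x => tensorPow T a b s (u / a) (x / b) * T (u % a) (x % b)

/-- The tensor power of the matrix multiplication tensor. -/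
def mulTensorPow (m : ℕ) : ℕ → ℕ → ℕ → ℕ → ℤ
  | 0, _, _, _ => 1
  | s + 1, x, y, z => mulTensorPow m s (x / (m * m)) (y / (m * m)) (z / (m * m)) *
      mulTensor m (x % (m * m)) (y % (m * m)) (z % (m * m))

theorem Finset.sum_range_mul {M : Type*} [AddCommMonoid M] (f : ℕ → M) (a b : ℕ) :
    ∑ i ∈ Finset.range (a * b), f i =
      ∑ j ∈ Finset.range a, ∑ l ∈ Finset.range b, f (j * b + l) := by
  induction a with
  | zero => simp
  | succ a ih => rw [Nat.succ_mul, Finset.sum_range_add, ih, Finset.sum_range_succ]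

/-- Splitting off the last digit of `l` factors the sum, and the scheme applies to the last digits
of `x`, `y`, `z`. Digits are remainders modulo `m * m`, so these three numbers need no bounds. -/
theorem sum_tensorPow {m r : ℕ} {F G W : ℕ → ℕ → ℤ} {Δ : ℤ} (hm : 0 < m)
    (h : ∀ x < m * m, ∀ y < m * m, ∀ z < m * m,
      ∑ l ∈ Finset.range r, W z l * F l x * G l y = Δ * mulTensor m x y z) (s : ℕ) :
    ∀ x y z : ℕ, ∑ l ∈ Finset.range (r ^ s), tensorPow W (m * m) r s z l *
      tensorPow F r (m * m) s l x * tensorPow G r (m * m) s l y =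
        Δ ^ s * mulTensorPow m s x y z := by
  have hQ : 0 < m * m := Nat.mul_pos hm hm
  induction s with
  | zero => intro x y z; simp [tensorPow, mulTensorPow]
  | succ s ih =>
    intro x y z
    rw [pow_succ, Finset.sum_range_mul]
    have e : ∀ j ∈ Finset.range (r ^ s), ∑ l ∈ Finset.range r,
        tensorPow W (m * m) r (s + 1) z (j * r + l) * tensorPow F r (m * m) (s + 1) (j * r + l) x *
          tensorPow G r (m * m) (s + 1) (j * r + l) y =
        (tensorPow W (m * m) r s (z / (m * m)) j * tensorPow F r (m * m) s j (x / (m * m)) *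
          tensorPow G r (m * m) s j (y / (m * m))) *
          (Δ * mulTensor m (x % (m * m)) (y % (m * m)) (z % (m * m))) := by
      intro j _
      rw [← h _ (Nat.mod_lt x hQ) _ (Nat.mod_lt y hQ) _ (Nat.mod_lt z hQ), Finset.mul_sum]
      refine Finset.sum_congr rfl fun l hl => ?_
      have hl := Finset.mem_range.1 hl
      have h1 : (j * r + l) / r = j := by
        rw [mul_comm, Nat.mul_add_div (by omega), Nat.div_eq_of_lt hl, add_zero]
      have h2 : (j * r + l) % r = l := by rw [mul_comm, Nat.mul_add_mod, Nat.mod_eq_of_lt hl]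
      simp only [tensorPow, h1, h2]
      ring
    rw [Finset.sum_congr rfl e, ← Finset.sum_mul, ih, mulTensorPow, pow_succ]
    ring

/-- The vector after `s` of `K` steps of the multiplication of `v` by `T ^ ⊗ K`: the first `s`
digits have been transformed and moved to the end. -/
def partialTransform (T : ℕ → ℕ → ℤ) (a b K s : ℕ) (v : ℕ → ℤ) (i : ℕ) : ℤ :=
  ∑ x ∈ Finset.range (b ^ s), tensorPow T a b s (i % a ^ s) x * v (x * b ^ (K - s) + i / a ^ s)

theorem partialTransform_zero (T : ℕ → ℕ → ℤ) (a b K : ℕ) (v : ℕ → ℤ) (i : ℕ) :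
    partialTransform T a b K 0 v i = v i := by
  simp [partialTransform, tensorPow]

theorem partialTransform_self (T : ℕ → ℕ → ℤ) (a b K : ℕ) (v : ℕ → ℤ) {i : ℕ} (hi : i < a ^ K) :
    partialTransform T a b K K v i =
      ∑ x ∈ Finset.range (b ^ K), tensorPow T a b K i x * v x := by
  simp [partialTransform, Nat.mod_eq_of_lt hi, Nat.div_eq_of_lt hi]

/-- One pass of Yates' algorithm: the leading digit `x` of the old index is summed against `T`, the
remaining digits `w` stay in order, and the new digit `l` is appended. Because digits rotate in this
way, a pass needs only the current length of the vector and division with remainder by `a`. -/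
theorem partialTransform_succ (T : ℕ → ℕ → ℤ) {a b K s : ℕ} (ha : 0 < a) (hs : s < K) (v : ℕ → ℤ)
    (w : ℕ) {l : ℕ} (hl : l < a) :
    partialTransform T a b K (s + 1) v (w * a + l) =
      ∑ x ∈ Finset.range b, T l x *
        partialTransform T a b K s v (x * (b ^ (K - (s + 1)) * a ^ s) + w) := by
  have h1 : (w * a + l) % a ^ (s + 1) = w % a ^ s * a + l := by
    rw [pow_succ, mul_comm (a ^ s) a, Nat.mod_mul, mul_comm w a, Nat.mul_add_mod,
      Nat.mod_eq_of_lt hl, Nat.mul_add_div ha, Nat.div_eq_of_lt hl]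
    ring_nf
  have h2 : (w * a + l) / a ^ (s + 1) = w / a ^ s := by
    rw [pow_succ, mul_comm (a ^ s) a, ← Nat.div_div_eq_div_mul, mul_comm w a,
      Nat.mul_add_div ha, Nat.div_eq_of_lt hl, add_zero]
  have hpos : 0 < a ^ s := by positivity
  unfold partialTransform
  rw [h1, h2, pow_succ, Finset.sum_range_mul, Finset.sum_comm]
  refine Finset.sum_congr rfl fun x hx => ?_
  rw [Finset.mul_sum]
  refine Finset.sum_congr rfl fun X _ => ?_
  have hx := Finset.mem_range.1 hx
  have e1 : (x * (b ^ (K - (s + 1)) * a ^ s) + w) % a ^ s = w % a ^ s := by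
    rw [← mul_assoc, mul_comm _ (a ^ s), Nat.mul_add_mod]
  have e2 : (x * (b ^ (K - (s + 1)) * a ^ s) + w) / a ^ s =
      x * b ^ (K - (s + 1)) + w / a ^ s := by
    rw [← mul_assoc, mul_comm _ (a ^ s), Nat.mul_add_div hpos]
  have e3 : (X * b + x) / b = X := by
    rw [mul_comm, Nat.mul_add_div (by omega), Nat.div_eq_of_lt hx, add_zero]
  have e4 : (X * b + x) % b = x := by rw [mul_comm, Nat.mul_add_mod, Nat.mod_eq_of_lt hx]
  have e5 : (w % a ^ s * a + l) / a = w % a ^ s := by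
    rw [mul_comm, Nat.mul_add_div ha, Nat.div_eq_of_lt hl, add_zero]
  have e6 : (w % a ^ s * a + l) % a = l := by rw [mul_comm, Nat.mul_add_mod, Nat.mod_eq_of_lt hl]
  have e7 : b ^ (K - s) = b * b ^ (K - (s + 1)) := by
    rw [← pow_succ']; congr 1; omega
  rw [e1, e2, tensorPow, e3, e4, e5, e6, e7]
  have e8 : (X * b + x) * b ^ (K - (s + 1)) + w / a ^ s =
      X * (b * b ^ (K - (s + 1))) + (x * b ^ (K - (s + 1)) + w / a ^ s) := by ring
  rw [e8]
  ring

theorem abs_tensorPow_le {T : ℕ → ℕ → ℤ} {a b : ℕ} {c : ℤ} (ha : 0 < a) (hb : 0 < b)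
    (hT : ∀ l < a, ∀ x < b, |T l x| ≤ c) (s : ℕ) : ∀ u x : ℕ, |tensorPow T a b s u x| ≤ c ^ s := by
  induction s with
  | zero => intro u x; simp [tensorPow]
  | succ s ih =>
    intro u x
    have h1 := hT _ (Nat.mod_lt u ha) _ (Nat.mod_lt x hb)
    have h0 : 0 ≤ c := (abs_nonneg _).trans h1
    rw [tensorPow, abs_mul, pow_succ]
    exact mul_le_mul (ih _ _) h1 (abs_nonneg _) (by positivity)

/-- There are `b ^ s` summands, each a product of `s` coefficients and one entry of `v`; hence every
pass costs a bounded number of bits. -/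
theorem abs_partialTransform_le {T : ℕ → ℕ → ℤ} {a b K s : ℕ} {c V : ℤ} (ha : 0 < a) (hb : 0 < b)
    (hT : ∀ l < a, ∀ x < b, |T l x| ≤ c) {v : ℕ → ℤ} (hs : s ≤ K)
    (hv : ∀ i < b ^ K, |v i| ≤ V) {i : ℕ} (hi : i < b ^ (K - s) * a ^ s) :
    |partialTransform T a b K s v i| ≤ (b * c) ^ s * V := by
  have hc : 0 ≤ c := (abs_nonneg _).trans (hT 0 ha 0 hb)
  have h1 : i / a ^ s < b ^ (K - s) := Nat.div_lt_of_lt_mul (by rwa [mul_comm])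
  have h2 : b ^ K = b ^ s * b ^ (K - s) := by rw [← pow_add]; congr 1; omega
  refine (Finset.abs_sum_le_sum_abs _ _).trans
    ((Finset.sum_le_card_nsmul _ _ (c ^ s * V) fun x hx => ?_).trans_eq ?_)
  · rw [abs_mul]
    have hx := Finset.mem_range.1 hx
    refine mul_le_mul (abs_tensorPow_le ha hb hT s _ _) (hv _ ?_) (abs_nonneg _) (by positivity)
    rw [h2]
    calc x * b ^ (K - s) + i / a ^ s < x * b ^ (K - s) + b ^ (K - s) := by omega
      _ = (x + 1) * b ^ (K - s) := by ring
      _ ≤ _ := Nat.mul_le_mul_right _ hx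
  · simp only [Finset.card_range, nsmul_eq_mul]
    push_cast
    ring

/-! ## Labels of points as bits of numbers -/

/-- The position of the `b`-th bit of the row in the index of an entry, see `mulTensorPow`. -/
def hiPos (p b : ℕ) : ℕ := p * (b / p) + b + p

/-- The position of the `b`-th bit of the column in the index of an entry. -/
def loPos (p b : ℕ) : ℕ := p * (b / p) + b

theorem mod_two_pow_eq_iff {u v p : ℕ} :
    u % 2 ^ p = v % 2 ^ p ↔ ∀ b < p, u.testBit b = v.testBit b := by
  constructor
  · intro h b hb
    have := congrArg (fun t => t.testBit b) h
    simpa [Nat.testBit_mod_two_pow, hb] using this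
  · intro h
    refine Nat.eq_of_testBit_eq fun b => ?_
    by_cases hb : b < p
    · simp [Nat.testBit_mod_two_pow, hb, h b hb]
    · simp [Nat.testBit_mod_two_pow, hb]

/-- A digit to the base `2 ^ (2 p)` holds the row in its upper `p` bits and the column in its lower
`p` bits. -/
theorem mulTensor_two_pow (p x y z : ℕ) :
    mulTensor (2 ^ p) (x % (2 ^ p * 2 ^ p)) (y % (2 ^ p * 2 ^ p)) (z % (2 ^ p * 2 ^ p)) =
      if ∀ b < p, z.testBit (b + p) = x.testBit (b + p) ∧ x.testBit b = y.testBit (b + p) ∧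
        y.testBit b = z.testBit b then 1 else 0 := by
  have h1 : ∀ u : ℕ, u % (2 ^ p * 2 ^ p) / 2 ^ p = u / 2 ^ p % 2 ^ p := fun u =>
    Nat.mod_mul_left_div_self u _ _
  have h2 : ∀ u : ℕ, u % (2 ^ p * 2 ^ p) % 2 ^ p = u % 2 ^ p := fun u =>
    Nat.mod_mul_left_mod u _ _
  have h3 : ∀ u b : ℕ, (u / 2 ^ p).testBit b = u.testBit (b + p) := fun u b => by
    rw [Nat.testBit_div_two_pow, add_comm]
  unfold mulTensor
  simp only [h1, h2, mod_two_pow_eq_iff, h3]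
  congr 1
  exact propext ⟨fun h b hb => ⟨h.1 b hb, h.2.1 b hb, h.2.2 b hb⟩,
    fun h => ⟨fun b hb => (h b hb).1, fun b hb => (h b hb).2.1, fun b hb => (h b hb).2.2⟩⟩

/-- The three entries of matrices belong to a summand of a matrix product. -/
def Compat (p g x y z : ℕ) : Prop :=
  ∀ b < g, z.testBit (hiPos p b) = x.testBit (hiPos p b) ∧
    x.testBit (loPos p b) = y.testBit (hiPos p b) ∧ y.testBit (loPos p b) = z.testBit (loPos p b)

instance (p g x y z : ℕ) : Decidable (Compat p g x y z) := by
  unfold Compat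
  infer_instance

/-- Tensor powers of matrix multiplication are matrix multiplication: the `K` row digits together
form a row number of `p * K` bits, and likewise for columns. Rows and columns are merely interleaved
in blocks of `p` bits, which is what `hiPos` and `loPos` record. -/
theorem mulTensorPow_two_pow {p : ℕ} (hp : 0 < p) (K : ℕ) : ∀ x y z : ℕ,
    mulTensorPow (2 ^ p) K x y z = if Compat p (p * K) x y z then 1 else 0 := by
  induction K with
  | zero => intro x y z; simp [mulTensorPow, Compat]
  | succ K ih =>
    intro x y z
    have h0 : ∀ b, b < p → hiPos p b = b + p ∧ loPos p b = b := fun b hb => by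
      simp [hiPos, loPos, Nat.div_eq_of_lt hb]
    have hd : ∀ u b : ℕ, (u / (2 ^ p * 2 ^ p)).testBit b = u.testBit (p + p + b) := fun u b => by
      rw [← pow_add, Nat.testBit_div_two_pow, add_comm]
    have h1 : ∀ b, hiPos p (p + b) = p + p + hiPos p b ∧ loPos p (p + b) = p + p + loPos p b := by
      intro b
      simp only [hiPos, loPos, Nat.add_div_left b hp]
      constructor <;> ring
    rw [mulTensorPow, ih, mulTensor_two_pow, mul_ite, mul_one, mul_zero, ← ite_and]
    congr 1
    refine propext ⟨fun ⟨hB, hA⟩ b hb => ?_, fun h => ⟨fun b hb => ?_, fun b hb => ?_⟩⟩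
    · by_cases hbp : b < p
      · rw [(h0 b hbp).1, (h0 b hbp).2]
        exact hB b hbp
      · obtain ⟨b', rfl⟩ := Nat.exists_eq_add_of_le (not_lt.1 hbp)
        have := hA b' (by rw [Nat.mul_succ] at hb; omega)
        simpa only [hd, (h1 b').1, (h1 b').2] using this
    · have := h b (by rw [Nat.mul_succ]; omega)
      rwa [(h0 b hb).1, (h0 b hb).2] at this
    · have := h (p + b) (by rw [Nat.mul_succ]; omega)
      simpa only [hd, (h1 b).1, (h1 b).2] using this

/-- The two labellings encoded in the bits of an index are arbitrary. -/
theorem exists_testBit {p : ℕ} (hp : 0 < p) (K : ℕ) (f h : ℕ → Bool) : ∃ z < 2 ^ (2 * (p * K)),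
    ∀ b < p * K, z.testBit (hiPos p b) = f b ∧ z.testBit (loPos p b) = h b := by
  -- Here `β / p` is the number of the block of `p` bits: odd blocks belong to the row, even ones to
  -- the column, and `β / p / 2` is the digit.
  let B : Fin (2 * (p * K)) → Bool := fun β =>
    if (β : ℕ) / p % 2 = 1 then f (p * (β / p / 2) + β % p) else h (p * (β / p / 2) + β % p)
  refine ⟨Nat.ofBits B, Nat.ofBits_lt_two_pow B, fun b hb => ?_⟩
  have hq : b / p < K := Nat.div_lt_of_lt_mul hb
  have hb' := Nat.div_add_mod b p
  have ht := Nat.mod_lt b hp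
  set q := b / p
  set t := b % p
  have e1 : hiPos p b = p * (2 * q + 1) + t := by
    change p * q + b + p = _
    linarith
  have e2 : loPos p b = p * (2 * q) + t := by
    change p * q + b = _
    linarith
  have hlt : hiPos p b < 2 * (p * K) := by
    rw [e1]
    have : p * (2 * q + 1) + p ≤ 2 * (p * K) := by
      calc p * (2 * q + 1) + p = 2 * (p * (q + 1)) := by ring
        _ ≤ _ := by gcongr; omega
    omega
  have hlt' : loPos p b < 2 * (p * K) := lt_of_le_of_lt (by unfold hiPos loPos; omega) hlt
  rw [Nat.testBit_ofBits_lt B _ hlt, Nat.testBit_ofBits_lt B _ hlt']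
  simp only [B]
  have d1 : hiPos p b / p = 2 * q + 1 := by
    rw [e1, Nat.mul_add_div hp, Nat.div_eq_of_lt ht, add_zero]
  have d2 : loPos p b / p = 2 * q := by
    rw [e2, Nat.mul_add_div hp, Nat.div_eq_of_lt ht, add_zero]
  have m1 : hiPos p b % p = t := by rw [e1, Nat.mul_add_mod, Nat.mod_eq_of_lt ht]
  have m2 : loPos p b % p = t := by rw [e2, Nat.mul_add_mod, Nat.mod_eq_of_lt ht]
  rw [d1, d2, m1, m2, if_pos (by omega), if_neg (by omega),
    show (2 * q + 1) / 2 = q by omega, show 2 * q / 2 = q by omega, hb']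
  exact ⟨rfl, rfl⟩

/-- The bit at position `i`, as an integer. -/
def bitAt (z i : ℕ) : ℤ := ((z.testBit i).toNat : ℤ)

theorem bitAt_eq (z i : ℕ) : bitAt z i = (z : ℤ) / 2 ^ i - 2 * ((z : ℤ) / 2 ^ i / 2) := by
  have : (z.testBit i).toNat = z / 2 ^ i % 2 := by
    rw [Nat.testBit_eq_decide_div_mod_eq]
    rcases Nat.mod_two_eq_zero_or_one (z / 2 ^ i) with h | h <;> simp [h]
  rw [bitAt, this]
  push_cast
  generalize (z : ℤ) / 2 ^ i = t
  omega

theorem bitAt_eq_zero_or_one (z i : ℕ) : bitAt z i = 0 ∨ bitAt z i = 1 := by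
  unfold bitAt
  cases z.testBit i <;> simp

/-! ### The objective as a combination of weights of pairs of parts. -/

section Objective

variable (p g d : ℕ) (Y : ℕ → ℕ → ℤ)

/-- A combination of the sums of the points that are selected by the bits of the row and of the
column. -/
def pairVec (c₀ : ℤ) (q₀ : ℕ) (c₁ : ℤ) (q₁ x j : ℕ) : ℤ :=
  ∑ b ∈ Finset.range g, (c₀ * (bitAt x (hiPos p b) * Y (3 * b + q₀) j) +
    c₁ * (bitAt x (loPos p b) * Y (3 * b + q₁) j))

/-- The squared norm of `pairVec`. -/
def pairWeight (c₀ : ℤ) (q₀ : ℕ) (c₁ : ℤ) (q₁ x : ℕ) : ℤ :=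
  ∑ j ∈ Finset.range d, pairVec p g Y c₀ q₀ c₁ q₁ x j * pairVec p g Y c₀ q₀ c₁ q₁ x j

/-- The sum of the points that are selected by the row and the column of `z` and by the row of
`y`. -/
def tripleVec (z y j : ℕ) : ℤ :=
  ∑ b ∈ Finset.range g, (bitAt z (hiPos p b) * Y (3 * b) j +
    bitAt z (loPos p b) * Y (3 * b + 1) j + bitAt y (hiPos p b) * Y (3 * b + 2) j)

/-- The squared norm of `tripleVec`. -/
def tripleWeight (z y : ℕ) : ℤ :=
  ∑ j ∈ Finset.range d, tripleVec p g Y z y j * tripleVec p g Y z y j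

/-- In each coordinate this is `2(A+B+C)² = (2A+C)² + (C+2B)² - 2(A-B)²`. Compatibility says that
the entries agree about the labels of the part they share. The first two weights depend on one
matrix entry each and are nonnegative, so they can serve as exponents; the third is known once the
entry of the product is. -/
theorem two_mul_tripleWeight {x y z : ℕ} (h : Compat p g x y z) :
    2 * tripleWeight p g d Y z y = pairWeight p g d Y 2 0 1 2 x + pairWeight p g d Y 1 2 2 1 y -
      2 * pairWeight p g d Y 1 0 (-1) 1 z := by
  unfold tripleWeight pairWeight
  rw [Finset.mul_sum, Finset.mul_sum, ← Finset.sum_add_distrib, ← Finset.sum_sub_distrib]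
  refine Finset.sum_congr rfl fun j _ => ?_
  have ex : pairVec p g Y 2 0 1 2 x j = 2 * ∑ b ∈ Finset.range g, bitAt z (hiPos p b) *
      Y (3 * b) j + ∑ b ∈ Finset.range g, bitAt y (hiPos p b) * Y (3 * b + 2) j := by
    rw [pairVec, Finset.mul_sum, ← Finset.sum_add_distrib]
    refine Finset.sum_congr rfl fun b hb => ?_
    have := h b (Finset.mem_range.1 hb)
    simp only [bitAt, this.1, this.2.1]
    ring_nf
  have ey : pairVec p g Y 1 2 2 1 y j = 2 * ∑ b ∈ Finset.range g, bitAt z (loPos p b) *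
      Y (3 * b + 1) j + ∑ b ∈ Finset.range g, bitAt y (hiPos p b) * Y (3 * b + 2) j := by
    rw [pairVec, Finset.mul_sum, ← Finset.sum_add_distrib]
    refine Finset.sum_congr rfl fun b hb => ?_
    have := h b (Finset.mem_range.1 hb)
    simp only [bitAt, this.2.2]
    ring_nf
  have ez : pairVec p g Y 1 0 (-1) 1 z j = ∑ b ∈ Finset.range g, bitAt z (hiPos p b) *
      Y (3 * b) j - ∑ b ∈ Finset.range g, bitAt z (loPos p b) * Y (3 * b + 1) j := by
    rw [pairVec, ← Finset.sum_sub_distrib]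
    refine Finset.sum_congr rfl fun b _ => ?_
    ring_nf
  have et : tripleVec p g Y z y j = ∑ b ∈ Finset.range g, bitAt z (hiPos p b) * Y (3 * b) j +
      ∑ b ∈ Finset.range g, bitAt z (loPos p b) * Y (3 * b + 1) j +
      ∑ b ∈ Finset.range g, bitAt y (hiPos p b) * Y (3 * b + 2) j := by
    rw [tripleVec, ← Finset.sum_add_distrib, ← Finset.sum_add_distrib]
  rw [ex, ey, ez, et]
  ring

theorem pairWeight_nonneg (c₀ : ℤ) (q₀ : ℕ) (c₁ : ℤ) (q₁ x : ℕ) :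
    0 ≤ pairWeight p g d Y c₀ q₀ c₁ q₁ x :=
  Finset.sum_nonneg fun _ _ => mul_self_nonneg _

variable {Y}

theorem sum_three_mul_add_le {f : ℕ → ℤ} {n : ℕ} (hf : ∀ i, 0 ≤ f i) (hn : ∀ i, n ≤ i → f i = 0)
    (q : ℕ) : ∑ b ∈ Finset.range g, f (3 * b + q) ≤ ∑ i ∈ Finset.range n, f i := by
  rw [← Finset.sum_image (g := fun b => 3 * b + q) (f := f) (by intro a _ b _ h; simpa using h)]
  rw [← Finset.sum_filter_of_ne (p := fun i => i < n) fun i _ hi =>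
    not_le.1 fun h => hi (hn i h)]
  exact Finset.sum_le_sum_of_subset_of_nonneg (fun i hi => by simpa using (Finset.mem_filter.1 hi).2)
    fun i _ _ => hf i

/-- For integers `|y| ≤ y²`, so each sum of selected coordinates is bounded by the sum of all
squares, and the coefficients contribute a factor of at most `3`. The right side is easy to compute
for the program itself. -/
theorem pairWeight_le {n : ℕ} (hY : ∀ i, n ≤ i → ∀ j < d, Y i j = 0) {c₀ c₁ : ℤ} (q₀ q₁ : ℕ)
    (hc : |c₀| + |c₁| ≤ 3) (x : ℕ) : pairWeight p g d Y c₀ q₀ c₁ q₁ x ≤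
      9 * ∑ j ∈ Finset.range d, (∑ i ∈ Finset.range n, Y i j * Y i j) *
        ∑ i ∈ Finset.range n, Y i j * Y i j := by
  rw [Finset.mul_sum]
  refine Finset.sum_le_sum fun j hj => ?_
  have hj := Finset.mem_range.1 hj
  set H := ∑ i ∈ Finset.range n, Y i j * Y i j with hH
  have key : ∀ (pos : ℕ → ℕ) (q : ℕ),
      |∑ b ∈ Finset.range g, bitAt x (pos b) * Y (3 * b + q) j| ≤ H := by
    intro pos q
    refine (Finset.abs_sum_le_sum_abs _ _).trans (le_trans (Finset.sum_le_sum fun b _ => ?_)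
      (sum_three_mul_add_le g (f := fun i => Y i j * Y i j) (fun _ => mul_self_nonneg _)
        (fun i hi => by simp [hY i hi j hj]) q))
    rcases bitAt_eq_zero_or_one x (pos b) with h | h
    · rw [h, zero_mul, abs_zero]
      exact mul_self_nonneg _
    · rw [h, one_mul]
      rcases eq_or_ne (Y (3 * b + q) j) 0 with h0 | h0
      · simp [h0]
      · rw [← abs_mul_abs_self (Y (3 * b + q) j)]
        nlinarith [Int.one_le_abs h0]
  have hv : |pairVec p g Y c₀ q₀ c₁ q₁ x j| ≤ 3 * H := by
    rw [pairVec, Finset.sum_add_distrib, ← Finset.mul_sum, ← Finset.mul_sum]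
    refine (abs_add_le _ _).trans ?_
    rw [abs_mul, abs_mul]
    have h1 := key (hiPos p) q₀
    have h2 := key (loPos p) q₁
    have hH0 := (abs_nonneg _).trans h1
    nlinarith [mul_le_mul_of_nonneg_left h1 (abs_nonneg c₀),
      mul_le_mul_of_nonneg_left h2 (abs_nonneg c₁)]
  have h0 := abs_nonneg (pairVec p g Y c₀ q₀ c₁ q₁ x j)
  rw [← abs_mul_abs_self]
  nlinarith

/-- The label of the `i`-th point. -/
def labelOf (z y i : ℕ) : ℤ :=
  if i % 3 = 0 then bitAt z (hiPos p (i / 3)) else if i % 3 = 1 then bitAt z (loPos p (i / 3))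
    else bitAt y (hiPos p (i / 3))

theorem labelOf_three_mul (z y b : ℕ) : labelOf p z y (3 * b) = bitAt z (hiPos p b) := by
  unfold labelOf
  rw [if_pos (by omega), show 3 * b / 3 = b by omega]

theorem labelOf_three_mul_add_one (z y b : ℕ) :
    labelOf p z y (3 * b + 1) = bitAt z (loPos p b) := by
  unfold labelOf
  rw [if_neg (by omega), if_pos (by omega), show (3 * b + 1) / 3 = b by omega]

theorem labelOf_three_mul_add_two (z y b : ℕ) :
    labelOf p z y (3 * b + 2) = bitAt y (hiPos p b) := by
  unfold labelOf
  rw [if_neg (by omega), if_neg (by omega), show (3 * b + 2) / 3 = b by omega]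

theorem labelOf_eq_zero_or_one (z y i : ℕ) : labelOf p z y i = 0 ∨ labelOf p z y i = 1 := by
  unfold labelOf
  split_ifs <;> exact bitAt_eq_zero_or_one _ _

/-- The points are dealt to the three parts by their index modulo `3`; indices from `n` to `3 * g`
are padding, on which `f` vanishes. -/
theorem sum_labelOf_mul {f : ℕ → ℤ} {n : ℕ} (hg : n ≤ 3 * g) (hn : ∀ i, n ≤ i → f i = 0)
    (z y : ℕ) : ∑ b ∈ Finset.range g, (bitAt z (hiPos p b) * f (3 * b) +
      bitAt z (loPos p b) * f (3 * b + 1) + bitAt y (hiPos p b) * f (3 * b + 2)) =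
        ∑ i ∈ Finset.range n, labelOf p z y i * f i := by
  rw [Finset.sum_subset (Finset.range_mono hg) (by
    intro i _ hi
    rw [hn i (by simpa using hi), mul_zero]), mul_comm 3 g, Finset.sum_range_mul]
  refine Finset.sum_congr rfl fun b _ => ?_
  simp only [Finset.sum_range_succ, Finset.sum_range_zero, zero_add, add_zero, mul_comm b 3,
    labelOf_three_mul, labelOf_three_mul_add_one, labelOf_three_mul_add_two]

end Objective

/-! ## The cost of a clustering into two clusters -/

section TwoMeans

variable {n d : ℕ}

/-- The size of the second cluster. -/
def clusterSize (c : Fin n → Fin 2) : ℤ := ∑ i, ((c i : ℕ) : ℤ)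

/-- The squared distance of the weighted centers, up to a factor. -/
def clusterSpread (x : Fin n → Fin d → ℤ) (c : Fin n → Fin 2) : ℤ :=
  ∑ l, (∑ i, ((c i : ℕ) : ℤ) * (n * x i l - ∑ i', x i' l)) ^ 2

theorem sum_mul_sub_sq (w y : Fin n → ℝ) (μ : ℝ) : ∑ i, w i * (y i - μ) ^ 2 =
    ∑ i, w i * y i ^ 2 - 2 * μ * ∑ i, w i * y i + μ ^ 2 * ∑ i, w i := by
  rw [Finset.mul_sum, Finset.mul_sum, ← Finset.sum_sub_distrib, ← Finset.sum_add_distrib]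
  exact Finset.sum_congr rfl fun i _ => by ring

theorem sum_mul_eq_zero {w : Fin n → ℝ} (hw : ∀ i, 0 ≤ w i) (h : ∑ i, w i = 0) (y : Fin n → ℝ) :
    ∑ i, w i * y i = 0 := by
  have := (Finset.sum_eq_zero_iff_of_nonneg fun i _ => hw i).1 h
  exact Finset.sum_eq_zero fun i hi => by rw [this i hi, zero_mul]

/-- Completing the square in `μ`: the difference of the sides is `(∑ w y - μ ∑ w)² / ∑ w`. For an
empty cluster the quotient is `0` by convention and there is nothing to gain. -/
theorem le_sum_mul_sub_sq {w : Fin n → ℝ} (hw : ∀ i, 0 ≤ w i) (y : Fin n → ℝ) (μ : ℝ) :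
    ∑ i, w i * y i ^ 2 - (∑ i, w i * y i) ^ 2 / ∑ i, w i ≤ ∑ i, w i * (y i - μ) ^ 2 := by
  rw [sum_mul_sub_sq]
  rcases (Finset.sum_nonneg fun i _ => hw i : (0 : ℝ) ≤ ∑ i, w i).eq_or_lt with h | h
  · rw [sum_mul_eq_zero hw h.symm y, ← h]
    simp
  · have : (∑ i, w i * y i) ^ 2 / ∑ i, w i - 2 * μ * ∑ i, w i * y i + μ ^ 2 * ∑ i, w i =
        (∑ i, w i * y i - μ * ∑ i, w i) ^ 2 / ∑ i, w i := by
      field_simp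
      ring
    have h2 : 0 ≤ (∑ i, w i * y i - μ * ∑ i, w i) ^ 2 / ∑ i, w i := by positivity
    linarith

theorem sum_mul_sub_sq_center {w : Fin n → ℝ} (hw : ∀ i, 0 ≤ w i) (y : Fin n → ℝ) {μ : ℝ}
    (hμ : μ * ∑ i, w i = ∑ i, w i * y i) : ∑ i, w i * (y i - μ) ^ 2 =
      ∑ i, w i * y i ^ 2 - (∑ i, w i * y i) ^ 2 / ∑ i, w i := by
  rw [sum_mul_sub_sq]
  rcases (Finset.sum_nonneg fun i _ => hw i : (0 : ℝ) ≤ ∑ i, w i).eq_or_lt with h | h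
  · rw [sum_mul_eq_zero hw h.symm y, ← h]
    simp
  · rw [← hμ]
    field_simp
    ring

theorem kMeansCost_two (x : Fin n → Fin d → ℤ) (c : Fin n → Fin 2)
    (μ : Fin 2 → EuclideanSpace ℝ (Fin d)) : kMeansCost (toPoints x) c μ =
      ∑ l, (∑ i, (1 - ((c i : ℕ) : ℝ)) * ((x i l : ℝ) - μ 0 l) ^ 2 +
        ∑ i, ((c i : ℕ) : ℝ) * ((x i l : ℝ) - μ 1 l) ^ 2) := by
  unfold kMeansCost
  rw [Fin.sum_univ_two, Finset.sum_add_distrib, Finset.sum_comm, Finset.sum_comm (γ := Fin d),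
    Finset.sum_filter, Finset.sum_filter]
  congr 1 <;> refine Finset.sum_congr rfl fun i _ => ?_ <;>
  · rw [EuclideanSpace.norm_sq_eq]
    have : c i = 0 ∨ c i = 1 := by omega
    rcases this with h | h <;> simp [h, toPoints]

/-- The part of the sum of squares in one coordinate that the centers account for. -/
noncomputable def clusterGain (y : Fin n → ℝ) (c : Fin n → Fin 2) : ℝ :=
  (∑ i, (1 - ((c i : ℕ) : ℝ)) * y i) ^ 2 / ∑ i, (1 - ((c i : ℕ) : ℝ)) +
    (∑ i, ((c i : ℕ) : ℝ) * y i) ^ 2 / ∑ i, ((c i : ℕ) : ℝ)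

theorem label_bounds (c : Fin n → Fin 2) (i : Fin n) :
    0 ≤ ((c i : ℕ) : ℝ) ∧ 0 ≤ 1 - ((c i : ℕ) : ℝ) := by
  have : (c i : ℕ) ≤ 1 := by omega
  exact ⟨Nat.cast_nonneg _, sub_nonneg.2 (by exact_mod_cast this)⟩

theorem le_kMeansCost (x : Fin n → Fin d → ℤ) (c : Fin n → Fin 2)
    (μ : Fin 2 → EuclideanSpace ℝ (Fin d)) :
    ∑ l, (∑ i, (x i l : ℝ) ^ 2 - clusterGain (fun i => (x i l : ℝ)) c) ≤
      kMeansCost (toPoints x) c μ := by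
  rw [kMeansCost_two]
  refine Finset.sum_le_sum fun l _ => ?_
  have h0 := le_sum_mul_sub_sq (fun i => (label_bounds c i).2) (fun i => (x i l : ℝ)) (μ 0 l)
  have h1 := le_sum_mul_sub_sq (fun i => (label_bounds c i).1) (fun i => (x i l : ℝ)) (μ 1 l)
  have h2 : ∑ i, (1 - ((c i : ℕ) : ℝ)) * (x i l : ℝ) ^ 2 + ∑ i, ((c i : ℕ) : ℝ) * (x i l : ℝ) ^ 2 =
      ∑ i, (x i l : ℝ) ^ 2 := by
    rw [← Finset.sum_add_distrib]
    exact Finset.sum_congr rfl fun i _ => by ring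
  unfold clusterGain
  linarith

theorem kMeansCost_center (x : Fin n → Fin d → ℤ) (c : Fin n → Fin 2)
    (μ : Fin 2 → EuclideanSpace ℝ (Fin d))
    (h0 : ∀ l, μ 0 l * ∑ i, (1 - ((c i : ℕ) : ℝ)) = ∑ i, (1 - ((c i : ℕ) : ℝ)) * (x i l : ℝ))
    (h1 : ∀ l, μ 1 l * ∑ i, ((c i : ℕ) : ℝ) = ∑ i, ((c i : ℕ) : ℝ) * (x i l : ℝ)) :
    kMeansCost (toPoints x) c μ =
      ∑ l, (∑ i, (x i l : ℝ) ^ 2 - clusterGain (fun i => (x i l : ℝ)) c) := by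
  rw [kMeansCost_two]
  refine Finset.sum_congr rfl fun l _ => ?_
  rw [sum_mul_sub_sq_center (fun i => (label_bounds c i).2) (fun i => (x i l : ℝ)) (h0 l),
    sum_mul_sub_sq_center (fun i => (label_bounds c i).1) (fun i => (x i l : ℝ)) (h1 l)]
  have h2 : ∑ i, (1 - ((c i : ℕ) : ℝ)) * (x i l : ℝ) ^ 2 + ∑ i, ((c i : ℕ) : ℝ) * (x i l : ℝ) ^ 2 =
      ∑ i, (x i l : ℝ) ^ 2 := by
    rw [← Finset.sum_add_distrib]
    exact Finset.sum_congr rfl fun i _ => by ring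
  unfold clusterGain
  linarith

/-- With `S = S₀ + S₁` and cluster sizes `n - k`, `k` one has `S₀²/(n-k) + S₁²/k = S²/n + (n S₁ - k
S)²/(n k (n-k))`. The first term is common to all clusterings, the second involves only the centered
points. -/
theorem clusterGain_eq (y : Fin n → ℝ) (c : Fin n → Fin 2) : clusterGain y c =
    (∑ i, y i) ^ 2 / n + (∑ i, ((c i : ℕ) : ℝ) * (n * y i - ∑ i', y i')) ^ 2 /
      (n * (clusterSize c * (n - clusterSize c))) := by
  have hk : (clusterSize c : ℝ) = ∑ i, ((c i : ℕ) : ℝ) := by simp [clusterSize]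
  have hk0 : ∑ i, (1 - ((c i : ℕ) : ℝ)) = n - clusterSize c := by
    rw [Finset.sum_sub_distrib, hk]; simp
  have hT : ∑ i, ((c i : ℕ) : ℝ) * (n * y i - ∑ i', y i') =
      n * ∑ i, ((c i : ℕ) : ℝ) * y i - clusterSize c * ∑ i, y i := by
    rw [hk, Finset.mul_sum, Finset.sum_mul, ← Finset.sum_sub_distrib]
    exact Finset.sum_congr rfl fun i _ => by ring
  have hS0 : ∑ i, (1 - ((c i : ℕ) : ℝ)) * y i = ∑ i, y i - ∑ i, ((c i : ℕ) : ℝ) * y i := by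
    rw [← Finset.sum_sub_distrib]
    exact Finset.sum_congr rfl fun i _ => by ring
  have z1 : (clusterSize c : ℝ) = 0 → ∑ i, ((c i : ℕ) : ℝ) * y i = 0 := fun h =>
    sum_mul_eq_zero (fun i => (label_bounds c i).1) (hk.symm.trans h) y
  have z0 : (n : ℝ) - clusterSize c = 0 → ∑ i, (1 - ((c i : ℕ) : ℝ)) * y i = 0 := fun h =>
    sum_mul_eq_zero (fun i => (label_bounds c i).2) (hk0.trans h) y
  unfold clusterGain
  rw [hk0, hT, ← hk]
  rw [hS0] at z0 ⊢
  -- If a cluster is empty, its sum vanishes and division by zero gives `0`, so both sides reduce to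
  -- `S² / n`.
  by_cases h1 : (clusterSize c : ℝ) = 0
  · rw [z1 h1, h1]
    simp
  by_cases h2 : (n : ℝ) - clusterSize c = 0
  · have e1 : ∑ i, ((c i : ℕ) : ℝ) * y i = ∑ i, y i := by linarith [z0 h2]
    have e2 : (clusterSize c : ℝ) = n := by linarith
    rw [e1, e2]
    simp
  have hn : (n : ℝ) ≠ 0 := by
    intro hn
    have : n = 0 := by exact_mod_cast hn
    subst this
    simp [clusterSize] at h1
  field_simp
  ring

theorem clusterSize_nonneg (c : Fin n → Fin 2) : 0 ≤ clusterSize c :=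
  Finset.sum_nonneg fun _ _ => by positivity

theorem clusterSize_le (c : Fin n → Fin 2) : clusterSize c ≤ n := by
  refine (Finset.sum_le_card_nsmul _ _ 1 fun i _ => ?_).trans (by simp)
  omega

theorem surjective_of_clusterSize {c : Fin n → Fin 2} (h : 0 < clusterSize c)
    (h' : clusterSize c < n) : Function.Surjective c := by
  have h1 : ∃ i, c i = 1 := by
    by_contra hc
    push Not at hc
    have : clusterSize c = 0 := Finset.sum_eq_zero fun i _ => by
      have := hc i; omega
    omega
  have h0 : ∃ i, c i = 0 := by
    by_contra hc
    push Not at hc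
    have : clusterSize c = ∑ i : Fin n, 1 := Finset.sum_congr rfl fun i _ => by
      have := hc i; omega
    simp at this
    omega
  intro j
  rcases (by omega : j = 0 ∨ j = 1) with rfl | rfl
  exacts [h0, h1]

/-- A clustering with maximal spread relative to the sizes of the clusters, together with its
centers, solves the `2`-means problem. -/
theorem isKMeansSolution_of_spread {x : Fin n → Fin d → ℤ} {c : Fin n → Fin 2}
    {μ : Fin 2 → EuclideanSpace ℝ (Fin d)}
    (h0 : ∀ l, μ 0 l * ∑ i, (1 - ((c i : ℕ) : ℝ)) = ∑ i, (1 - ((c i : ℕ) : ℝ)) * (x i l : ℝ))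
    (h1 : ∀ l, μ 1 l * ∑ i, ((c i : ℕ) : ℝ) = ∑ i, ((c i : ℕ) : ℝ) * (x i l : ℝ))
    (hc : 2 ≤ n → 0 < clusterSize c ∧ clusterSize c < n)
    (hopt : ∀ c' : Fin n → Fin 2, 0 < clusterSize c' → clusterSize c' < n →
      clusterSpread x c' * (clusterSize c * (n - clusterSize c)) ≤
        clusterSpread x c * (clusterSize c' * (n - clusterSize c'))) :
    IsKMeansSolution (toPoints x) c μ := by
  refine ⟨fun h => surjective_of_clusterSize (hc h).1 (hc h).2, fun c' μ' => ?_⟩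
  rw [kMeansCost_center x c μ h0 h1]
  refine le_trans ?_ (le_kMeansCost x c' μ')
  rw [Finset.sum_sub_distrib, Finset.sum_sub_distrib]
  refine sub_le_sub_left ?_ _
  have key : ∀ c : Fin n → Fin 2, ∑ l, clusterGain (fun i => (x i l : ℝ)) c =
      ∑ l, (∑ i, (x i l : ℝ)) ^ 2 / n +
        clusterSpread x c / (n * (clusterSize c * (n - clusterSize c)) : ℝ) := by
    intro c
    simp only [clusterGain_eq]
    rw [Finset.sum_add_distrib, clusterSpread]
    push_cast
    rw [Finset.sum_div]
  rw [key, key]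
  refine add_le_add_right ?_ _
  have hsp : ∀ c : Fin n → Fin 2, (0 : ℝ) ≤ clusterSpread x c := fun c => by
    exact_mod_cast (Finset.sum_nonneg fun _ _ => sq_nonneg _ : 0 ≤ clusterSpread x c)
  have hk0 : (0 : ℝ) ≤ clusterSize c := by exact_mod_cast clusterSize_nonneg c
  have hkn : (0 : ℝ) ≤ n - clusterSize c := sub_nonneg.2 (by exact_mod_cast clusterSize_le c)
  -- A competitor with an empty cluster has spread term `0`, since its denominator is `0`; it can
  -- never be strictly better, and `hopt` is needed only for proper clusterings.
  rcases (clusterSize_nonneg c').eq_or_lt with h | h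
  · rw [← h]
    simp only [Int.cast_zero, zero_mul, mul_zero, div_zero]
    exact div_nonneg (hsp c) (by positivity)
  rcases (clusterSize_le c').eq_or_lt with h' | h'
  · rw [h']
    simp only [Int.cast_natCast, sub_self, mul_zero, div_zero]
    exact div_nonneg (hsp c) (by positivity)
  have hn : 2 ≤ n := by omega
  obtain ⟨a1, a2⟩ := hc hn
  have hn0 : (0 : ℝ) < n := by positivity
  have p1 : (0 : ℝ) < clusterSize c := by exact_mod_cast a1
  have p2 : (0 : ℝ) < n - clusterSize c := sub_pos.2 (by exact_mod_cast a2)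
  have p3 : (0 : ℝ) < clusterSize c' := by exact_mod_cast h
  have p4 : (0 : ℝ) < n - clusterSize c' := sub_pos.2 (by exact_mod_cast h')
  have ho : (clusterSpread x c' : ℝ) * (clusterSize c * (n - clusterSize c)) ≤
      clusterSpread x c * (clusterSize c' * (n - clusterSize c')) := by
    exact_mod_cast hopt c' h h'
  rw [div_le_div_iff₀ (by positivity) (by positivity)]
  nlinarith

end TwoMeans

namespace RAM

/-! ## Expressions for the search -/

instance : Add Expr := ⟨.op .add⟩
instance : Sub Expr := ⟨.op .sub⟩
instance : Mul Expr := ⟨.op .mul⟩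
instance : Div Expr := ⟨.op .div⟩
instance (k : ℕ) : OfNat Expr k := ⟨.const k⟩

@[simp] theorem Expr.eval_add (u v : Expr) (s : Store) : (u + v).eval s = u.eval s + v.eval s := rfl
@[simp] theorem Expr.eval_sub (u v : Expr) (s : Store) : (u - v).eval s = u.eval s - v.eval s := rfl
@[simp] theorem Expr.eval_mul (u v : Expr) (s : Store) : (u * v).eval s = u.eval s * v.eval s := rfl
@[simp] theorem Expr.eval_div (u v : Expr) (s : Store) : (u / v).eval s = u.eval s / v.eval s := rfl
@[simp] theorem Expr.eval_zero (s : Store) : Expr.eval 0 s = 0 := rfl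
@[simp] theorem Expr.eval_one (s : Store) : Expr.eval 1 s = 1 := rfl
@[simp] theorem Expr.eval_two (s : Store) : Expr.eval 2 s = 2 := rfl
@[simp] theorem Expr.eval_three (s : Store) : Expr.eval 3 s = 3 := rfl
@[simp] theorem Expr.eval_four (s : Store) : Expr.eval 4 s = 4 := rfl
@[simp] theorem Expr.eval_eighteen (s : Store) : Expr.eval 18 s = 18 := rfl
@[simp] theorem Expr.eval_const (z : ℤ) (s : Store) : Expr.eval (.const z) s = z := rfl
@[simp] theorem Expr.eval_var (x : ℕ) (s : Store) : Expr.eval (.var x) s = s.var x := rfl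
@[simp] theorem Expr.eval_read (a : ℕ) (i : Expr) (s : Store) :
    Expr.eval (.read a i) s = s.arr a (i.eval s) := rfl
theorem Expr.eval_sum (x w : ℕ) (u : Expr) (s : Store) : Expr.eval (.sum x w u) s =
    ∑ i ∈ Finset.range (s.var w).toNat, u.eval (s.setVar x i) := rfl

@[simp] theorem Expr.fits_add (u v : Expr) : (u + v).Fits ↔ u.Fits ∧ v.Fits := Iff.rfl
@[simp] theorem Expr.fits_sub (u v : Expr) : (u - v).Fits ↔ u.Fits ∧ v.Fits := Iff.rfl
@[simp] theorem Expr.fits_mul (u v : Expr) : (u * v).Fits ↔ u.Fits ∧ v.Fits := Iff.rfl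
@[simp] theorem Expr.fits_div (u v : Expr) : (u / v).Fits ↔ u.Fits ∧ v.Fits := Iff.rfl
@[simp] theorem Expr.fits_zero : Expr.Fits 0 := trivial
@[simp] theorem Expr.fits_one : Expr.Fits 1 := trivial
@[simp] theorem Expr.fits_two : Expr.Fits 2 := trivial
@[simp] theorem Expr.fits_three : Expr.Fits 3 := trivial
@[simp] theorem Expr.fits_four : Expr.Fits 4 := trivial
@[simp] theorem Expr.fits_eighteen : Expr.Fits 18 := trivial

/-- `1` if `u` is positive, `0` otherwise. -/
def Expr.pos (u : Expr) : Expr := 0 - (0 - u) / (u * u + 1)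

/-- `1` if `u` vanishes, `0` otherwise. -/
def Expr.isZero (u : Expr) : Expr := 1 - (u * u).pos

@[simp] theorem Expr.fits_pos (u : Expr) : u.pos.Fits ↔ u.Fits := by simp [Expr.pos]
@[simp] theorem Expr.fits_isZero (u : Expr) : u.isZero.Fits ↔ u.Fits := by simp [Expr.isZero]

/-- As `|z| < z * z + 1`, the quotient of `-z` by `z * z + 1`, rounded down, is `-1` or `0`, and it
is `-1` exactly for positive `z`. Such indicators replace conditionals. -/
theorem Expr.eval_pos (u : Expr) (s : Store) : u.pos.eval s = if 0 < u.eval s then 1 else 0 := by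
  simp only [Expr.pos, eval_sub, eval_zero, eval_one, eval_div, eval_add, eval_mul]
  generalize u.eval s = z
  have h1 : z * z + 1 > 0 := by nlinarith
  split_ifs with h
  · have : (0 - z) / (z * z + 1) = -1 := by
      rw [Int.ediv_eq_iff_of_pos h1]
      constructor <;> nlinarith
    rw [this]; rfl
  · have : (0 - z) / (z * z + 1) = 0 := by
      rw [Int.ediv_eq_iff_of_pos h1]
      constructor <;> nlinarith
    rw [this]; rfl

theorem Expr.eval_isZero (u : Expr) (s : Store) :
    u.isZero.eval s = if u.eval s = 0 then 1 else 0 := by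
  simp only [Expr.isZero, eval_sub, eval_one, eval_pos, eval_mul, mul_self_pos, ne_eq, ite_not]
  split_ifs <;> rfl

/-- The remainder of `u` modulo `v`. -/
def Expr.rem (u v : Expr) : Expr := u - u / v * v

@[simp] theorem Expr.fits_rem (u v : Expr) : (u.rem v).Fits ↔ u.Fits ∧ v.Fits := by
  simp only [Expr.rem, fits_sub, fits_mul, fits_div]; tauto

theorem Expr.eval_rem (u v : Expr) (s : Store) : (u.rem v).eval s = u.eval s % v.eval s := by
  simp only [Expr.rem, eval_sub, eval_mul, eval_div]
  rw [Int.emod_def, mul_comm (v.eval s)]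

/-- The bit of the variable `x` at the position `i`; the array `4` holds the powers of two. -/
def bitE (x : ℕ) (i : Expr) : Expr :=
  .var x / .read 4 i - 2 * (.var x / .read 4 i / 2)

/-- The position `hiPos`. -/
def hiPosE (p : ℕ) (b : Expr) : Expr := .const p * (b / .const p) + b + .const p

/-- The position `loPos`. -/
def loPosE (p : ℕ) (b : Expr) : Expr := .const p * (b / .const p) + b

/-- The coordinate with the number in the variable `41` of a point. -/
def pointE (i : Expr) : Expr := .read 5 (i * .var 1 + .var 41)

/-- The integer `pairWeight` of the variable `x`. -/
def pairWeightE (p : ℕ) (c₀ : ℤ) (q₀ : ℕ) (c₁ : ℤ) (q₁ x : ℕ) : Expr :=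
  .sum 41 1 (
    .sum 40 4 (.const c₀ * (bitE x (hiPosE p (.var 40)) * pointE (3 * .var 40 + .const q₀)) +
      .const c₁ * (bitE x (loPosE p (.var 40)) * pointE (3 * .var 40 + .const q₁))) *
    .sum 40 4 (.const c₀ * (bitE x (hiPosE p (.var 40)) * pointE (3 * .var 40 + .const q₀)) +
      .const c₁ * (bitE x (loPosE p (.var 40)) * pointE (3 * .var 40 + .const q₁))))

/-- The integer `tripleVec` of the variables `z` and `y`. -/
def tripleVecE (p z y : ℕ) : Expr :=
  .sum 40 4 (bitE z (hiPosE p (.var 40)) * pointE (3 * .var 40) +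
    bitE z (loPosE p (.var 40)) * pointE (3 * .var 40 + 1) +
    bitE y (hiPosE p (.var 40)) * pointE (3 * .var 40 + 2))

/-- The integer `tripleWeight` of the variables `z` and `y`. -/
def tripleWeightE (p z y : ℕ) : Expr := .sum 41 1 (tripleVecE p z y * tripleVecE p z y)

/-- The number of points that are selected by the row and the column of the variable `z`. -/
def pairSizeE (p z : ℕ) : Expr :=
  .sum 40 4 (bitE z (hiPosE p (.var 40)) * .read 6 (3 * .var 40) +
    bitE z (loPosE p (.var 40)) * .read 6 (3 * .var 40 + 1))

/-- The number of points that are selected by the row of the variable `y`. -/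
def thirdSizeE (p y : ℕ) : Expr :=
  .sum 40 4 (bitE y (hiPosE p (.var 40)) * .read 6 (3 * .var 40 + 2))

/-! ## The program -/

/-- Stores the first `N` values of `f` in the array `a`. -/
def tableStmt (a : ℕ) (f : ℕ → ℤ) : ℕ → Stmt
  | 0 => .write a 0 0
  | N + 1 => .seq (tableStmt a f N) (.write a (.const N) (.const (f N)))

/-- Transforms the vector in the array `a`, whose length is in the variable `17`, by the tensor
power of the matrix in the array `tab`; the variables `qin`, `qout` hold the numbers of columns and
of rows. -/
def transformStmt (tab a qin qout : ℕ) : Stmt :=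
  .loop 31 (.var 8) (.seq (.assign 17 (.var 17 / .var qin)) (.seq
    (.loop 30 (.var 17 * .var qout) (.write 13 (.var 30)
      (.sum 40 qin (.read tab ((Expr.var 30).rem (.var qout) * .var qin + .var 40) *
        .read a (.var 40 * .var 17 + .var 30 / .var qout))))) (.seq
    (.assign 17 (.var 17 * .var qout))
    (.loop 30 (.var 17) (.write a (.var 30) (.read 13 (.var 30)))))))

/-- The parameters and the table of the powers of two. -/
def paramStmt (p Q r : ℕ) : Stmt :=
  .seq (.assign 2 (.const Q)) (.seq (.assign 3 (.const r)) (.seq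
  (.assign 8 ((.var 0 + .const (3 * p - 1 : ℕ)) / .const (3 * p : ℕ))) (.seq
  (.assign 4 (.const p * .var 8)) (.seq
  (.write 4 0 1) (.seq
  (.loop 30 (4 * .var 4 + 1) (.write 4 (.var 30 + 1) (2 * .read 4 (.var 30)))) (.seq
  (.assign 9 (.read 4 (2 * .var 4)))
  (.assign 10 (.read 4 (4 * .var 4 + 1)))))))))

/-- The powers of the number of products and of the scaling factor. -/
def powerStmt (Δ : ℤ) : Stmt :=
  .seq (.assign 11 1) (.seq (.loop 30 (.var 8) (.assign 11 (.var 11 * .var 3))) (.seq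
  (.assign 12 1) (.loop 30 (.var 8) (.assign 12 (.var 12 * .const Δ)))))

/-- The centered points and the powers of the base. -/
def centerStmt : Stmt :=
  .seq (.loop 30 (.var 0) (.write 6 (.var 30) 1)) (.seq
  (.loop 30 (.var 0 * .var 1) (.write 5 (.var 30) (.var 0 * .read 0 (.var 30) -
    .sum 40 0 (.read 0 (.var 40 * .var 1 + (Expr.var 30).rem (.var 1)))))) (.seq
  (.assign 5 (18 * .sum 41 1 (.sum 40 0 (pointE (.var 40) * pointE (.var 40)) *
    .sum 40 0 (pointE (.var 40) * pointE (.var 40))))) (.seq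
  (.write 7 0 1)
  (.loop 30 (.var 5) (.write 7 (.var 30 + 1) (.read 7 (.var 30) * .var 10))))))

/-- The matrix product with exponentially coded weights, for third parts with as many points as
the variable `23` says. -/
def productStmt (p : ℕ) : Stmt :=
  .seq (.loop 30 (.var 9) (.write 11 (.var 30) (.read 7 (pairWeightE p 2 0 1 2 30)))) (.seq
  (.loop 30 (.var 9) (.write 12 (.var 30) (.read 7 (pairWeightE p 1 2 2 1 30) *
    (thirdSizeE p 30 - .var 23).isZero))) (.seq
  (.assign 17 (.var 9)) (.seq
  (transformStmt 8 11 2 3) (.seq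
  (.assign 17 (.var 9)) (.seq
  (transformStmt 9 12 2 3) (.seq
  (.loop 30 (.var 11) (.write 11 (.var 30) (.read 11 (.var 30) * .read 12 (.var 30)))) (.seq
  (.assign 17 (.var 11))
  (transformStmt 10 11 3 2))))))))

/-- Compares the best clustering found so far with those for the entry in the variable `30`. -/
def updateStmt (p : ℕ) : Stmt :=
  .seq (.assign 18 (.read 11 (.var 30) / .var 12)) (.seq
  (.assign 19 (.sum 40 5 (.var 18 + 1 - .read 7 (.var 40 + 1) : Expr).pos)) (.seq
  (.assign 20 (pairSizeE p 30 + .var 23)) (.seq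
  (.assign 21 (.var 19 - 2 * pairWeightE p 1 0 (-1) 1 30)) (.seq
  (.assign 22 ((Expr.var 18).pos * ((Expr.var 20).pos * ((.var 0 - .var 20 : Expr).pos *
    (.var 21 * .var 14 - .var 13 * (.var 20 * (.var 0 - .var 20)) : Expr).pos)))) (.seq
  (.assign 13 (.var 13 + .var 22 * (.var 21 - .var 13))) (.seq
  (.assign 14 (.var 14 + .var 22 * (.var 20 * (.var 0 - .var 20) - .var 14)))
  (.assign 15 (.var 15 + .var 22 * (.var 30 - .var 15)))))))))

/-- The search for the first two parts of an optimal clustering. -/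
def searchStmt (p : ℕ) : Stmt :=
  .seq (.assign 13 (.const (-1))) (.seq (.assign 14 1) (.seq (.assign 15 0)
  (.loop 23 (.var 4 + 1) (.seq (productStmt p) (.loop 30 (.var 9) (updateStmt p))))))

/-- The search for the third part. -/
def thirdStmt (p : ℕ) : Stmt :=
  .seq (.assign 16 0) (.loop 30 (.var 9) (.seq
    (.assign 20 (pairSizeE p 15 + thirdSizeE p 30))
    (.assign 16 (.var 16 + (Expr.var 20).pos * ((.var 0 - .var 20 : Expr).pos *
      (2 * tripleWeightE p 15 30 * .var 14 + 1 - .var 13 * (.var 20 * (.var 0 - .var 20)) :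
        Expr).pos) * (.var 30 - .var 16)))))

/-- The output of the labels and the centers. -/
def outputStmt (p : ℕ) : Stmt :=
  .seq (.loop 30 (3 * .var 4) (.write 1 (.var 30)
    (((Expr.var 30).rem 3).isZero * bitE 15 (hiPosE p (.var 30 / 3)) +
      ((Expr.var 30).rem 3 - 1).isZero * bitE 15 (loPosE p (.var 30 / 3)) +
      ((Expr.var 30).rem 3 - 2).isZero * bitE 16 (hiPosE p (.var 30 / 3))))) (.seq
  (.assign 18 (.sum 40 0 (.read 1 (.var 40)))) (.seq
  (.write 2 0 (.var 0 - .var 18 + (.var 0 - .var 18 : Expr).isZero)) (.seq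
  (.write 2 1 (.var 18 + (Expr.var 18).isZero)) (.seq
  (.loop 30 (.var 1) (.write 3 (.var 30)
    (.sum 40 0 ((1 - .read 1 (.var 40)) * .read 0 (.var 40 * .var 1 + .var 30)))))
  (.loop 30 (.var 1) (.write 3 (.var 30 + .var 1)
    (.sum 40 0 (.read 1 (.var 40) * .read 0 (.var 40 * .var 1 + .var 30)))))))))

/-- The whole program. -/
def mainStmt (p r : ℕ) (F G W : ℕ → ℕ → ℤ) (Δ : ℤ) : Stmt :=
  .seq (tableStmt 8 (fun i => F (i / (2 ^ p * 2 ^ p)) (i % (2 ^ p * 2 ^ p))) (r * (2 ^ p * 2 ^ p)))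
  (.seq
  (tableStmt 9 (fun i => G (i / (2 ^ p * 2 ^ p)) (i % (2 ^ p * 2 ^ p))) (r * (2 ^ p * 2 ^ p))) (.seq
  (tableStmt 10 (fun i => W (i / r) (i % r)) (2 ^ p * 2 ^ p * r)) (.seq
  (paramStmt p (2 ^ p * 2 ^ p) r) (.seq (powerStmt Δ) (.seq centerStmt (.seq
  (searchStmt p) (.seq (thirdStmt p) (outputStmt p))))))))

/-! ### Admissibility of the programs and their frames. -/

theorem tableStmt_fits (a : ℕ) (f : ℕ → ℤ) (N : ℕ) : (tableStmt a f N).Fits := by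
  induction N with
  | zero => exact ⟨trivial, trivial⟩
  | succ N ih => exact ⟨ih, trivial, trivial⟩

theorem pairWeightE_fits (p : ℕ) (c₀ : ℤ) (q₀ : ℕ) (c₁ : ℤ) (q₁ : ℕ) {x : ℕ} (hx : x < 64) :
    (pairWeightE p c₀ q₀ c₁ q₁ x).Fits := by
  simp [pairWeightE, bitE, hiPosE, loPosE, pointE, Expr.Fits, hx]

theorem tripleWeightE_fits (p : ℕ) {z y : ℕ} (hz : z < 64) (hy : y < 64) :
    (tripleWeightE p z y).Fits := by
  simp [tripleWeightE, tripleVecE, bitE, hiPosE, loPosE, pointE, Expr.Fits, hz, hy]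

theorem pairSizeE_fits (p : ℕ) {z : ℕ} (hz : z < 64) : (pairSizeE p z).Fits := by
  simp [pairSizeE, bitE, hiPosE, loPosE, Expr.Fits, hz]

theorem thirdSizeE_fits (p : ℕ) {z : ℕ} (hz : z < 64) : (thirdSizeE p z).Fits := by
  simp [thirdSizeE, bitE, hiPosE, Expr.Fits, hz]

theorem transformStmt_fits (tab a : ℕ) {qin qout : ℕ} (hi : qin < 8) (ho : qout < 8) :
    (transformStmt tab a qin qout).Fits := by
  simp [transformStmt, Stmt.Fits, Expr.Fits, hi, show qin < 64 by omega,
    show qout < 64 by omega]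

theorem paramStmt_fits (p Q r : ℕ) : (paramStmt p Q r).Fits := by
  simp [paramStmt, Stmt.Fits, Expr.Fits]

theorem powerStmt_fits (Δ : ℤ) : (powerStmt Δ).Fits := by
  simp [powerStmt, Stmt.Fits, Expr.Fits]

theorem centerStmt_fits : centerStmt.Fits := by
  simp [centerStmt, pointE, Stmt.Fits, Expr.Fits]

theorem productStmt_fits (p : ℕ) : (productStmt p).Fits := by
  simp [productStmt, Stmt.Fits, Expr.Fits, transformStmt_fits, pairWeightE_fits, thirdSizeE_fits]

theorem updateStmt_fits (p : ℕ) : (updateStmt p).Fits := by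
  simp [updateStmt, Stmt.Fits, Expr.Fits, pairWeightE_fits, pairSizeE_fits]

theorem searchStmt_fits (p : ℕ) : (searchStmt p).Fits := by
  simp [searchStmt, Stmt.Fits, Expr.Fits, productStmt_fits, updateStmt_fits]

theorem thirdStmt_fits (p : ℕ) : (thirdStmt p).Fits := by
  simp [thirdStmt, Stmt.Fits, Expr.Fits, pairSizeE_fits, thirdSizeE_fits, tripleWeightE_fits]

theorem outputStmt_fits (p : ℕ) : (outputStmt p).Fits := by
  simp [outputStmt, Stmt.Fits, Expr.Fits, bitE, hiPosE, loPosE]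

theorem mainStmt_fits (p r : ℕ) (F G W : ℕ → ℕ → ℤ) (Δ : ℤ) : (mainStmt p r F G W Δ).Fits := by
  simp [mainStmt, Stmt.Fits, tableStmt_fits, paramStmt_fits, powerStmt_fits, centerStmt_fits,
    searchStmt_fits, thirdStmt_fits, outputStmt_fits]

theorem tableStmt_vars (a : ℕ) (f : ℕ → ℤ) (N : ℕ) : (tableStmt a f N).vars = [] := by
  induction N with
  | zero => rfl
  | succ N ih => simp [tableStmt, Stmt.vars, ih]

theorem mem_tableStmt_arrs {a : ℕ} {f : ℕ → ℤ} {N b : ℕ} (h : b ∈ (tableStmt a f N).arrs) :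
    b = a := by
  induction N with
  | zero => simpa [tableStmt, Stmt.arrs] using h
  | succ N ih =>
    simp only [tableStmt, Stmt.arrs, List.mem_append, List.mem_singleton] at h
    exact h.elim ih id

/-! ## Loops that fill arrays -/

/-- The hypothesis `hstep` may use both the cells already written and the fact that the others are
still untouched. This covers tables in which a value is computed from its predecessor (`off = 1`)
and updates in place. -/
theorem Spec.fill {ℓ Y : ℕ} {s : Store} {x a : ℕ} {b idx u : Expr} {N off : ℕ} {f : ℕ → ℤ}
    (hp : (Stmt.write a idx u).Fits) (hx : 8 ≤ x) (hs : Good ℓ Y s) (hN : b.eval s = N)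
    (hb : bits (N : ℤ) ≤ ℓ) (hf : ∀ k < N, bits (f k) ≤ ℓ)
    (hstep : ∀ k < N, ∀ s', Frame [x] [a] s s' → s'.var x = k →
      (∀ k' < k, s'.arr a ((k' + off : ℕ) : ℤ) = f k') →
      (∀ j : ℤ, (∀ k' < k, j ≠ ((k' + off : ℕ) : ℤ)) → s'.arr a j = s.arr a j) →
      idx.eval s' = ((k + off : ℕ) : ℤ) ∧ u.eval s' = f k) :
    Spec ℓ Y (.loop x b (.write a idx u)) s (1 + N * 2) fun s' =>
      (∀ k < N, s'.arr a ((k + off : ℕ) : ℤ) = f k) ∧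
        ∀ j : ℤ, (∀ k < N, j ≠ ((k + off : ℕ) : ℤ)) → s'.arr a j = s.arr a j := by
  refine Spec.loop (n := 1) (fun i s' => (∀ k < i, s'.arr a ((k + off : ℕ) : ℤ) = f k) ∧
    ∀ j : ℤ, (∀ k < i, j ≠ ((k + off : ℕ) : ℤ)) → s'.arr a j = s.arr a j) hp hx hs hN hb
    (fun _ _ _ h => h) ⟨fun k hk => absurd hk (Nat.not_lt_zero k), fun _ _ => rfl⟩
    fun i hi s' _ hfr hxi hI => ?_
  obtain ⟨h1, h2⟩ := hstep i hi s' hfr hxi hI.1 hI.2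
  refine Spec.write h1 h2 (hf i hi) ⟨fun k hk => ?_, fun j hj => ?_⟩
  · rw [Store.setArr_arr]
    split_ifs with h
    · have : k = i := by have := h.2; push_cast at this; omega
      rw [this]
    · refine hI.1 k (lt_of_le_of_ne (Nat.lt_succ_iff.1 hk) fun hki => h ⟨rfl, ?_⟩)
      rw [hki]
  · rw [Store.setArr_arr, if_neg fun h => hj i (Nat.lt_succ_self i) h.2]
    exact hI.2 j fun k hk => hj k (Nat.lt_succ_of_lt hk)

theorem Spec.table {ℓ Y : ℕ} {s : Store} (hs : Good ℓ Y s) {a : ℕ} {f : ℕ → ℤ} (N : ℕ)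
    (hf : ∀ k < N, bits (f k) ≤ ℓ) :
    Spec ℓ Y (tableStmt a f N) s (N + 1) fun s' => ∀ k : ℕ, k < N → s'.arr a k = f k := by
  induction N with
  | zero =>
    exact Spec.write rfl rfl (by simp [bits]) fun k hk => absurd hk (Nat.not_lt_zero k)
  | succ N ih =>
    refine Spec.seq (tableStmt_fits a f N) hs (ih fun k hk => hf k (Nat.lt_succ_of_lt hk))
      fun s' _ _ h => Spec.write rfl rfl (hf N (Nat.lt_succ_self N)) fun k hk => ?_
    rw [Store.setArr_arr]
    split_ifs with hkN
    · have : k = N := by have := hkN.2; simpa using this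
      rw [this]
      rfl
    · exact h k (lt_of_le_of_ne (Nat.lt_succ_iff.1 hk) fun hki => hkN ⟨rfl, by rw [hki]; rfl⟩)

end RAM

open RAM

/-! ## Instances -/

/-- An instance of the problem, together with the parameters of the algorithm: `n` points `x i` of
dimension `d`, and the `K`-th power of a multiplication scheme for matrices of size `2 ^ p` with `r`
products, scaled by `Δ`. -/
structure Inst where
  (n d p r K M : ℕ)
  x : ℕ → ℕ → ℤ
  Δ : ℤ
  (F G W : ℕ → ℕ → ℤ)

namespace Inst

variable (I : Inst)

/-- The number of points in each of the three parts. -/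
def g : ℕ := I.p * I.K

/-- The number of entries of a matrix of the scheme. -/
def Q : ℕ := 2 ^ I.p * 2 ^ I.p

/-- The number of entries of the large matrices. -/
def size : ℕ := 2 ^ (2 * I.g)

/-- The points, translated and scaled such that their sum is `0`, padded by zeros. -/
def cen (i j : ℕ) : ℤ :=
  if i < I.n then I.n * I.x i j - ∑ i' ∈ Finset.range I.n, I.x i' j else 0

/-- The indicator function of the points. -/
def unit (i : ℕ) : ℤ := if i < I.n then 1 else 0

/-- A bound for the weights. -/
def maxExp : ℕ := (18 * ∑ j ∈ Finset.range I.d, (∑ i ∈ Finset.range I.n, I.cen i j * I.cen i j) *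
  ∑ i ∈ Finset.range I.n, I.cen i j * I.cen i j).toNat

/-- The base of the exponential coding. -/
def base : ℕ := 2 ^ (4 * I.g + 1)

/-- The conditions on the parameters. -/
structure Ok : Prop where
  p_pos : 0 < I.p
  Q_le : I.Q ≤ I.r
  n_le : I.n ≤ 3 * I.g
  Δ_ne : I.Δ ≠ 0
  scheme : ∀ x < I.Q, ∀ y < I.Q, ∀ z < I.Q,
    ∑ l ∈ Finset.range I.r, I.W z l * I.F l x * I.G l y = I.Δ * mulTensor (2 ^ I.p) x y z

/-- Bounds for the data. -/
structure Bounds (c h ℓ Y : ℕ) : Prop where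
  x_le : ∀ i < I.n, ∀ j < I.d, |I.x i j| ≤ I.M
  F_le : ∀ l < I.r, ∀ x < I.Q, |I.F l x| ≤ c
  G_le : ∀ l < I.r, ∀ x < I.Q, |I.G l x| ≤ c
  W_le : ∀ x < I.Q, ∀ l < I.r, |I.W x l| ≤ c
  one_le : 1 ≤ c
  mul_le : I.r * c ≤ 2 ^ h
  Δ_le : |I.Δ| ≤ 2 ^ h
  Y_ge : 4 * I.maxExp + I.n * I.n + I.n * I.d + I.n * I.M + 5 * I.g + I.K + I.Q + I.r + I.n + I.d +
    I.M + 1 ≤ Y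
  ℓ_ge : Y + h + 3 * (h * I.K) + 2 * ((4 * I.g + 1) * I.maxExp) + 1 ≤ ℓ

theorem maxExp_cast : (I.maxExp : ℤ) = 18 * ∑ j ∈ Finset.range I.d,
    (∑ i ∈ Finset.range I.n, I.cen i j * I.cen i j) *
      ∑ i ∈ Finset.range I.n, I.cen i j * I.cen i j :=
  Int.toNat_of_nonneg (mul_nonneg (by norm_num) (Finset.sum_nonneg fun _ _ => mul_self_nonneg _))

variable {I}

theorem cen_eq_zero {i : ℕ} (h : I.n ≤ i) (j : ℕ) : I.cen i j = 0 := if_neg (not_lt.2 h)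

/-- The factor `2` leaves room for the sum of two weights: exponents of the two matrix factors add
up to at most `maxExp`. -/
theorem two_mul_pairWeight_le {c₀ c₁ : ℤ} (q₀ q₁ : ℕ) (hc : |c₀| + |c₁| ≤ 3) (x : ℕ) :
    2 * pairWeight I.p I.g I.d I.cen c₀ q₀ c₁ q₁ x ≤ I.maxExp := by
  have := pairWeight_le I.p I.g I.d (Y := I.cen) (n := I.n) (fun i hi j _ => cen_eq_zero hi j)
    q₀ q₁ hc x
  rw [maxExp_cast]
  linarith

/-- A chain of integer inequalities, `|y| ≤ y² ≤ H ≤ H²`, where `H` is the sum of squares in one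
coordinate. -/
theorem abs_cen_le {i j : ℕ} (hj : j < I.d) : |I.cen i j| ≤ I.maxExp := by
  by_cases hi : i < I.n
  · rw [maxExp_cast]
    set H : ℕ → ℤ := fun j => ∑ i ∈ Finset.range I.n, I.cen i j * I.cen i j with hH
    have h0 : ∀ j, 0 ≤ H j := fun j => Finset.sum_nonneg fun _ _ => mul_self_nonneg _
    have h1 : I.cen i j * I.cen i j ≤ H j :=
      Finset.single_le_sum (f := fun i => I.cen i j * I.cen i j) (fun _ _ => mul_self_nonneg _)
        (Finset.mem_range.2 hi)
    have h2 : H j * H j ≤ ∑ j ∈ Finset.range I.d, H j * H j :=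
      Finset.single_le_sum (f := fun j => H j * H j) (fun _ _ => mul_self_nonneg _)
        (Finset.mem_range.2 hj)
    change _ ≤ 18 * ∑ j ∈ Finset.range I.d, H j * H j
    rw [← abs_mul_abs_self] at h1
    rcases (abs_nonneg (I.cen i j)).eq_or_lt with h | h
    · rw [← h]
      have := mul_self_nonneg (H j)
      linarith
    · have h3 : |I.cen i j| ≤ H j := by nlinarith
      have h4 : H j ≤ H j * H j := by nlinarith
      nlinarith
  · rw [cen_eq_zero (not_lt.1 hi), abs_zero]
    positivity

theorem Ok.r_pos (ok : I.Ok) : 0 < I.r := lt_of_lt_of_le (by unfold Q; positivity) ok.Q_le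

theorem Q_pos : 0 < I.Q := by unfold Q; positivity

theorem size_eq : I.size = I.Q ^ I.K := by
  rw [size, g, Q, ← pow_add, ← pow_mul]
  congr 1
  ring

namespace Bounds

variable {c h ℓ Y : ℕ}

theorem bits_le_of_le_Y (B : I.Bounds c h ℓ Y) {z : ℤ} (hz : |z| ≤ Y) : bits z ≤ ℓ := by
  have := B.ℓ_ge
  have h1 : Y < 2 ^ ℓ := lt_of_lt_of_le Nat.lt_two_pow_self (Nat.pow_le_pow_right (by norm_num)
    (by omega))
  exact bits_le_of_abs_le hz (by exact_mod_cast h1)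

end Bounds

end Inst

theorem RAM.bits_le_of_le_pow {z : ℤ} {k ℓ : ℕ} (hz : |z| ≤ 2 ^ k) (hk : k < ℓ) : bits z ≤ ℓ :=
  bits_le_of_abs_le hz (by gcongr; norm_num)

/-- The contents of the memory during the search: the parameters and the tables. -/
structure Env (I : Inst) (s : Store) : Prop where
  n : s.var 0 = I.n
  d : s.var 1 = I.d
  Q : s.var 2 = I.Q
  r : s.var 3 = I.r
  g : s.var 4 = I.g
  maxExp : s.var 5 = I.maxExp
  K : s.var 8 = I.K
  size : s.var 9 = I.size
  rpow : s.var 11 = (I.r ^ I.K : ℕ)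
  scale : s.var 12 = I.Δ ^ I.K
  x : ∀ i < I.n, ∀ j < I.d, s.arr 0 ((i * I.d + j : ℕ) : ℤ) = I.x i j
  two : ∀ i ≤ 4 * I.g + 1, s.arr 4 (i : ℤ) = 2 ^ i
  cen : ∀ i, ∀ j < I.d, s.arr 5 ((i * I.d + j : ℕ) : ℤ) = I.cen i j
  unit : ∀ i : ℕ, s.arr 6 (i : ℤ) = I.unit i
  base : ∀ i ≤ I.maxExp, s.arr 7 (i : ℤ) = (I.base : ℤ) ^ i
  F : ∀ l < I.r, ∀ x < I.Q, s.arr 8 ((l * I.Q + x : ℕ) : ℤ) = I.F l x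
  G : ∀ l < I.r, ∀ x < I.Q, s.arr 9 ((l * I.Q + x : ℕ) : ℤ) = I.G l x
  W : ∀ x < I.Q, ∀ l < I.r, s.arr 10 ((x * I.r + l : ℕ) : ℤ) = I.W x l

/-- Parameters and tables occupy variables below `13` and a fixed list of arrays, and the search
writes elsewhere, so a look at the write sets is enough to preserve `Env`. -/
theorem Env.frame {I : Inst} {s s' : Store} {vs as : List ℕ} (h : Env I s) (hf : Frame vs as s s')
    (hv : ∀ x ∈ vs, 13 ≤ x) (ha : ∀ a ∈ as, a ∉ [0, 4, 5, 6, 7, 8, 9, 10]) : Env I s' := by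
  have ev : ∀ x < 13, s'.var x = s.var x := fun x hx => hf.1 x fun h => by
    have := hv x h
    omega
  have ea : ∀ a ∈ [0, 4, 5, 6, 7, 8, 9, 10], s'.arr a = s.arr a := fun a hm =>
    hf.2 a fun h => ha a h hm
  constructor
  · rw [ev 0 (by omega), h.n]
  · rw [ev 1 (by omega), h.d]
  · rw [ev 2 (by omega), h.Q]
  · rw [ev 3 (by omega), h.r]
  · rw [ev 4 (by omega), h.g]
  · rw [ev 5 (by omega), h.maxExp]
  · rw [ev 8 (by omega), h.K]
  · rw [ev 9 (by omega), h.size]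
  · rw [ev 11 (by omega), h.rpow]
  · rw [ev 12 (by omega), h.scale]
  · rw [ea 0 (by decide)]; exact h.x
  · rw [ea 4 (by decide)]; exact h.two
  · rw [ea 5 (by decide)]; exact h.cen
  · rw [ea 6 (by decide)]; exact h.unit
  · rw [ea 7 (by decide)]; exact h.base
  · rw [ea 8 (by decide)]; exact h.F
  · rw [ea 9 (by decide)]; exact h.G
  · rw [ea 10 (by decide)]; exact h.W

theorem Frame.setVar (s : Store) (x : ℕ) (z : ℤ) : Frame [x] [] s (s.setVar x z) :=
  ⟨fun y hy => by simp only [List.mem_singleton] at hy; simp [hy], fun _ _ => rfl⟩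

theorem Env.setVar {I : Inst} {s : Store} (h : Env I s) {x : ℕ} (hx : 13 ≤ x) (z : ℤ) :
    Env I (s.setVar x z) :=
  h.frame (Frame.setVar s x z) (by simpa using hx) (by simp)

/-! ## The values of the expressions -/

theorem hiPos_lt {p K b : ℕ} (hp : 0 < p) (hb : b < p * K) : hiPos p b < 2 * (p * K) := by
  have h1 : b / p < K := Nat.div_lt_of_lt_mul hb
  have h2 := Nat.div_add_mod b p
  have h3 := Nat.mod_lt b hp
  have h4 : p * (b / p + 1) ≤ p * K := Nat.mul_le_mul_left p h1
  have h5 : p * (b / p + 1) = p * (b / p) + p := by ring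
  unfold hiPos
  omega

theorem loPos_lt {p K b : ℕ} (hp : 0 < p) (hb : b < p * K) : loPos p b < 2 * (p * K) :=
  lt_of_le_of_lt (by unfold hiPos loPos; omega) (hiPos_lt hp hb)

theorem eval_hiPosE {p b : ℕ} {u : Expr} {s : Store} (hu : u.eval s = b) :
    (hiPosE p u).eval s = (hiPos p b : ℕ) := by
  simp [hiPosE, hiPos, hu]

theorem eval_loPosE {p b : ℕ} {u : Expr} {s : Store} (hu : u.eval s = b) :
    (loPosE p u).eval s = (loPos p b : ℕ) := by
  simp [loPosE, loPos, hu]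

section Eval

variable {I : Inst} {s : Store}

theorem eval_bitE (E : Env I s) {x z i : ℕ} {u : Expr} (hx : s.var x = z) (hu : u.eval s = i)
    (hi : i < 2 * I.g) : (bitE x u).eval s = bitAt z i := by
  simp only [bitE, Expr.eval_sub, Expr.eval_div, Expr.eval_mul, Expr.eval_read, Expr.eval_var,
    Expr.eval_two, hx, hu, E.two i (by omega)]
  rw [bitAt_eq]

theorem eval_bitE_hiPosE (ok : I.Ok) (E : Env I s) {x z b : ℕ} {u : Expr} (hx : s.var x = z)
    (hu : u.eval s = b) (hb : b < I.g) :
    (bitE x (hiPosE I.p u)).eval s = bitAt z (hiPos I.p b) :=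
  eval_bitE E hx (eval_hiPosE hu) (hiPos_lt ok.p_pos hb)

theorem eval_bitE_loPosE (ok : I.Ok) (E : Env I s) {x z b : ℕ} {u : Expr} (hx : s.var x = z)
    (hu : u.eval s = b) (hb : b < I.g) :
    (bitE x (loPosE I.p u)).eval s = bitAt z (loPos I.p b) :=
  eval_bitE E hx (eval_loPosE hu) (loPos_lt ok.p_pos hb)

theorem eval_pointE (E : Env I s) {i j : ℕ} {u : Expr} (hj : s.var 41 = j) (hjd : j < I.d)
    (hu : u.eval s = i) : (pointE u).eval s = I.cen i j := by
  rw [← E.cen i j hjd]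
  simp [pointE, hu, hj, E.d]

theorem eval_sum_of {x w N : ℕ} {u : Expr} {f : ℕ → ℤ} (hw : s.var w = N)
    (hf : ∀ i < N, u.eval (s.setVar x i) = f i) :
    Expr.eval (.sum x w u) s = ∑ i ∈ Finset.range N, f i := by
  rw [Expr.eval_sum, hw, Int.toNat_natCast]
  exact Finset.sum_congr rfl fun i hi => hf i (Finset.mem_range.1 hi)

theorem eval_pairWeightE (ok : I.Ok) (E : Env I s) {x z : ℕ} (hx : s.var x = z) (hx1 : x ≠ 40)
    (hx2 : x ≠ 41) (c₀ : ℤ) (q₀ : ℕ) (c₁ : ℤ) (q₁ : ℕ) :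
    (pairWeightE I.p c₀ q₀ c₁ q₁ x).eval s = pairWeight I.p I.g I.d I.cen c₀ q₀ c₁ q₁ z := by
  refine eval_sum_of E.d fun j hj => ?_
  have key : Expr.eval (.sum 40 4 (.const c₀ * (bitE x (hiPosE I.p (.var 40)) *
      pointE (3 * .var 40 + .const q₀)) + .const c₁ * (bitE x (loPosE I.p (.var 40)) *
      pointE (3 * .var 40 + .const q₁)))) (s.setVar 41 j) =
      pairVec I.p I.g I.cen c₀ q₀ c₁ q₁ z j := by
    refine eval_sum_of (E.setVar (by norm_num) _).g fun b hb => ?_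
    have E' : Env I ((s.setVar 41 j).setVar 40 b) :=
      (E.setVar (by norm_num) _).setVar (by norm_num) _
    have hx' : ((s.setVar 41 j).setVar 40 b).var x = z := by simp [hx1, hx2, hx]
    simp only [Expr.eval_add, Expr.eval_mul, Expr.eval_const]
    rw [eval_bitE_hiPosE ok E' hx' (b := b) (by simp) hb,
      eval_bitE_loPosE ok E' hx' (b := b) (by simp) hb,
      eval_pointE E' (i := 3 * b + q₀) (j := j) (by simp) hj (by simp),
      eval_pointE E' (i := 3 * b + q₁) (j := j) (by simp) hj (by simp)]
  rw [Expr.eval_mul, key]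

theorem eval_tripleWeightE (ok : I.Ok) (E : Env I s) {x x' z y : ℕ} (hz : s.var x = z)
    (hy : s.var x' = y) (hx1 : x ≠ 40) (hx2 : x ≠ 41) (hx1' : x' ≠ 40) (hx2' : x' ≠ 41) :
    (tripleWeightE I.p x x').eval s = tripleWeight I.p I.g I.d I.cen z y := by
  refine eval_sum_of E.d fun j hj => ?_
  have key : (tripleVecE I.p x x').eval (s.setVar 41 j) = tripleVec I.p I.g I.cen z y j := by
    refine eval_sum_of (E.setVar (by norm_num) _).g fun b hb => ?_
    have E' : Env I ((s.setVar 41 j).setVar 40 b) :=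
      (E.setVar (by norm_num) _).setVar (by norm_num) _
    have hz' : ((s.setVar 41 j).setVar 40 b).var x = z := by simp [hx1, hx2, hz]
    have hy' : ((s.setVar 41 j).setVar 40 b).var x' = y := by simp [hx1', hx2', hy]
    simp only [Expr.eval_add, Expr.eval_mul]
    rw [eval_bitE_hiPosE ok E' hz' (b := b) (by simp) hb,
      eval_bitE_loPosE ok E' hz' (b := b) (by simp) hb,
      eval_bitE_hiPosE ok E' hy' (b := b) (by simp) hb,
      eval_pointE E' (i := 3 * b) (j := j) (by simp) hj (by simp),
      eval_pointE E' (i := 3 * b + 1) (j := j) (by simp) hj (by simp),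
      eval_pointE E' (i := 3 * b + 2) (j := j) (by simp) hj (by simp)]
  rw [Expr.eval_mul, key]

/-- The number of points that are selected by the row and the column of `z`. -/
def pairSize (I : Inst) (z : ℕ) : ℤ := ∑ b ∈ Finset.range I.g,
  (bitAt z (hiPos I.p b) * I.unit (3 * b) + bitAt z (loPos I.p b) * I.unit (3 * b + 1))

/-- The number of points that are selected by the row of `y`. -/
def thirdSize (I : Inst) (y : ℕ) : ℤ :=
  ∑ b ∈ Finset.range I.g, bitAt y (hiPos I.p b) * I.unit (3 * b + 2)

theorem eval_pairSizeE (ok : I.Ok) (E : Env I s) {x z : ℕ} (hz : s.var x = z) (hx1 : x ≠ 40) :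
    (pairSizeE I.p x).eval s = pairSize I z := by
  refine eval_sum_of E.g fun b hb => ?_
  have E' : Env I (s.setVar 40 b) := E.setVar (by norm_num) _
  have hz' : (s.setVar 40 b).var x = z := by simp [hx1, hz]
  simp only [Expr.eval_add, Expr.eval_mul]
  rw [eval_bitE_hiPosE ok E' hz' (b := b) (by simp) hb,
    eval_bitE_loPosE ok E' hz' (b := b) (by simp) hb, ← E'.unit (3 * b), ← E'.unit (3 * b + 1)]
  simp

theorem eval_thirdSizeE (ok : I.Ok) (E : Env I s) {x y : ℕ} (hy : s.var x = y) (hx1 : x ≠ 40) :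
    (thirdSizeE I.p x).eval s = thirdSize I y := by
  refine eval_sum_of E.g fun b hb => ?_
  have E' : Env I (s.setVar 40 b) := E.setVar (by norm_num) _
  have hy' : (s.setVar 40 b).var x = y := by simp [hx1, hy]
  simp only [Expr.eval_mul]
  rw [eval_bitE_hiPosE ok E' hy' (b := b) (by simp) hb, ← E'.unit (3 * b + 2)]
  simp

end Eval

/-! ## Straight-line programs -/

theorem RAM.Spec.assign_seq {ℓ Y : ℕ} {s : Store} {x : ℕ} {u : Expr} {z : ℤ} {q : Stmt} {n : ℕ}
    {Q : Store → Prop} (hz : u.eval s = z) (h : bits z ≤ ℓ) (hx : x < 8 → z ≤ Y)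
    (hq : Spec ℓ Y q (s.setVar x z) n Q) : Spec ℓ Y (.seq (.assign x u) q) s (1 + n) Q := by
  obtain ⟨s', e, h'⟩ := hq
  subst hz
  exact ⟨s', ⟨_, 1, n, ⟨h, hx, rfl, le_rfl⟩, e, le_rfl⟩, h'⟩

theorem RAM.Spec.write_seq {ℓ Y : ℕ} {s : Store} {a : ℕ} {i u : Expr} {j z : ℤ} {q : Stmt} {n : ℕ}
    {Q : Store → Prop} (hj : i.eval s = j) (hz : u.eval s = z) (h : bits z ≤ ℓ)
    (hq : Spec ℓ Y q (s.setArr a j z) n Q) : Spec ℓ Y (.seq (.write a i u) q) s (1 + n) Q := by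
  obtain ⟨s', e, h'⟩ := hq
  subst hz hj
  exact ⟨s', ⟨_, 1, n, ⟨h, rfl, le_rfl⟩, e, le_rfl⟩, h'⟩

open RAM

/-! ## The transformation by a tensor power -/

theorem pow_mul_pow_le {a b r K s : ℕ} (ha : a ≤ r) (hb : b ≤ r) (hs : s ≤ K) :
    b ^ (K - s) * a ^ s ≤ r ^ K := by
  calc b ^ (K - s) * a ^ s ≤ r ^ (K - s) * r ^ s := by gcongr
    _ = r ^ K := by rw [← pow_add]; congr 1; omega

/-- After `i` passes the array holds `partialTransform` with `s = i`, and the variable `17` its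
length `b ^ (K - i) * a ^ i`, which never exceeds `r ^ K`. A pass goes through the scratch array
`13`, since an old entry is needed for several new ones. -/
theorem transformStmt_spec {ℓ Y K a b r c h m tab arr qin qout : ℕ} {s : Store} {T : ℕ → ℕ → ℤ}
    {v : ℕ → ℤ} (hs : Good ℓ Y s) (ha : 0 < a) (hb : 0 < b) (har : a ≤ r) (hbr : b ≤ r)
    (hin : qin < 8) (hout : qout < 8) (htab : tab ≠ 13) (harr : arr ≠ 13) (hne : tab ≠ arr)
    (h8 : s.var 8 = K) (hqin : s.var qin = b) (hqout : s.var qout = a)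
    (h17 : s.var 17 = (b ^ K : ℕ))
    (hT : ∀ l < a, ∀ x < b, s.arr tab ((l * b + x : ℕ) : ℤ) = T l x)
    (hv : ∀ i < b ^ K, s.arr arr (i : ℤ) = v i) (hTc : ∀ l < a, ∀ x < b, |T l x| ≤ c)
    (hvm : ∀ i < b ^ K, |v i| ≤ 2 ^ m) (hbc : b * c ≤ 2 ^ h) (hℓ : h * K + m < ℓ)
    (hK : bits (K : ℤ) ≤ ℓ) (hr : bits ((r ^ K : ℕ) : ℤ) ≤ ℓ) :
    Spec ℓ Y (transformStmt tab arr qin qout) s (1 + K * (5 + 4 * r ^ K)) fun s' =>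
      ∀ i < a ^ K, s'.arr arr (i : ℤ) = ∑ x ∈ Finset.range (b ^ K), tensorPow T a b K i x * v x := by
  have hfits := transformStmt_fits tab arr hin hout
  have hbits : ∀ {N : ℕ}, N ≤ r ^ K → bits (N : ℤ) ≤ ℓ := fun hN =>
    (bits_mono (by simpa using hN)).trans hr
  refine (Spec.loop (b := .var 8) (N := K) (n := 4 + 4 * r ^ K) (fun i s' => s'.var 17 = (b ^ (K - i) * a ^ i : ℕ) ∧
      ∀ k < b ^ (K - i) * a ^ i, s'.arr arr (k : ℤ) = partialTransform T a b K i v k)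
    hfits.2.2.2 (by norm_num) hs h8 hK (fun i s v h => by simpa using h)
    ⟨by simpa using h17, fun k hk => by
      rw [partialTransform_zero]; exact hv k (by simpa using hk)⟩
    fun i hi s' hs' hfr _ ⟨hI1, hI2⟩ => ?_).mono (by ring_nf; rfl) fun s' hs' i hi => ?_
  · simp only [Stmt.vars, Stmt.arrs, List.cons_append, List.nil_append] at hfr
    -- The distance of two indices that differ by one in the leading digit; the old length is `b *
    -- L`, the new one `L * a`.
    set L := b ^ (K - (i + 1)) * a ^ i with hL
    have hbL : b ^ (K - i) * a ^ i = b * L := by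
      rw [hL, ← mul_assoc, ← pow_succ']
      congr 2
      omega
    have hLa : b ^ (K - (i + 1)) * a ^ (i + 1) = L * a := by rw [hL, pow_succ]; ring
    have hbLr : b * L ≤ r ^ K := hbL ▸ pow_mul_pow_le har hbr hi.le
    have hLar : L * a ≤ r ^ K := hLa ▸ pow_mul_pow_le har hbr hi
    have hLr : L ≤ r ^ K := (Nat.le_mul_of_pos_left L hb).trans hbLr
    rw [hbL] at hI1 hI2
    have vin : s'.var qin = b := by rw [hfr.1 qin (by simp; omega), hqin]
    have vout : s'.var qout = a := by rw [hfr.1 qout (by simp; omega), hqout]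
    have vtab : s'.arr tab = s.arr tab := hfr.2 tab (by simp [htab, hne])
    have hfb : ∀ k < L * a, bits (partialTransform T a b K (i + 1) v k) ≤ ℓ := fun k hk => by
      refine bits_le_of_le_pow (k := h * K + m) ((abs_partialTransform_le ha hb hTc hi hvm
        (by rwa [hLa])).trans ?_) hℓ
      have hbc' : (b * c : ℤ) ≤ 2 ^ h := by exact_mod_cast hbc
      calc ((b * c : ℤ)) ^ (i + 1) * 2 ^ m ≤ (2 ^ h) ^ (i + 1) * 2 ^ m := by gcongr
        _ ≤ (2 ^ h) ^ K * 2 ^ m := by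
          gcongr
          · exact one_le_pow₀ (by norm_num)
          · exact hi
        _ = _ := by rw [← pow_mul, ← pow_add]
    refine Spec.mono (n := 1 + ((1 + L * a * 2) + (1 + (1 + L * a * 2))))
      (Spec.assign_seq (z := (L : ℤ)) ?_ (hbits hLr) (by norm_num) ?_) (by omega) fun _ h => h
    · simp only [Expr.eval_div, Expr.eval_var, hI1, vin]
      push_cast
      exact Int.mul_ediv_cancel_left _ (by exact_mod_cast hb.ne')
    have hs₁ : Good ℓ Y (s'.setVar 17 L) := hs'.setVar (hbits hLr) (by norm_num)
    refine Spec.seq hfits.2.2.2.2.1 hs₁ (Spec.fill (N := L * a) (off := 0)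
      (f := fun k => partialTransform T a b K (i + 1) v k) hfits.2.2.2.2.1.2.2.2 (by norm_num) hs₁
      ?_ (hbits hLar) hfb ?_) ?_
    · simp [vout, show qout ≠ 17 by omega]
    · intro k hk s₂ hfr₂ h30 _ _
      refine ⟨by simp [h30], ?_⟩
      have e17 : s₂.var 17 = L := by rw [hfr₂.1 17 (by decide)]; simp
      have ein : s₂.var qin = b := by
        rw [hfr₂.1 qin (by simp; omega), Store.setVar_var, if_neg (by omega), vin]
      have eout : s₂.var qout = a := by
        rw [hfr₂.1 qout (by simp; omega), Store.setVar_var, if_neg (by omega), vout]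
      have etab : s₂.arr tab = s.arr tab := by rw [hfr₂.2 tab (by simpa using htab)]; exact vtab
      have earr : s₂.arr arr = s'.arr arr := hfr₂.2 arr (by simpa using harr)
      have hk1 : k / a < L := Nat.div_lt_of_lt_mul (by rwa [mul_comm])
      have hk2 : k % a < a := Nat.mod_lt k ha
      have hk3 : k / a * a + k % a = k := by rw [mul_comm]; exact Nat.div_add_mod k a
      have := partialTransform_succ T (K := K) (s := i) (b := b) ha hi v (k / a) hk2
      rw [hk3, ← hL] at this
      simp only [this]
      refine eval_sum_of ein fun x hx => ?_
      simp only [Expr.eval_mul, Expr.eval_read, Expr.eval_add, Expr.eval_rem, Expr.eval_div,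
        Expr.eval_var, Store.setVar_var, Store.setVar_arr, etab, earr, h30, e17,
        if_neg (show qin ≠ 40 by omega), if_neg (show qout ≠ 40 by omega), ein, eout]
      norm_num only [if_false, if_true]
      have hidx : x * L + k / a < b * L := by
        calc x * L + k / a < x * L + L := by omega
          _ = (x + 1) * L := by ring
          _ ≤ _ := Nat.mul_le_mul_right _ hx
      rw [← hT _ hk2 x hx, ← hI2 _ hidx]
      push_cast
      rfl
    · intro s₂ hs₂ hfr₂ ⟨hQ, _⟩
      refine Spec.assign_seq (z := ((L * a : ℕ) : ℤ)) ?_ (hbits hLar) (by norm_num) ?_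
      · simp only [Expr.eval_mul, Expr.eval_var]
        rw [hfr₂.1 17 (by simp [Stmt.vars]), hfr₂.1 qout (by simp [Stmt.vars]; omega),
          Store.setVar_var, Store.setVar_var, if_pos rfl, if_neg (by omega), vout]
        push_cast
        rfl
      · have hs₃ : Good ℓ Y (s₂.setVar 17 ((L * a : ℕ) : ℤ)) :=
          hs₂.setVar (hbits hLar) (by norm_num)
        refine (Spec.frame hfits.2.2.2.2.2.2 hs₃ (Spec.fill (N := L * a) (off := 0)
          (f := fun k => partialTransform T a b K (i + 1) v k) hfits.2.2.2.2.2.2.2.2.2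
          (by norm_num) hs₃ (by simp) (hbits hLar) hfb ?_)).mono le_rfl fun s₄ hs₄ => ?_
        · intro k hk s₄ hfr₄ h30 _ _
          refine ⟨by simp [h30], ?_⟩
          simp only [Expr.eval_read, Expr.eval_var, h30]
          rw [hfr₄.2 13 (by simpa using harr.symm)]
          exact hQ k hk
        · obtain ⟨_, hfr₄, hQ₄, _⟩ := hs₄
          rw [hLa]
          exact ⟨by rw [hfr₄.1 17 (by simp [Stmt.vars])]; simp, hQ₄⟩
  · rw [← partialTransform_self T a b K v hi]
    exact hs'.2 i (by simpa using hi)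

open RAM

/-! ## The matrix product -/

section Product

variable {I : Inst}

/-- The exponential code of the weight of an entry of the left matrix. -/
def leftCode (I : Inst) (x : ℕ) : ℤ :=
  (I.base : ℤ) ^ (pairWeight I.p I.g I.d I.cen 2 0 1 2 x).toNat

/-- The exponential code of the weight of an entry of the right matrix, for third parts with `κ`
points. -/
def rightCode (I : Inst) (κ y : ℕ) : ℤ :=
  (I.base : ℤ) ^ (pairWeight I.p I.g I.d I.cen 1 2 2 1 y).toNat *
    if thirdSize I y - κ = 0 then 1 else 0

/-- The entry of the product. -/
def productEntry (I : Inst) (κ z : ℕ) : ℤ :=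
  ∑ x ∈ Finset.range I.size, ∑ y ∈ Finset.range I.size,
    if Compat I.p I.g x y z then leftCode I x * rightCode I κ y else 0

theorem sum_mul_sum_mul_sum (N₁ N₂ N₃ : ℕ) (w : ℕ → ℤ) (f g : ℕ → ℕ → ℤ) (A D : ℕ → ℤ) :
    ∑ l ∈ Finset.range N₁, w l * ((∑ x ∈ Finset.range N₂, f l x * A x) *
      ∑ y ∈ Finset.range N₃, g l y * D y) = ∑ x ∈ Finset.range N₂, ∑ y ∈ Finset.range N₃,
        (∑ l ∈ Finset.range N₁, w l * f l x * g l y) * (A x * D y) := by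
  simp_rw [Finset.sum_mul_sum, Finset.mul_sum, Finset.sum_mul]
  rw [Finset.sum_comm]
  refine Finset.sum_congr rfl fun x _ => ?_
  rw [Finset.sum_comm]
  exact Finset.sum_congr rfl fun y _ => Finset.sum_congr rfl fun l _ => by ring

/-- After interchanging sums, the coefficient of each pair `x, y` is an entry of the tensor power of
the scheme, that is, `Δ ^ K` times the indicator of compatibility. -/
theorem transform_eq_productEntry (ok : I.Ok) (κ z : ℕ) :
    ∑ l ∈ Finset.range (I.r ^ I.K), tensorPow I.W I.Q I.r I.K z l *
      ((∑ x ∈ Finset.range (I.Q ^ I.K), tensorPow I.F I.r I.Q I.K l x * leftCode I x) *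
        ∑ y ∈ Finset.range (I.Q ^ I.K), tensorPow I.G I.r I.Q I.K l y * rightCode I κ y) =
      I.Δ ^ I.K * productEntry I κ z := by
  rw [sum_mul_sum_mul_sum, productEntry, Finset.mul_sum, Inst.size_eq]
  refine Finset.sum_congr rfl fun x _ => ?_
  rw [Finset.mul_sum]
  refine Finset.sum_congr rfl fun y _ => ?_
  have := sum_tensorPow (m := 2 ^ I.p) (by positivity) ok.scheme I.K x y z
  rw [mulTensorPow_two_pow ok.p_pos] at this
  change _ = _ * (if Compat I.p I.g x y z then 1 else 0) at this
  change ∑ l ∈ Finset.range (I.r ^ I.K), tensorPow I.W I.Q I.r I.K z l *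
    tensorPow I.F I.r I.Q I.K l x * tensorPow I.G I.r I.Q I.K l y = _ at this
  rw [this]
  split_ifs <;> ring

theorem toNat_pairWeight_le {c₀ c₁ : ℤ} (q₀ q₁ : ℕ) (hc : |c₀| + |c₁| ≤ 3) (x : ℕ) :
    (pairWeight I.p I.g I.d I.cen c₀ q₀ c₁ q₁ x).toNat ≤ I.maxExp := by
  have h1 := Inst.two_mul_pairWeight_le (I := I) q₀ q₁ hc x
  have h2 := pairWeight_nonneg I.p I.g I.d I.cen c₀ q₀ c₁ q₁ x
  omega

theorem base_pow_le {k : ℕ} (hk : k ≤ I.maxExp) :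
    (I.base : ℤ) ^ k ≤ 2 ^ ((4 * I.g + 1) * I.maxExp) := by
  rw [Inst.base]
  push_cast
  rw [← pow_mul]
  exact pow_le_pow_right₀ (by norm_num) (Nat.mul_le_mul_left _ hk)

theorem abs_leftCode_le (x : ℕ) : |leftCode I x| ≤ 2 ^ ((4 * I.g + 1) * I.maxExp) := by
  rw [leftCode, abs_of_nonneg (by positivity)]
  exact base_pow_le (toNat_pairWeight_le 0 2 (by norm_num) x)

theorem abs_rightCode_le (κ y : ℕ) : |rightCode I κ y| ≤ 2 ^ ((4 * I.g + 1) * I.maxExp) := by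
  rw [rightCode, abs_of_nonneg (by positivity)]
  split_ifs
  · rw [mul_one]; exact base_pow_le (toNat_pairWeight_le 2 1 (by norm_num) y)
  · rw [mul_zero]; positivity

variable {c h ℓ Y : ℕ}

theorem Inst.Bounds.pow_le (B : I.Bounds c h ℓ Y) : (I.r : ℤ) ^ I.K ≤ 2 ^ (h * I.K) := by
  have h1 : I.r ≤ 2 ^ h := (Nat.le_mul_of_pos_right _ B.one_le).trans B.mul_le
  rw [pow_mul]
  gcongr
  exact_mod_cast h1

theorem Inst.Bounds.bits_pow (B : I.Bounds c h ℓ Y) : bits ((I.r ^ I.K : ℕ) : ℤ) ≤ ℓ := by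
  refine bits_le_of_le_pow (k := h * I.K) ?_ (by have := B.ℓ_ge; omega)
  rw [abs_of_nonneg (by positivity)]
  push_cast
  exact B.pow_le

theorem Inst.Ok.size_le (ok : I.Ok) : I.size ≤ I.r ^ I.K := by
  rw [Inst.size_eq]
  exact Nat.pow_le_pow_left ok.Q_le _

theorem Inst.Bounds.bits_size (ok : I.Ok) (B : I.Bounds c h ℓ Y) : bits (I.size : ℤ) ≤ ℓ :=
  (bits_mono (by simpa using ok.size_le)).trans B.bits_pow

theorem Inst.Bounds.bits_natCast_le (B : I.Bounds c h ℓ Y) {k : ℕ} (hk : k ≤ Y) :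
    bits (k : ℤ) ≤ ℓ :=
  B.bits_le_of_le_Y (by rw [abs_of_nonneg (by positivity)]; exact_mod_cast hk)

theorem abs_transform_le {T : ℕ → ℕ → ℤ} {a b K m : ℕ} {v : ℕ → ℤ} (ha : 0 < a) (hb : 0 < b)
    (hT : ∀ l < a, ∀ x < b, |T l x| ≤ c) (hv : ∀ i < b ^ K, |v i| ≤ 2 ^ m) (hbc : b * c ≤ 2 ^ h)
    {i : ℕ} (hi : i < a ^ K) :
    |∑ x ∈ Finset.range (b ^ K), tensorPow T a b K i x * v x| ≤ 2 ^ (h * K + m) := by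
  rw [← partialTransform_self T a b K v hi]
  refine (abs_partialTransform_le ha hb hT le_rfl hv (by simpa using hi)).trans ?_
  have hbc' : (b * c : ℤ) ≤ 2 ^ h := by exact_mod_cast hbc
  calc ((b * c : ℤ)) ^ K * 2 ^ m ≤ (2 ^ h) ^ K * 2 ^ m := by gcongr
    _ = _ := by rw [← pow_mul, ← pow_add]

/-- The three transformations dominate, with `K` passes each over at most `r ^ K` entries; the sizes
of the codes matter only for the bit length. -/
theorem productStmt_spec (ok : I.Ok) (B : I.Bounds c h ℓ Y) {s : Store} (E : Env I s)
    (hs : Good ℓ Y s) {κ : ℕ} (h23 : s.var 23 = κ) :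
    Spec ℓ Y (productStmt I.p) s (30 * ((I.K + 1) * I.r ^ I.K)) fun s' =>
      ∀ z < I.size, s'.arr 11 (z : ℤ) = I.Δ ^ I.K * productEntry I κ z := by
  set R := I.r ^ I.K with hR
  set m := (4 * I.g + 1) * I.maxExp with hm
  have hℓ := B.ℓ_ge
  have hY := B.Y_ge
  rw [← hm] at hℓ
  have hR1 : 1 ≤ R := Nat.one_le_pow _ _ ok.r_pos
  have hsz : I.size ≤ R := ok.size_le
  have hQc : I.Q * c ≤ 2 ^ h := (Nat.mul_le_mul_right c ok.Q_le).trans B.mul_le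
  have hKb : bits (I.K : ℤ) ≤ ℓ := B.bits_natCast_le (by omega)
  have hfit := productStmt_fits I.p
  have f1 := hfit.1
  have f2 := hfit.2.1
  have f4 := hfit.2.2.2.1
  have f6 := hfit.2.2.2.2.2.1
  have f7 := hfit.2.2.2.2.2.2.1
  refine Spec.mono (n := (1 + I.size * 2) + ((1 + I.size * 2) + (1 + ((1 + I.K * (5 + 4 * R)) +
    (1 + ((1 + I.K * (5 + 4 * R)) + ((1 + R * 2) + (1 + (1 + I.K * (5 + 4 * R)))))))))) ?_
    (by nlinarith) fun _ h => h
  refine Spec.seq f1 hs (Spec.fill (N := I.size) (off := 0) (f := leftCode I) f1.2.2.2 (by norm_num)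
    hs E.size (B.bits_size ok) (fun k _ => bits_le_of_le_pow (abs_leftCode_le k) (by omega)) ?_) ?_
  · intro k hk s₁ hfr h30 _ _
    have E₁ : Env I s₁ := E.frame hfr (by decide) (by decide)
    refine ⟨by simp [h30], ?_⟩
    rw [Expr.eval_read, eval_pairWeightE ok E₁ h30 (by norm_num) (by norm_num),
      ← Int.toNat_of_nonneg (pairWeight_nonneg I.p I.g I.d I.cen 2 0 1 2 k),
      E₁.base _ (toNat_pairWeight_le 0 2 (by norm_num) k)]
    rfl
  intro s₁ hs₁ hfr₁ ⟨hA₁, _⟩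
  have E₁ : Env I s₁ := E.frame hfr₁ (by simp [Stmt.vars]) (by simp [Stmt.arrs])
  have k₁ : s₁.var 23 = κ := by rw [hfr₁.1 23 (by simp [Stmt.vars]), h23]
  refine Spec.seq f2 hs₁ (Spec.fill (N := I.size) (off := 0) (f := rightCode I κ) f2.2.2.2
    (by norm_num) hs₁ E₁.size (B.bits_size ok)
    (fun k _ => bits_le_of_le_pow (abs_rightCode_le κ k) (by omega)) ?_) ?_
  · intro k hk s₂ hfr h30 _ _
    have E₂ : Env I s₂ := E₁.frame hfr (by decide) (by decide)
    refine ⟨by simp [h30], ?_⟩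
    rw [Expr.eval_mul, Expr.eval_isZero, Expr.eval_sub, Expr.eval_var, hfr.1 23 (by decide), k₁,
      eval_thirdSizeE ok E₂ h30 (by norm_num), Expr.eval_read,
      eval_pairWeightE ok E₂ h30 (by norm_num) (by norm_num),
      ← Int.toNat_of_nonneg (pairWeight_nonneg I.p I.g I.d I.cen 1 2 2 1 k),
      E₂.base _ (toNat_pairWeight_le 2 1 (by norm_num) k)]
    rfl
  intro s₂ hs₂ hfr₂ ⟨hD₂, _⟩
  have E₂ : Env I s₂ := E₁.frame hfr₂ (by simp [Stmt.vars]) (by simp [Stmt.arrs])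
  have hA₂ : ∀ k < I.Q ^ I.K, s₂.arr 11 (k : ℤ) = leftCode I k := fun k hk => by
    rw [hfr₂.2 11 (by simp [Stmt.arrs])]
    exact hA₁ k (by rwa [Inst.size_eq])
  refine Spec.assign_seq E₂.size (B.bits_size ok) (by norm_num) ?_
  have hs₃ := hs₂.setVar (x := 17) (B.bits_size ok) (by norm_num)
  have E₃ : Env I (s₂.setVar 17 I.size) := E₂.setVar (by norm_num) _
  refine Spec.seq f4 hs₃ (transformStmt_spec (m := m) (r := I.r) (T := I.F) (v := leftCode I) hs₃
    ok.r_pos Inst.Q_pos le_rfl ok.Q_le (by norm_num) (by norm_num) (by norm_num) (by norm_num)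
    (by norm_num) E₃.K E₃.Q E₃.r (by rw [Store.setVar_var, if_pos rfl, Inst.size_eq]) E₃.F hA₂
    B.F_le (fun i _ => abs_leftCode_le i) hQc (by omega) hKb B.bits_pow) ?_
  intro s₄ hs₄ hfr₄ hA₄
  have E₄ : Env I s₄ := E₃.frame hfr₄ (by decide) (by decide)
  have hD₄ : ∀ k < I.Q ^ I.K, s₄.arr 12 (k : ℤ) = rightCode I κ k := fun k hk => by
    rw [hfr₄.2 12 (by decide)]
    exact hD₂ k (by rwa [Inst.size_eq])
  refine Spec.assign_seq E₄.size (B.bits_size ok) (by norm_num) ?_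
  have hs₅ := hs₄.setVar (x := 17) (B.bits_size ok) (by norm_num)
  have E₅ : Env I (s₄.setVar 17 I.size) := E₄.setVar (by norm_num) _
  refine Spec.seq f6 hs₅ (transformStmt_spec (m := m) (r := I.r) (T := I.G) (v := rightCode I κ) hs₅
    ok.r_pos Inst.Q_pos le_rfl ok.Q_le (by norm_num) (by norm_num) (by norm_num) (by norm_num)
    (by norm_num) E₅.K E₅.Q E₅.r (by rw [Store.setVar_var, if_pos rfl, Inst.size_eq]) E₅.G hD₄
    B.G_le (fun i _ => abs_rightCode_le κ i) hQc (by omega) hKb B.bits_pow) ?_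
  intro s₆ hs₆ hfr₆ hD₆
  have E₆ : Env I s₆ := E₅.frame hfr₆ (by decide) (by decide)
  set α : ℕ → ℤ := fun l =>
    ∑ x ∈ Finset.range (I.Q ^ I.K), tensorPow I.F I.r I.Q I.K l x * leftCode I x with hα
  set β : ℕ → ℤ := fun l =>
    ∑ y ∈ Finset.range (I.Q ^ I.K), tensorPow I.G I.r I.Q I.K l y * rightCode I κ y with hβ
  have hA₆ : ∀ l < R, s₆.arr 11 (l : ℤ) = α l := fun l hl => by
    rw [hfr₆.2 11 (by decide)]
    exact hA₄ l hl
  -- Each transformation adds `h * K` bits to the `m` bits of a code, the pointwise product doubles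
  -- the length, and the last transformation adds `h * K` once more: hence `3 * (h * K) + 2 * m` in
  -- the bound for `ℓ`.
  have hαβ : ∀ l < R, |α l * β l| ≤ 2 ^ (2 * (h * I.K + m)) := fun l hl => by
    rw [abs_mul, two_mul, pow_add]
    exact mul_le_mul
      (abs_transform_le ok.r_pos Inst.Q_pos B.F_le (fun i _ => abs_leftCode_le i) hQc hl)
      (abs_transform_le ok.r_pos Inst.Q_pos B.G_le (fun i _ => abs_rightCode_le κ i) hQc hl)
      (abs_nonneg _) (by positivity)
  refine Spec.seq f7 hs₆ (Spec.fill (N := R) (off := 0) (f := fun l => α l * β l) f7.2.2.2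
    (by norm_num) hs₆ E₆.rpow B.bits_pow (fun k hk => bits_le_of_le_pow (hαβ k hk) (by omega)) ?_) ?_
  -- The update is in place: cell `k` of the array `11` still has its old value when it is read.
  · intro k hk s₇ hfr h30 _ hrest
    refine ⟨by simp [h30], ?_⟩
    rw [Expr.eval_mul, Expr.eval_read, Expr.eval_read, Expr.eval_var, h30,
      hrest k (fun k' hk' h => by rw [add_zero] at h; omega), hA₆ k hk, hfr.2 12 (by decide),
      hD₆ k hk]
  intro s₇ hs₇ hfr₇ ⟨hP₇, _⟩
  have E₇ : Env I s₇ := E₆.frame hfr₇ (by decide) (by decide)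
  refine Spec.assign_seq E₇.rpow B.bits_pow (by norm_num) ?_
  have hs₈ := hs₇.setVar (x := 17) B.bits_pow (by norm_num)
  have E₈ : Env I (s₇.setVar 17 ((I.r ^ I.K : ℕ) : ℤ)) := E₇.setVar (by norm_num) _
  refine Spec.mono (transformStmt_spec (m := 2 * (h * I.K + m)) (r := I.r) (T := I.W)
    (v := fun l => α l * β l) hs₈ Inst.Q_pos ok.r_pos ok.Q_le le_rfl (by norm_num) (by norm_num)
    (by norm_num) (by norm_num) (by norm_num) E₈.K E₈.r E₈.Q (by simp) E₈.W hP₇ B.W_le hαβ B.mul_le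
    (by omega) hKb B.bits_pow) le_rfl fun s₉ h₉ z hz => ?_
  rw [Inst.size_eq] at hz
  rw [h₉ z hz]
  exact transform_eq_productEntry ok κ z

end Product

open RAM

/-! ## Reading off the maximal exponent -/

theorem sum_ite_le_eq {N k : ℕ} (hk : k ≤ N) :
    ∑ i ∈ Finset.range N, (if i + 1 ≤ k then (1 : ℤ) else 0) = k := by
  rw [Finset.sum_ite, Finset.sum_const_zero, add_zero, Finset.sum_const, nsmul_eq_mul, mul_one]
  congr 1
  have : Finset.filter (fun i => i + 1 ≤ k) (Finset.range N) = Finset.range k := by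
    ext i
    simp only [Finset.mem_filter, Finset.mem_range]
    omega
  rw [this, Finset.card_range]

/-- Fewer than `b` powers of `b` cannot produce a carry past the largest one: the sum lies between
`b ^ e t` and `b ^ (e t + 1)`. Counting the `i` with `b ^ (i + 1)` at most the sum therefore gives
the maximal exponent. -/
theorem pow_le_sum_pow_iff {ι : Type*} {P : Finset ι} {e : ι → ℕ} {b : ℤ} (hb : (P.card : ℤ) < b)
    {t : ι} (ht : t ∈ P) (hmax : ∀ t' ∈ P, e t' ≤ e t) (i : ℕ) :
    b ^ (i + 1) ≤ ∑ t ∈ P, b ^ e t ↔ i + 1 ≤ e t := by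
  have hb0 : 1 ≤ b := by omega
  constructor
  · intro h
    by_contra hlt
    have h1 : ∑ t ∈ P, b ^ e t ≤ P.card * b ^ i := by
      rw [← nsmul_eq_mul]
      exact Finset.sum_le_card_nsmul _ _ _ fun t' ht' =>
        pow_le_pow_right₀ hb0 ((hmax t' ht').trans (by omega))
    have h2 : (P.card : ℤ) * b ^ i < b * b ^ i :=
      mul_lt_mul_of_pos_right hb (pow_pos (by omega) i)
    rw [pow_succ'] at h
    omega
  · intro h
    calc b ^ (i + 1) ≤ b ^ e t := pow_le_pow_right₀ hb0 h
      _ ≤ _ := Finset.single_le_sum (f := fun t => b ^ e t)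
        (fun _ _ => pow_nonneg (by omega) _) ht

/-! ## The search for the first two parts -/

section Search

variable {I : Inst}

/-- Twice the squared norm of the sum of the selected points. -/
def spread (I : Inst) (z y : ℕ) : ℤ := 2 * tripleWeight I.p I.g I.d I.cen z y

/-- The number of selected points. -/
def selSize (I : Inst) (z y : ℕ) : ℤ := pairSize I z + thirdSize I y

/-- The number of pairs of a selected and a remaining point. -/
def selPairs (I : Inst) (z y : ℕ) : ℤ := selSize I z y * (I.n - selSize I z y)

/-- The selected and the remaining points form two non-empty clusters. -/
def Proper (I : Inst) (z y : ℕ) : Prop := 0 < selSize I z y ∧ 0 < I.n - selSize I z y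

/-- The entries `y` and `z` of the second factor and of the product are in the same column. -/
def Cand (I : Inst) (z y : ℕ) : Prop := y < I.size ∧ ∃ x < I.size, Compat I.p I.g x y z

/-- The fraction `num / den` is attained by a clustering with first two parts `best`, and it is
maximal among the clusterings with first two parts `z` and third part of size `κ`, if `D κ z`. -/
structure Best (I : Inst) (D : ℕ → ℕ → Prop) (num den best : ℤ) : Prop where
  num_le : |num| ≤ I.maxExp + 1
  den_pos : 0 < den
  den_le : den ≤ I.n * I.n + 1
  attained : ∃ z < I.size, best = (z : ℕ) ∧ ((num = -1 ∧ den = 1) ∨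
    ∃ y < I.size, Proper I z y ∧ spread I z y = num ∧ selPairs I z y = den)
  maximal : ∀ κ z, D κ z → ∀ y, Cand I z y → thirdSize I y = κ → Proper I z y →
    spread I z y * den ≤ num * selPairs I z y

theorem spread_eq {x y z : ℕ} (hc : Compat I.p I.g x y z) : spread I z y =
    (((pairWeight I.p I.g I.d I.cen 2 0 1 2 x).toNat +
      (pairWeight I.p I.g I.d I.cen 1 2 2 1 y).toNat : ℕ) : ℤ) -
        2 * pairWeight I.p I.g I.d I.cen 1 0 (-1) 1 z := by
  rw [spread, two_mul_tripleWeight I.p I.g I.d I.cen hc]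
  push_cast
  rw [Int.toNat_of_nonneg (pairWeight_nonneg I.p I.g I.d I.cen 2 0 1 2 x),
    Int.toNat_of_nonneg (pairWeight_nonneg I.p I.g I.d I.cen 1 2 2 1 y)]

theorem productEntry_eq (κ z : ℕ) : productEntry I κ z =
    ∑ t ∈ (Finset.range I.size ×ˢ Finset.range I.size).filter
      (fun t => Compat I.p I.g t.1 t.2 z ∧ thirdSize I t.2 = κ), (I.base : ℤ) ^
        ((pairWeight I.p I.g I.d I.cen 2 0 1 2 t.1).toNat +
          (pairWeight I.p I.g I.d I.cen 1 2 2 1 t.2).toNat) := by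
  rw [Finset.sum_filter, Finset.sum_product, productEntry]
  refine Finset.sum_congr rfl fun x _ => Finset.sum_congr rfl fun y _ => ?_
  by_cases h1 : Compat I.p I.g x y z <;> by_cases h2 : thirdSize I y = κ <;>
    simp [h1, h2, leftCode, rightCode, sub_eq_zero, pow_add]

/-- The value that the program reads off an entry of the product. -/
theorem productEntry_decode (κ z : ℕ) :
    (productEntry I κ z = 0 ∧ ∀ y, Cand I z y → thirdSize I y ≠ κ) ∨
    (0 < productEntry I κ z ∧ ∃ y, Cand I z y ∧ thirdSize I y = κ ∧
      ∑ i ∈ Finset.range I.maxExp,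
        (if 0 < productEntry I κ z + 1 - (I.base : ℤ) ^ (i + 1) then (1 : ℤ) else 0) -
          2 * pairWeight I.p I.g I.d I.cen 1 0 (-1) 1 z = spread I z y ∧
      ∀ y', Cand I z y' → thirdSize I y' = κ → spread I z y' ≤ spread I z y) := by
  set P := (Finset.range I.size ×ˢ Finset.range I.size).filter
      (fun t => Compat I.p I.g t.1 t.2 z ∧ thirdSize I t.2 = κ) with hP
  set e : ℕ × ℕ → ℕ := fun t => (pairWeight I.p I.g I.d I.cen 2 0 1 2 t.1).toNat +
          (pairWeight I.p I.g I.d I.cen 1 2 2 1 t.2).toNat with he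
  have hentry : productEntry I κ z = ∑ t ∈ P, (I.base : ℤ) ^ e t := productEntry_eq κ z
  have hmem : ∀ x y, x < I.size → y < I.size → Compat I.p I.g x y z → thirdSize I y = κ →
      (x, y) ∈ P := fun x y hx hy hc hk => by
    rw [hP]
    simp only [Finset.mem_filter, Finset.mem_product, Finset.mem_range]
    exact ⟨⟨hx, hy⟩, hc, hk⟩
  have hbase : (0 : ℤ) < I.base := by unfold Inst.base; positivity
  rcases P.eq_empty_or_nonempty with h | h
  · refine Or.inl ⟨by rw [hentry, h, Finset.sum_empty], fun y ⟨hy, x, hx, hc⟩ hk => ?_⟩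
    have := hmem x y hx hy hc hk
    simp [h] at this
  · refine Or.inr ?_
    obtain ⟨t, ht, hmax⟩ := P.exists_max_image e h
    have ht' := ht
    rw [hP] at ht'
    simp only [Finset.mem_filter, Finset.mem_product, Finset.mem_range] at ht'
    obtain ⟨⟨hx, hy⟩, hc, hk⟩ := ht'
    -- There are at most `size * size = 2 ^ (4 * g)` pairs, whence the exponent `4 * g + 1` of the
    -- base.
    have hcard : (P.card : ℤ) < I.base := by
      have h1 : P.card ≤ I.size * I.size := by
        refine (Finset.card_filter_le _ _).trans ?_
        simp
      have h2 : I.size * I.size < I.base := by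
        rw [Inst.size, Inst.base, ← pow_add]
        exact Nat.pow_lt_pow_right (by norm_num) (by omega)
      exact_mod_cast lt_of_le_of_lt h1 h2
    refine ⟨?_, t.2, ⟨hy, t.1, hx, hc⟩, hk, ?_, ?_⟩
    · rw [hentry]
      exact Finset.sum_pos (fun _ _ => by positivity) h
    · rw [spread_eq hc]
      congr 1
      rw [← sum_ite_le_eq (N := I.maxExp) (k := e t)]
      · refine Finset.sum_congr rfl fun i _ => ?_
        rw [hentry]
        have := pow_le_sum_pow_iff hcard ht hmax i
        congr 1
        rw [← this]
        exact propext ⟨fun h => by omega, fun h => by omega⟩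
      -- The sum of the two exponents is at most `maxExp`, so counting up to `maxExp` misses
      -- nothing.
      · have h1 := Inst.two_mul_pairWeight_le (I := I) 0 2 (c₀ := 2) (c₁ := 1) (by norm_num) t.1
        have h2 := Inst.two_mul_pairWeight_le (I := I) 2 1 (c₀ := 1) (c₁ := 2) (by norm_num) t.2
        simp only [he]
        omega
    · rintro y' ⟨hy', x', hx', hc'⟩ hk'
      rw [spread_eq hc, spread_eq hc']
      have := hmax _ (hmem x' y' hx' hy' hc' hk')
      simp only [he] at this
      push_cast at *
      linarith

theorem spread_nonneg (z y : ℕ) : 0 ≤ spread I z y :=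
  mul_nonneg (by norm_num) (Finset.sum_nonneg fun _ _ => mul_self_nonneg _)

theorem spread_le {z y : ℕ} (h : Cand I z y) : spread I z y ≤ I.maxExp := by
  obtain ⟨_, x, _, hc⟩ := h
  have h0 := two_mul_tripleWeight I.p I.g I.d I.cen hc
  have h1 := Inst.two_mul_pairWeight_le (I := I) 0 2 (c₀ := 2) (c₁ := 1) (by norm_num) x
  have h2 := Inst.two_mul_pairWeight_le (I := I) 2 1 (c₀ := 1) (c₁ := 2) (by norm_num) y
  have h3 := pairWeight_nonneg I.p I.g I.d I.cen 1 0 (-1) 1 z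
  rw [spread]
  linarith

theorem Best.mono {D D' : ℕ → ℕ → Prop} {num den best : ℤ} (h : Best I D num den best)
    (hD : ∀ κ z, D' κ z → D κ z) : Best I D' num den best :=
  ⟨h.num_le, h.den_pos, h.den_le, h.attained, fun κ z hd => h.maximal κ z (hD κ z hd)⟩

/-- The new values after the treatment of one entry of the product. -/
theorem Best.update {D : ℕ → ℕ → Prop} {num den best : ℤ} (hB : Best I D num den best)
    {κ z : ℕ} (hz : z < I.size) {v k f : ℤ}
    (hv : v = ∑ i ∈ Finset.range I.maxExp,
        (if 0 < productEntry I κ z + 1 - (I.base : ℤ) ^ (i + 1) then (1 : ℤ) else 0) -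
          2 * pairWeight I.p I.g I.d I.cen 1 0 (-1) 1 z)
    (hk : k = pairSize I z + κ)
    (hf : f = (if 0 < productEntry I κ z then 1 else 0) * ((if 0 < k then 1 else 0) *
      ((if 0 < I.n - k then 1 else 0) * if 0 < v * den - num * (k * (I.n - k)) then 1 else 0))) :
    Best I (fun κ' z' => D κ' z' ∨ (κ' = κ ∧ z' = z)) (num + f * (v - num))
      (den + f * (k * (I.n - k) - den)) (best + f * (z - best)) := by
  -- With `κ` and `z` fixed, all competing third parts give the same cluster sizes, so the largest
  -- fraction is the one with the largest spread.
  have key : ∀ y, thirdSize I y = κ → selSize I z y = k := fun y hy => by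
    rw [hk, selSize, hy]
  rcases productEntry_decode (I := I) κ z with ⟨h0, hno⟩ | ⟨hpos, y, hy, hyκ, hval, hmax⟩
  · have hf0 : f = 0 := by rw [hf, h0]; simp
    rw [hf0]
    simp only [zero_mul, add_zero]
    refine ⟨hB.num_le, hB.den_pos, hB.den_le, hB.attained, ?_⟩
    rintro κ' z' (hd | ⟨rfl, rfl⟩) y hy hyκ
    exacts [hB.maximal κ' z' hd y hy hyκ, absurd hyκ (hno y hy)]
  rw [← hv] at hval
  have hden := hB.den_pos
  by_cases hok : 0 < k ∧ 0 < I.n - k ∧ 0 < v * den - num * (k * (I.n - k))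
  · obtain ⟨hk0, hkn, hlt⟩ := hok
    have hf1 : f = 1 := by rw [hf, if_pos hpos, if_pos hk0, if_pos hkn, if_pos hlt]; rfl
    rw [hf1]
    simp only [one_mul, add_sub_cancel]
    have hw : 0 < k * (I.n - k) := mul_pos hk0 hkn
    refine ⟨?_, hw, ?_, ⟨z, hz, rfl, Or.inr ⟨y, hy.1, ?_, hval.symm, ?_⟩⟩, ?_⟩
    · rw [hval, abs_of_nonneg (spread_nonneg z y)]
      have := spread_le hy
      omega
    · nlinarith
    · exact ⟨by rwa [key y hyκ], by rwa [key y hyκ]⟩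
    · rw [selPairs, key y hyκ]
    · rintro κ' z' (hd | ⟨rfl, rfl⟩) y' hy' hyκ' hp
      · have h1 := hB.maximal κ' z' hd y' hy' hyκ' hp
        have hw' : 0 < selPairs I z' y' := mul_pos hp.1 hp.2
        -- Transitivity of the order of fractions in cross-multiplied form; the positive factor
        -- `den` is cancelled afterwards.
        have h2 : spread I z' y' * (k * (I.n - k)) * den ≤ v * selPairs I z' y' * den := by
          nlinarith [mul_le_mul_of_nonneg_right h1 hw.le]
        exact le_of_mul_le_mul_right h2 hden
      · have h1 := hmax y' hy' hyκ'
        rw [selPairs, key y' hyκ', hval]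
        exact mul_le_mul_of_nonneg_right h1 hw.le
  · have hf0 : f = 0 := by
      rw [hf, if_pos hpos]
      by_cases a : 0 < k
      · by_cases b : 0 < I.n - k
        · rw [if_neg fun c => hok ⟨a, b, c⟩]
          simp
        · rw [if_neg b]
          simp
      · rw [if_neg a]
        simp
    rw [hf0]
    simp only [zero_mul, add_zero]
    refine ⟨hB.num_le, hB.den_pos, hB.den_le, hB.attained, ?_⟩
    rintro κ' z' (hd | ⟨rfl, rfl⟩) y' hy' hyκ' hp
    · exact hB.maximal κ' z' hd y' hy' hyκ' hp
    · have hp' := hp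
      rw [Proper, key y' hyκ'] at hp'
      have h1 := hmax y' hy' hyκ'
      rw [← hval] at h1
      rw [selPairs, key y' hyκ']
      have h2 : v * den - num * (k * (I.n - k)) ≤ 0 := not_lt.1 fun h => hok ⟨hp'.1, hp'.2, h⟩
      nlinarith

theorem pairSize_bounds (z : ℕ) : 0 ≤ pairSize I z ∧ pairSize I z ≤ 2 * I.g := by
  have h : ∀ i j, 0 ≤ bitAt z i * I.unit j ∧ bitAt z i * I.unit j ≤ 1 := fun i j => by
    unfold Inst.unit
    rcases bitAt_eq_zero_or_one z i with h | h <;> split_ifs <;> simp [h]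
  constructor
  · exact Finset.sum_nonneg fun b _ => add_nonneg (h _ _).1 (h _ _).1
  · refine (Finset.sum_le_card_nsmul _ _ 2 fun b _ => ?_).trans (by simp; linarith)
    have h1 := h (hiPos I.p b) (3 * b)
    have h2 := h (loPos I.p b) (3 * b + 1)
    omega

theorem thirdSize_bounds (y : ℕ) : 0 ≤ thirdSize I y ∧ thirdSize I y ≤ I.g := by
  have h : ∀ i j, 0 ≤ bitAt y i * I.unit j ∧ bitAt y i * I.unit j ≤ 1 := fun i j => by
    unfold Inst.unit
    rcases bitAt_eq_zero_or_one y i with h | h <;> split_ifs <;> simp [h]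
  constructor
  · exact Finset.sum_nonneg fun b _ => (h _ _).1
  · exact (Finset.sum_le_card_nsmul _ _ 1 fun b _ => (h _ _).2).trans (by simp)

variable {c h ℓ Y : ℕ}

theorem Best.bits (ok : I.Ok) (B : I.Bounds c h ℓ Y) {D : ℕ → ℕ → Prop} {num den best : ℤ}
    (hB : Best I D num den best) : bits num ≤ ℓ ∧ bits den ≤ ℓ ∧ bits best ≤ ℓ := by
  have hY := B.Y_ge
  have h1 := hB.num_le
  have h2 := hB.den_pos
  have h3 := hB.den_le
  have h4 : ((I.n * I.n : ℕ) : ℤ) + I.maxExp + 1 ≤ Y := by exact_mod_cast (by omega)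
  push_cast at h4
  refine ⟨B.bits_le_of_le_Y ?_, B.bits_le_of_le_Y ?_, ?_⟩
  · have : 0 ≤ (I.n * I.n : ℤ) := by positivity
    linarith
  · rw [abs_of_pos h2]
    omega
  · obtain ⟨z, hz, rfl, -⟩ := hB.attained
    exact (bits_mono (by simpa using hz.le)).trans (B.bits_size ok)

theorem updateStmt_spec (ok : I.Ok) (B : I.Bounds c h ℓ Y) {s : Store} (E : Env I s)
    (hs : Good ℓ Y s) {κ z : ℕ} (hκ : κ ≤ I.g) (hz : z < I.size) (h23 : s.var 23 = κ)
    (h30 : s.var 30 = z) (h11 : s.arr 11 (z : ℤ) = I.Δ ^ I.K * productEntry I κ z)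
    {D : ℕ → ℕ → Prop} (hB : Best I D (s.var 13) (s.var 14) (s.var 15)) :
    Spec ℓ Y (updateStmt I.p) s 8 fun s' =>
      Best I (fun κ' z' => D κ' z' ∨ (κ' = κ ∧ z' = z)) (s'.var 13) (s'.var 14) (s'.var 15) := by
  have hY := B.Y_ge
  have hΔ : I.Δ ^ I.K ≠ 0 := pow_ne_zero _ ok.Δ_ne
  set C := productEntry I κ z with hC
  set e : ℤ := ∑ i ∈ Finset.range I.maxExp,
    (if 0 < C + 1 - (I.base : ℤ) ^ (i + 1) then (1 : ℤ) else 0) with he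
  set k : ℤ := pairSize I z + κ with hk
  set v : ℤ := e - 2 * pairWeight I.p I.g I.d I.cen 1 0 (-1) 1 z with hv
  set f : ℤ := (if 0 < C then 1 else 0) * ((if 0 < k then 1 else 0) *
      ((if 0 < I.n - k then 1 else 0) *
        if 0 < v * s.var 14 - s.var 13 * (k * (I.n - k)) then 1 else 0)) with hf
  -- The new values are described before they are computed, because `Best` also bounds their
  -- lengths.
  have hnew := hB.update hz hv hk hf
  obtain ⟨b13, b14, b15⟩ := hnew.bits ok B
  have he0 : 0 ≤ e ∧ e ≤ I.maxExp := by
    constructor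
    · exact Finset.sum_nonneg fun _ _ => by split_ifs <;> norm_num
    · exact (Finset.sum_le_card_nsmul _ _ 1 fun _ _ => by split_ifs <;> norm_num).trans (by simp)
  have hpw := Inst.two_mul_pairWeight_le (I := I) 0 1 (c₀ := 1) (c₁ := -1) (by norm_num) z
  have hpw0 := pairWeight_nonneg I.p I.g I.d I.cen 1 0 (-1) 1 z
  have hkb := pairSize_bounds (I := I) z
  have hf01 : f = 0 ∨ f = 1 := by
    rw [hf]
    split_ifs <;> simp
  refine Spec.mono (n := 1 + (1 + (1 + (1 + (1 + (1 + (1 + 1))))))) ?_ le_rfl fun _ h => h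
  refine Spec.assign_seq (z := C) ?_ ?_ (by norm_num) ?_
  · simp only [Expr.eval_div, Expr.eval_read, Expr.eval_var, h30, h11, E.scale]
    exact Int.mul_ediv_cancel_left _ hΔ
  -- The quotient divides a stored number, so it is no longer than that number.
  · refine (bits_mono ?_).trans (hs.arr 11 z)
    rw [h11, Int.natAbs_mul]
    exact Nat.le_mul_of_pos_left _ (Int.natAbs_pos.2 hΔ)
  have E₁ : Env I (s.setVar 18 C) := E.setVar (by norm_num) _
  refine Spec.assign_seq (z := e) ?_ (B.bits_le_of_le_Y ?_) (by norm_num) ?_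
  · refine eval_sum_of E₁.maxExp fun i hi => ?_
    have := (E₁.setVar (x := 40) (by norm_num) i).base (i + 1) (by omega)
    rw [Expr.eval_pos]
    simp only [Expr.eval_sub, Expr.eval_add, Expr.eval_var, Expr.eval_one, Expr.eval_read]
    push_cast at this
    simp only [Store.setVar_var, Store.setVar_arr] at this ⊢
    norm_num [this]
  · rw [abs_of_nonneg he0.1]
    omega
  set s₂ := (s.setVar 18 C).setVar 19 e with hs₂
  have E₂ : Env I s₂ := E₁.setVar (by norm_num) _
  refine Spec.assign_seq (z := k) ?_ (B.bits_le_of_le_Y ?_) (by norm_num) ?_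
  · rw [Expr.eval_add, eval_pairSizeE ok E₂ (z := z) (by simp [hs₂, h30]) (by norm_num)]
    simp [hs₂, h23, hk]
  · rw [abs_of_nonneg (by omega)]
    omega
  set s₃ := s₂.setVar 20 k with hs₃
  have E₃ : Env I s₃ := E₂.setVar (by norm_num) _
  refine Spec.assign_seq (z := v) ?_ (B.bits_le_of_le_Y ?_) (by norm_num) ?_
  · rw [Expr.eval_sub, Expr.eval_mul,
      eval_pairWeightE ok E₃ (z := z) (by simp [hs₃, hs₂, h30]) (by norm_num) (by norm_num)]
    simp [hs₃, hs₂, hv]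
  · rw [abs_le]
    constructor <;> omega
  set s₄ := s₃.setVar 21 v with hs₄
  refine Spec.assign_seq (z := f) ?_ (B.bits_le_of_le_Y ?_) (by norm_num) ?_
  · simp only [Expr.eval_mul, Expr.eval_pos, Expr.eval_sub, Expr.eval_var]
    simp [hs₄, hs₃, hs₂, hf, E.n]
  · rcases hf01 with h | h <;> rw [h]
    · simp
    · rw [abs_one]; omega
  set s₅ := s₄.setVar 22 f with hs₅
  have v13 : s₅.var 13 = s.var 13 := by simp [hs₅, hs₄, hs₃, hs₂]
  have v14 : s₅.var 14 = s.var 14 := by simp [hs₅, hs₄, hs₃, hs₂]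
  have v15 : s₅.var 15 = s.var 15 := by simp [hs₅, hs₄, hs₃, hs₂]
  have v20 : s₅.var 20 = k := by simp [hs₅, hs₄, hs₃]
  have v21 : s₅.var 21 = v := by simp [hs₅, hs₄]
  have v22 : s₅.var 22 = f := by simp [hs₅]
  have v30 : s₅.var 30 = z := by simp [hs₅, hs₄, hs₃, hs₂, h30]
  have v0 : s₅.var 0 = I.n := by simp [hs₅, hs₄, hs₃, hs₂, E.n]
  refine Spec.assign_seq (z := s.var 13 + f * (v - s.var 13)) (by simp [v13, v21, v22]) b13
    (by norm_num) ?_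
  refine Spec.assign_seq (z := s.var 14 + f * (k * (I.n - k) - s.var 14))
    (by simp [v14, v20, v22, v0]) b14 (by norm_num) ?_
  refine Spec.assign (z := s.var 15 + f * (z - s.var 15)) (by simp [v15, v22, v30]) b15
    (by norm_num) ?_
  simpa using hnew

theorem productStmt_vars (p : ℕ) : (productStmt p).vars = [30, 30, 17, 31, 17, 30, 17, 30, 17, 31,
    17, 30, 17, 30, 30, 17, 31, 17, 30, 17, 30] := rfl

theorem productStmt_arrs (p : ℕ) : (productStmt p).arrs = [11, 12, 13, 11, 13, 12, 11, 13, 11] := rfl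

theorem updateStmt_vars (p : ℕ) : (updateStmt p).vars = [18, 19, 20, 21, 22, 13, 14, 15] := rfl

theorem updateStmt_arrs (p : ℕ) : (updateStmt p).arrs = [] := rfl

/-- A third part selects between `0` and `g` points, so `κ` takes `g + 1` values and separating the
sizes costs only a polynomial factor. -/
theorem searchStmt_spec (ok : I.Ok) (B : I.Bounds c h ℓ Y) {s : Store} (E : Env I s)
    (hs : Good ℓ Y s) :
    Spec ℓ Y (searchStmt I.p) s (46 * ((I.g + 1) * ((I.K + 1) * I.r ^ I.K))) fun s' =>
      Best I (fun κ z => κ ≤ I.g ∧ z < I.size) (s'.var 13) (s'.var 14) (s'.var 15) := by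
  have hY := B.Y_ge
  have hR1 : 1 ≤ I.r ^ I.K := Nat.one_le_pow _ _ ok.r_pos
  have hsz := ok.size_le
  have hfit := searchStmt_fits I.p
  -- The fraction `-1 / 1` lies below every attainable one, since spreads are nonnegative; the first
  -- proper clustering found replaces it.
  have hinit : Best I (fun κ z => κ < 0 ∧ z < I.size) (-1) 1 0 := by
    refine ⟨?_, by norm_num, ?_, ⟨0, by unfold Inst.size; positivity, rfl, Or.inl ⟨rfl, rfl⟩⟩,
      fun κ z hd => absurd hd.1 (Nat.not_lt_zero κ)⟩
    · simp
    · nlinarith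
  set n₁ := 30 * ((I.K + 1) * I.r ^ I.K) + (1 + I.size * (8 + 1)) with hn₁
  refine Spec.mono (n := 1 + (1 + (1 + (1 + (I.g + 1) * (n₁ + 1))))) ?_ ?_ fun _ h => h
  rotate_left
  · have h1 : I.r ^ I.K ≤ (I.K + 1) * I.r ^ I.K := Nat.le_mul_of_pos_left _ (by omega)
    set X := (I.K + 1) * I.r ^ I.K with hX
    have h2 : n₁ + 1 ≤ 41 * X := by omega
    have h3 : 1 ≤ (I.g + 1) * X := by nlinarith
    calc _ ≤ 4 + (I.g + 1) * (41 * X) := by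
          have := Nat.mul_le_mul_left (I.g + 1) h2; omega
      _ = 4 + 41 * ((I.g + 1) * X) := by ring
      _ ≤ _ := by omega
  refine Spec.assign_seq (z := -1) rfl (B.bits_le_of_le_Y (by simp; omega)) (by norm_num) ?_
  refine Spec.assign_seq (z := 1) rfl (B.bits_le_of_le_Y (by simp; omega)) (by norm_num) ?_
  refine Spec.assign_seq (z := 0) rfl (B.bits_le_of_le_Y (by simp)) (by norm_num) ?_
  set s₀ := ((s.setVar 13 (-1)).setVar 14 1).setVar 15 0 with hs₀
  have E₀ : Env I s₀ :=
    ((E.setVar (by norm_num) _).setVar (by norm_num) _).setVar (by norm_num) _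
  have g₀ : Good ℓ Y s₀ := ((hs.setVar (B.bits_le_of_le_Y (by simp; omega)) (by norm_num)).setVar
    (B.bits_le_of_le_Y (by simp; omega)) (by norm_num)).setVar (B.bits_le_of_le_Y (by simp))
    (by norm_num)
  refine Spec.mono (Spec.loop (N := I.g + 1) (n := n₁) (fun κ s' =>
    Best I (fun κ' z => κ' < κ ∧ z < I.size) (s'.var 13) (s'.var 14) (s'.var 15))
    hfit.2.2.2.2.2.2 (by norm_num) g₀ (by simp [E₀.g]) (B.bits_natCast_le (by omega))
    (fun i s v h => by simpa using h) (by simpa [hs₀] using hinit) fun κ hκ s₁ hs₁ hfr₁ h23 hB => ?_)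
    le_rfl fun s' h => h.mono fun κ z hd => ⟨Nat.lt_succ_of_le hd.1, hd.2⟩
  have E₁ : Env I s₁ := E₀.frame hfr₁
    (by simp [Stmt.vars, productStmt_vars, updateStmt_vars])
    (by simp [Stmt.arrs, productStmt_arrs, updateStmt_arrs])
  refine Spec.seq (productStmt_fits I.p) hs₁ (productStmt_spec ok B E₁ hs₁ h23)
    fun s₂ hs₂ hfr₂ hprod => ?_
  have E₂ : Env I s₂ := E₁.frame hfr₂ (by simp [productStmt_vars])
    (by simp [productStmt_arrs])
  have hB₂ : Best I (fun κ' z => κ' < κ ∧ z < I.size) (s₂.var 13) (s₂.var 14) (s₂.var 15) := by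
    rw [hfr₂.1 13 (by simp [productStmt_vars]), hfr₂.1 14 (by simp [productStmt_vars]),
      hfr₂.1 15 (by simp [productStmt_vars])]
    exact hB
  refine Spec.mono (Spec.loop (N := I.size) (n := 8) (fun z s' =>
    Best I (fun κ' z' => (κ' < κ ∧ z' < I.size) ∨ (κ' = κ ∧ z' < z)) (s'.var 13) (s'.var 14)
      (s'.var 15)) (updateStmt_fits I.p) (by norm_num) hs₂ E₂.size (B.bits_size ok)
    (fun i s v h => by simpa using h) (hB₂.mono fun κ' z hd => by omega)
    fun z hz s₃ hs₃ hfr₃ h30 hB₃ => ?_)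
    le_rfl fun s' h => h.mono fun κ' z hd => by omega
  have E₃ : Env I s₃ := E₂.frame hfr₃ (by simp [updateStmt_vars])
    (by simp [updateStmt_arrs])
  refine (updateStmt_spec ok B E₃ hs₃ (Nat.lt_succ_iff.1 hκ) hz ?_ h30 ?_ hB₃).mono le_rfl
    fun s' h => h.mono fun κ' z' hd => by omega
  · rw [hfr₃.1 23 (by simp [updateStmt_vars]), hfr₂.1 23 (by simp [productStmt_vars]), h23]
  · rw [hfr₃.2 11 (by simp [updateStmt_arrs])]
    exact hprod z hz

end Search

open RAM

section Output

variable {I : Inst} {c h ℓ Y : ℕ}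

/-! ## The search for the third part -/

/-- An entry of the product reveals the value of the best third part, but not the part. With the
first two parts fixed, one scan over all `y` finds a proper choice whose fraction is at least `num /
den`, and by maximality any such choice is optimal. -/
theorem thirdStmt_spec (ok : I.Ok) (B : I.Bounds c h ℓ Y) {s : Store} (E : Env I s)
    (hs : Good ℓ Y s)
    (hB : Best I (fun κ z => κ ≤ I.g ∧ z < I.size) (s.var 13) (s.var 14) (s.var 15)) :
    Spec ℓ Y (thirdStmt I.p) s (2 + I.size * 3) fun s' =>
      ∃ z y : ℕ, s'.var 15 = z ∧ s'.var 16 = y ∧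
        ∀ z' < I.size, ∀ y', Cand I z' y' → Proper I z' y' → Proper I z y ∧
          spread I z' y' * selPairs I z y ≤ spread I z y * selPairs I z' y' := by
  have hY := B.Y_ge
  have hfit := thirdStmt_fits I.p
  obtain ⟨z, hz, h15, hatt⟩ := hB.attained
  set num := s.var 13 with hnum
  set den := s.var 14 with hden
  have hden0 : 0 < den := hB.den_pos
  set Hit : ℕ → Prop := fun y => Proper I z y ∧ num * selPairs I z y ≤ spread I z y * den with hHit
  refine Spec.mono (n := 1 + (1 + I.size * (2 + 1))) (Spec.assign_seq (z := 0) rfl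
    (B.bits_le_of_le_Y (by simp)) (by norm_num) ?_) (by omega) fun _ h => h
  have E₀ : Env I (s.setVar 16 0) := E.setVar (by norm_num) _
  have g₀ : Good ℓ Y (s.setVar 16 0) := hs.setVar (B.bits_le_of_le_Y (by simp)) (by norm_num)
  refine (Spec.frame hfit.2 g₀ (Spec.loop (N := I.size) (n := 2) (fun i s' => ∃ y < I.size,
    s'.var 16 = (y : ℕ) ∧ ((∃ y₀ < i, Hit y₀) → Hit y)) hfit.2.2.2.2 (by norm_num) g₀ E₀.size
    (B.bits_size ok) (fun i s v h => by simpa using h)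
    ⟨0, by unfold Inst.size; positivity, by simp, fun ⟨y₀, h, _⟩ => absurd h (Nat.not_lt_zero _)⟩
    fun i hi s₁ hs₁ hfr₁ h30 ⟨y, hy, h16, hyI⟩ => ?_)).mono le_rfl ?_
  · have E₁ : Env I s₁ := E₀.frame hfr₁ (by simp [Stmt.vars]) (by simp [Stmt.arrs])
    have v15 : s₁.var 15 = z := by rw [hfr₁.1 15 (by simp [Stmt.vars])]; simpa using h15
    have v13 : s₁.var 13 = num := by rw [hfr₁.1 13 (by simp [Stmt.vars])]; simp [hnum]
    have v14 : s₁.var 14 = den := by rw [hfr₁.1 14 (by simp [Stmt.vars])]; simp [hden]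
    have hb1 := pairSize_bounds (I := I) z
    have hb2 := thirdSize_bounds (I := I) i
    refine Spec.mono (n := 1 + 1) (Spec.assign_seq (z := selSize I z i) ?_ (B.bits_le_of_le_Y ?_)
      (by norm_num) ?_) le_rfl fun _ h => h
    · rw [Expr.eval_add, eval_pairSizeE ok E₁ v15 (by norm_num),
        eval_thirdSizeE ok E₁ h30 (by norm_num)]
      rfl
    · rw [selSize, abs_of_nonneg (by omega)]
      omega
    set s₂ := s₁.setVar 20 (selSize I z i) with hs₂
    have E₂ : Env I s₂ := E₁.setVar (by norm_num) _
    set f : ℤ := (if 0 < selSize I z i then 1 else 0) * ((if 0 < I.n - selSize I z i then 1 else 0) *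
      if 0 < spread I z i * den + 1 - num * selPairs I z i then 1 else 0) with hf
    have hf' : f = 1 ∧ Hit i ∨ f = 0 ∧ ¬ Hit i := by
      by_cases h : Hit i
      · refine Or.inl ⟨?_, h⟩
        rw [hf, if_pos h.1.1, if_pos h.1.2, if_pos (by have := h.2; omega)]
        rfl
      · refine Or.inr ⟨?_, h⟩
        rw [hf]
        by_cases a : 0 < selSize I z i
        · by_cases b : 0 < I.n - selSize I z i
          · rw [if_neg (c := 0 < spread I z i * den + 1 - num * selPairs I z i) fun e =>
              h ⟨⟨a, b⟩, by omega⟩]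
            simp
          · rw [if_neg b]; simp
        · rw [if_neg a]; simp
    have hval : ∃ y' < I.size, (y : ℤ) + f * (i - y) = (y' : ℕ) ∧
        ((∃ y₀ < i + 1, Hit y₀) → Hit y') := by
      rcases hf' with ⟨h1, h2⟩ | ⟨h1, h2⟩
      · exact ⟨i, hi, by rw [h1]; ring, fun _ => h2⟩
      · refine ⟨y, hy, by rw [h1]; ring, fun ⟨y₀, hy₀, hh⟩ => hyI ⟨y₀, ?_, hh⟩⟩
        refine lt_of_le_of_ne (Nat.lt_succ_iff.1 hy₀) ?_
        rintro rfl
        exact h2 hh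
    obtain ⟨y', hy', hy'e, hy'I⟩ := hval
    refine Spec.assign (z := (y' : ℤ)) ?_ ((bits_mono (by simpa using hy'.le)).trans
      (B.bits_size ok)) (by norm_num) ⟨y', hy', by simp, hy'I⟩
    have hT := eval_tripleWeightE ok E₂ (x := 15) (x' := 30) (z := z) (y := i)
      (by simp [hs₂, v15]) (by simp [hs₂, h30]) (by norm_num) (by norm_num) (by norm_num)
      (by norm_num)
    have e16 : s₂.var 16 = y := by simp [hs₂, h16]
    have e20 : s₂.var 20 = selSize I z i := by simp [hs₂]
    have e14 : s₂.var 14 = den := by simp [hs₂, v14]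
    have e13 : s₂.var 13 = num := by simp [hs₂, v13]
    have e30 : s₂.var 30 = i := by simp [hs₂, h30]
    rw [← hy'e]
    simp only [Expr.eval_add, Expr.eval_mul, Expr.eval_pos, Expr.eval_sub, Expr.eval_var,
      Expr.eval_two, Expr.eval_one, hT, e16, e20, e14, e13, e30, E₂.n, hf]
    rfl
  · rintro s' ⟨_, hfr, y, hy, h16, hyI⟩
    refine ⟨z, y, ?_, h16, fun z' hz' y' hc' hp' => ?_⟩
    · rw [hfr.1 15 (by simp [Stmt.vars])]
      simpa using h15
    have hmax := hB.maximal (thirdSize I y').toNat z'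
      ⟨by have := (thirdSize_bounds (I := I) y').2; omega, hz'⟩ y' hc'
      (by have := (thirdSize_bounds (I := I) y').1; omega) hp'
    have hw' : 0 < selPairs I z' y' := mul_pos hp'.1 hp'.2
    -- The initial value `-1` cannot have survived once a proper clustering exists, as `hmax` would
    -- make a nonnegative spread negative. So `num / den` is attained by some `y₀`, and the scan
    -- meets a hit.
    have hhit : Hit y := by
      refine hyI ?_
      rcases hatt with ⟨h1, h2⟩ | ⟨y₀, hy₀, hp, h1, h2⟩
      · rw [h1, h2] at hmax
        have := spread_nonneg (I := I) z' y'
        omega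
      · exact ⟨y₀, hy₀, hp, by rw [h1, h2]⟩
    refine ⟨hhit.1, ?_⟩
    have hw : 0 < selPairs I z y := mul_pos hhit.1.1 hhit.1.2
    have h2 : spread I z' y' * selPairs I z y * den ≤ spread I z y * selPairs I z' y' * den := by
      nlinarith [mul_le_mul_of_nonneg_right hmax hw.le, mul_le_mul_of_nonneg_right hhit.2 hw'.le]
    exact le_of_mul_le_mul_right h2 hden0

/-! ## The output -/

/-- The number of points with label `1`. -/
def labelCount (I : Inst) (z y : ℕ) : ℤ := ∑ i ∈ Finset.range I.n, labelOf I.p z y i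

theorem labelCount_bounds (z y : ℕ) : 0 ≤ labelCount I z y ∧ labelCount I z y ≤ I.n := by
  constructor
  · refine Finset.sum_nonneg fun i _ => ?_
    rcases labelOf_eq_zero_or_one I.p z y i with h | h <;> rw [h]
    norm_num
  · refine (Finset.sum_le_card_nsmul _ _ 1 fun i _ => ?_).trans (by simp)
    rcases labelOf_eq_zero_or_one I.p z y i with h | h <;> rw [h]
    norm_num

theorem eval_label (ok : I.Ok) {s : Store} (E : Env I s) {z y i : ℕ} (hz : s.var 15 = z)
    (hy : s.var 16 = y) (hi : i < 3 * I.g) (h30 : s.var 30 = i) :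
    Expr.eval (((Expr.var 30).rem 3).isZero * bitE 15 (hiPosE I.p (.var 30 / 3)) +
      ((Expr.var 30).rem 3 - 1).isZero * bitE 15 (loPosE I.p (.var 30 / 3)) +
      ((Expr.var 30).rem 3 - 2).isZero * bitE 16 (hiPosE I.p (.var 30 / 3))) s =
        labelOf I.p z y i := by
  have hb : Expr.eval (.var 30 / 3) s = (i / 3 : ℕ) := by simp [h30]
  have hbg : i / 3 < I.g := by omega
  simp only [Expr.eval_add, Expr.eval_mul, Expr.eval_isZero, Expr.eval_sub, Expr.eval_rem,
    Expr.eval_var, Expr.eval_one, Expr.eval_two, Expr.eval_three, h30]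
  rw [eval_bitE_hiPosE ok E hz hb hbg, eval_bitE_loPosE ok E hz hb hbg,
    eval_bitE_hiPosE ok E hy hb hbg, labelOf]
  have h3 : i % 3 = 0 ∨ i % 3 = 1 ∨ i % 3 = 2 := by omega
  rcases h3 with h | h | h
  · rw [if_pos (by omega), if_neg (by omega), if_neg (by omega), if_pos h]; ring
  · rw [if_neg (by omega), if_pos (by omega), if_neg (by omega), if_neg (by omega), if_pos h]; ring
  · rw [if_neg (by omega), if_neg (by omega), if_pos (by omega), if_neg (by omega),
      if_neg (by omega)]
    ring

theorem abs_sum_mul_le (B : I.Bounds c h ℓ Y) {w : ℕ → ℤ} (hw : ∀ i, |w i| ≤ 1) {l : ℕ}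
    (hl : l < I.d) : |∑ i ∈ Finset.range I.n, w i * I.x i l| ≤ Y := by
  have hY := B.Y_ge
  have : |∑ i ∈ Finset.range I.n, w i * I.x i l| ≤ (I.n * I.M : ℕ) := by
    refine (Finset.abs_sum_le_sum_abs _ _).trans ((Finset.sum_le_card_nsmul _ _ (I.M : ℤ)
      fun i hi => ?_).trans (by simp))
    rw [abs_mul]
    have := B.x_le i (Finset.mem_range.1 hi) l hl
    nlinarith [hw i, abs_nonneg (w i), abs_nonneg (I.x i l)]
  refine this.trans ?_
  exact_mod_cast (by omega)

/-- Labels are written up to `3 * g`, of which only the first `n` matter. An empty cluster gets the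
denominator `1`, so that its center is a well-defined rational point. -/
theorem outputStmt_spec (ok : I.Ok) (B : I.Bounds c h ℓ Y) {s : Store} (E : Env I s)
    (hs : Good ℓ Y s) {z y : ℕ} (hz : s.var 15 = z) (hy : s.var 16 = y) :
    Spec ℓ Y (outputStmt I.p) s (6 + I.g * 6 + I.d * 4) fun s' =>
      (∀ i < I.n, s'.arr 1 (i : ℤ) = labelOf I.p z y i) ∧
      s'.arr 2 0 = I.n - labelCount I z y + (if I.n - labelCount I z y = 0 then 1 else 0) ∧
      s'.arr 2 1 = labelCount I z y + (if labelCount I z y = 0 then 1 else 0) ∧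
      (∀ l < I.d, s'.arr 3 (l : ℤ) =
        ∑ i ∈ Finset.range I.n, (1 - labelOf I.p z y i) * I.x i l) ∧
      ∀ l < I.d, s'.arr 3 ((l + I.d : ℕ) : ℤ) =
        ∑ i ∈ Finset.range I.n, labelOf I.p z y i * I.x i l := by
  have hY := B.Y_ge
  have hn := ok.n_le
  have hfit := outputStmt_fits I.p
  have hk := labelCount_bounds (I := I) z y
  set k := labelCount I z y with hkdef
  have hl01 : ∀ i, |labelOf I.p z y i| ≤ 1 := fun i => by
    rcases labelOf_eq_zero_or_one I.p z y i with h | h <;> rw [h] <;> norm_num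
  have hl01' : ∀ i, |1 - labelOf I.p z y i| ≤ 1 := fun i => by
    rcases labelOf_eq_zero_or_one I.p z y i with h | h <;> rw [h] <;> norm_num
  refine Spec.mono (n := (1 + 3 * I.g * 2) + (1 + (1 + (1 + ((1 + I.d * 2) + (1 + I.d * 2))))))
    (Spec.seq hfit.1 hs (Spec.fill (N := 3 * I.g) (off := 0) (f := labelOf I.p z y)
      hfit.1.2.2.2 (by norm_num) hs (by simp [E.g]) (B.bits_natCast_le (by omega))
      (fun i _ => B.bits_le_of_le_Y ((hl01 i).trans (by omega))) ?_) ?_) (by omega) fun _ h => h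
  · intro i hi s₁ hfr h30 _ _
    have E₁ : Env I s₁ := E.frame hfr (by decide) (by decide)
    exact ⟨by simp [h30], eval_label ok E₁ (by rw [hfr.1 15 (by decide), hz])
      (by rw [hfr.1 16 (by decide), hy]) hi h30⟩
  intro s₁ hs₁ hfr₁ ⟨hlab, _⟩
  have E₁ : Env I s₁ := E.frame hfr₁ (by simp [Stmt.vars]) (by simp [Stmt.arrs])
  have hlab₁ : ∀ i < I.n, s₁.arr 1 (i : ℤ) = labelOf I.p z y i := fun i hi => hlab i (by omega)
  have hkY : |k| ≤ Y := by rw [abs_of_nonneg hk.1]; omega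
  refine Spec.assign_seq (z := k) (eval_sum_of E₁.n fun i hi => by simpa using hlab₁ i hi)
    (B.bits_le_of_le_Y hkY) (by norm_num) ?_
  have E₂ : Env I (s₁.setVar 18 k) := E₁.setVar (by norm_num) _
  have hs₂ : Good ℓ Y (s₁.setVar 18 k) := hs₁.setVar (B.bits_le_of_le_Y hkY) (by norm_num)
  have hb0 : bits (I.n - k + (if I.n - k = 0 then 1 else 0)) ≤ ℓ := B.bits_le_of_le_Y (by
    rw [abs_le]; split_ifs <;> omega)
  have hb1 : bits (k + (if k = 0 then 1 else 0)) ≤ ℓ := B.bits_le_of_le_Y (by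
    rw [abs_le]; split_ifs <;> omega)
  refine Spec.write_seq (j := 0) (z := I.n - k + (if I.n - k = 0 then 1 else 0)) rfl
    (by simp [Expr.eval_isZero, E₁.n]) hb0 ?_
  have hs₃ := hs₂.setArr (a := 2) (i := 0) hb0
  set s₃ := (s₁.setVar 18 k).setArr 2 0 (I.n - k + (if I.n - k = 0 then 1 else 0)) with hs₃def
  refine Spec.write_seq (j := 1) (z := k + (if k = 0 then 1 else 0)) rfl
    (by simp [Expr.eval_isZero, hs₃def]) hb1 ?_
  have hs₄ := hs₃.setArr (a := 2) (i := 1) hb1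
  set s₄ := s₃.setArr 2 1 (k + (if k = 0 then 1 else 0)) with hs₄def
  have fr₄ : Frame [] [2] (s₁.setVar 18 k) s₄ := by
    refine ⟨fun _ _ => rfl, fun a ha => ?_⟩
    funext j
    have ha' : a ≠ 2 := by simpa using ha
    simp [hs₄def, hs₃def, Store.setArr_arr, ha']
  have E₄ : Env I s₄ := E₂.frame fr₄ (by simp) (by decide)
  have hlab₄ : ∀ i < I.n, s₄.arr 1 (i : ℤ) = labelOf I.p z y i := fun i hi => by
    rw [fr₄.2 1 (by decide)]; exact hlab₁ i hi
  have h20 : s₄.arr 2 0 = I.n - k + (if I.n - k = 0 then 1 else 0) := by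
    simp [hs₄def, hs₃def, Store.setArr_arr]
  have h21 : s₄.arr 2 1 = k + (if k = 0 then 1 else 0) := by
    simp [hs₄def, Store.setArr_arr]
  have hdb : bits (I.d : ℤ) ≤ ℓ := B.bits_natCast_le (by omega)
  refine Spec.seq hfit.2.2.2.2.1 hs₄ (Spec.fill (N := I.d) (off := 0)
    (f := fun l => ∑ i ∈ Finset.range I.n, (1 - labelOf I.p z y i) * I.x i l) hfit.2.2.2.2.1.2.2.2
    (by norm_num) hs₄ E₄.d hdb (fun l hl => B.bits_le_of_le_Y (abs_sum_mul_le B hl01' hl)) ?_) ?_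
  · intro l hl s₅ hfr h30 _ _
    have E₅ : Env I s₅ := E₄.frame hfr (by decide) (by decide)
    refine ⟨by simp [h30], eval_sum_of E₅.n fun i hi => ?_⟩
    have e1 := hlab₄ i hi
    rw [← hfr.2 1 (by decide)] at e1
    have e2 := E₅.x i hi l hl
    push_cast at e2
    simp [h30, E₅.d, e1, e2]
  intro s₅ hs₅ hfr₅ ⟨hA, _⟩
  have E₅ : Env I s₅ := E₄.frame hfr₅ (by simp [Stmt.vars]) (by simp [Stmt.arrs])
  have hlab₅ : ∀ i < I.n, s₅.arr 1 (i : ℤ) = labelOf I.p z y i := fun i hi => by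
    rw [hfr₅.2 1 (by simp [Stmt.arrs])]; exact hlab₄ i hi
  refine (Spec.frame hfit.2.2.2.2.2 hs₅ (Spec.fill (N := I.d) (off := I.d)
    (f := fun l => ∑ i ∈ Finset.range I.n, labelOf I.p z y i * I.x i l) hfit.2.2.2.2.2.2.2.2
    (by norm_num) hs₅ E₅.d hdb (fun l hl => B.bits_le_of_le_Y (abs_sum_mul_le B hl01 hl))
    ?_)).mono le_rfl ?_
  · intro l hl s₆ hfr h30 _ _
    have E₆ : Env I s₆ := E₅.frame hfr (by decide) (by decide)
    refine ⟨by simp [h30, E₆.d], eval_sum_of E₆.n fun i hi => ?_⟩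
    have e1 := hlab₅ i hi
    rw [← hfr.2 1 (by decide)] at e1
    have e2 := E₆.x i hi l hl
    push_cast at e2
    simp [h30, E₆.d, e1, e2]
  · rintro s₆ ⟨_, hfr₆, hB, hrest⟩
    refine ⟨fun i hi => ?_, ?_, ?_, fun l hl => ?_, hB⟩
    · rw [hfr₆.2 1 (by simp [Stmt.arrs])]; exact hlab₅ i hi
    · rw [hfr₆.2 2 (by simp [Stmt.arrs]), hfr₅.2 2 (by simp [Stmt.arrs]), h20]
    · rw [hfr₆.2 2 (by simp [Stmt.arrs]), hfr₅.2 2 (by simp [Stmt.arrs]), h21]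
    · rw [hrest l fun k' _ h => by push_cast at h; omega]
      exact hA l hl

end Output

open RAM

section Setup

variable {I : Inst} {c h ℓ Y : ℕ}

/-! ## The preparation of the tables -/

theorem table_spec {s : Store} (hs : Good ℓ Y s) (a : ℕ) {T : ℕ → ℕ → ℤ} {N m : ℕ} (hm : 0 < m)
    (hT : ∀ l < N, ∀ x < m, bits (T l x) ≤ ℓ) :
    Spec ℓ Y (tableStmt a (fun i => T (i / m) (i % m)) (N * m)) s (N * m + 1) fun s' =>
      ∀ l < N, ∀ x < m, s'.arr a ((l * m + x : ℕ) : ℤ) = T l x := by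
  refine (Spec.table hs (N * m) fun k hk => ?_).mono le_rfl fun s' h l hl x hx => ?_
  · exact hT _ (Nat.div_lt_of_lt_mul (by rwa [mul_comm])) _ (Nat.mod_lt _ hm)
  · rw [h _ (by nlinarith), mul_comm, Nat.mul_add_div hm, Nat.mul_add_mod,
      Nat.div_eq_of_lt hx, Nat.mod_eq_of_lt hx, add_zero]

/-- The value of `K` is `n / (3 p)` rounded up, which makes the three parts of `p * K` points large
enough. The table of powers of two runs to `4 * g + 1`, so it also contains `size` and `base`. -/
theorem paramStmt_spec (ok : I.Ok) (B : I.Bounds c h ℓ Y) (hK : I.K = (I.n + (3 * I.p - 1)) / (3 * I.p))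
    {s : Store} (hs : Good ℓ Y s) (hn : s.var 0 = I.n) :
    Spec ℓ Y (paramStmt I.p I.Q I.r) s (10 + I.g * 8) fun s' =>
      (s'.var 2 = I.Q ∧ s'.var 3 = I.r ∧ s'.var 4 = I.g ∧ s'.var 8 = I.K) ∧
      s'.var 9 = I.size ∧ s'.var 10 = I.base ∧
      ∀ i ≤ 4 * I.g + 1, s'.arr 4 (i : ℤ) = 2 ^ i := by
  have hY := B.Y_ge
  have hℓ := B.ℓ_ge
  have hfit := paramStmt_fits I.p I.Q I.r
  have b2 : ∀ i ≤ 4 * I.g + 1, bits ((2 : ℤ) ^ i) ≤ ℓ := fun i hi =>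
    bits_le_of_le_pow (k := i) (by rw [abs_of_nonneg (by positivity)]) (by omega)
  refine Spec.mono (n := 1 + (1 + (1 + (1 + (1 + ((1 + (4 * I.g + 1) * 2) + (1 + 1)))))))
    (Spec.assign_seq (z := I.Q) rfl (B.bits_natCast_le (by omega)) (fun _ => by omega) ?_)
    (by omega) fun _ h => h
  have g₁ : Good ℓ Y (s.setVar 2 I.Q) := hs.setVar (B.bits_natCast_le (by omega)) (by omega)
  refine Spec.assign_seq (z := I.r) rfl (B.bits_natCast_le (by omega)) (fun _ => by omega) ?_
  have g₂ := g₁.setVar (x := 3) (z := I.r) (B.bits_natCast_le (by omega)) (by omega)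
  refine Spec.assign_seq (z := I.K) ?_ (B.bits_natCast_le (by omega)) (fun _ => by omega) ?_
  · simp [hn, hK]
  have g₃ := g₂.setVar (x := 8) (z := I.K) (B.bits_natCast_le (by omega)) (by omega)
  refine Spec.assign_seq (z := I.g) (by simp [Inst.g]) (B.bits_natCast_le (by omega))
    (fun _ => by omega) ?_
  have g₄ := g₃.setVar (x := 4) (z := I.g) (B.bits_natCast_le (by omega)) (by omega)
  refine Spec.write_seq (j := 0) (z := 1) rfl rfl (b2 0 (by omega)) ?_
  have g₅ := g₄.setArr (a := 4) (i := 0) (b2 0 (by omega))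
  rw [pow_zero] at g₅
  set s₅ := ((((s.setVar 2 I.Q).setVar 3 I.r).setVar 8 I.K).setVar 4 I.g).setArr 4 0 1 with hs₅
  have e40 : s₅.arr 4 0 = 1 := by simp [hs₅, Store.setArr_arr]
  refine Spec.seq hfit.2.2.2.2.2.1 g₅ (Spec.fill (N := 4 * I.g + 1) (off := 1)
    (f := fun k => 2 ^ (k + 1)) hfit.2.2.2.2.2.1.2.2.2 (by norm_num) g₅ (by simp [hs₅])
    (B.bits_natCast_le (by omega)) (fun k hk => b2 _ (by omega)) ?_) ?_
  · intro k hk s' _ h30 hp hr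
    refine ⟨by simp [h30], ?_⟩
    simp only [Expr.eval_mul, Expr.eval_two, Expr.eval_read, Expr.eval_var, h30]
    rcases k with _ | k
    · rw [Nat.cast_zero, hr 0 (by simp), e40]; rfl
    · rw [hp k (Nat.lt_succ_self k)]; ring
  intro s₆ g₆ hfr ⟨hp, hr⟩
  have two : ∀ i ≤ 4 * I.g + 1, s₆.arr 4 (i : ℤ) = 2 ^ i := by
    intro i hi
    rcases i with _ | i
    · rw [Nat.cast_zero, hr 0 fun k _ h => by push_cast at h; omega, e40]; rfl
    · exact hp i (by omega)
  have hv : ∀ x, x ≠ 30 → s₆.var x = s₅.var x := fun x hx => hfr.1 x (by simpa [Stmt.vars] using hx)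
  refine Spec.assign_seq (z := I.size) ?_ (B.bits_size ok) (fun h => by omega) ?_
  · have := two (2 * I.g) (by omega)
    push_cast at this
    simp [hv 4 (by norm_num), hs₅, this, Inst.size]
  refine Spec.assign (z := I.base) ?_ (by simpa [Inst.base] using b2 _ le_rfl) (fun h => by omega) ?_
  · have := two (4 * I.g + 1) le_rfl
    push_cast at this
    simp [hv 4 (by norm_num), hs₅, this, Inst.base]
  · simp [hv 2 (by norm_num), hv 3 (by norm_num), hv 4 (by norm_num), hv 8 (by norm_num), hs₅]
    exact two

theorem abs_scale_le (B : I.Bounds c h ℓ Y) {k : ℕ} (hk : k ≤ I.K) : |I.Δ ^ k| ≤ 2 ^ (h * I.K) := by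
  rw [abs_pow]
  calc |I.Δ| ^ k ≤ (2 ^ h) ^ k := by gcongr; exact B.Δ_le
    _ ≤ 2 ^ (h * I.K) := by
      rw [← pow_mul]
      exact pow_le_pow_right₀ (by norm_num) (Nat.mul_le_mul_left h hk)

theorem Spec.power {s : Store} (hs : Good ℓ Y s) {x : ℕ} {u : Expr} {b : ℤ} {K : ℕ}
    (hfit : (Stmt.loop 30 (.var 8) (.assign x (.var x * u))).Fits) (hx : 8 ≤ x) (hx30 : x ≠ 30)
    (hu : ∀ s', Frame [30, x] [] s s' → u.eval s' = b) (hK : s.var 8 = K) (hKb : bits (K : ℤ) ≤ ℓ)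
    (hb : ∀ k ≤ K, bits (b ^ k) ≤ ℓ) (h1 : s.var x = 1) :
    Spec ℓ Y (.loop 30 (.var 8) (.assign x (.var x * u))) s (1 + K * 2) fun s' =>
      s'.var x = b ^ K := by
  refine Spec.loop (n := 1) (fun i s' => s'.var x = b ^ i) hfit.2.2.2 (by norm_num) hs hK hKb
    (fun i s v h => by simpa [hx30] using h) (by simpa using h1) fun i hi s' _ hfr _ hv => ?_
  refine Spec.assign (z := b ^ (i + 1)) ?_ (hb _ hi) (fun h => by omega) (by simp)
  rw [Expr.eval_mul, hu s' hfr, Expr.eval_var, hv, pow_succ]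

theorem powerStmt_spec (ok : I.Ok) (B : I.Bounds c h ℓ Y) {s : Store} (hs : Good ℓ Y s)
    (hr : s.var 3 = I.r) (hK : s.var 8 = I.K) :
    Spec ℓ Y (powerStmt I.Δ) s (4 + I.K * 4) fun s' =>
      s'.var 11 = (I.r ^ I.K : ℕ) ∧ s'.var 12 = I.Δ ^ I.K := by
  have hY := B.Y_ge
  have hℓ := B.ℓ_ge
  have hfit := powerStmt_fits I.Δ
  have h1 : bits 1 ≤ ℓ := B.bits_le_of_le_Y (by simp; omega)
  have hKb : bits (I.K : ℤ) ≤ ℓ := B.bits_natCast_le (by omega)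
  refine Spec.mono (n := 1 + ((1 + I.K * 2) + (1 + (1 + I.K * 2))))
    (Spec.assign_seq (z := 1) rfl h1 (by norm_num) ?_) (by omega) fun _ h => h
  have g₁ : Good ℓ Y (s.setVar 11 1) := hs.setVar h1 (by norm_num)
  refine Spec.seq hfit.2.1 g₁ (Spec.power (b := I.r) (K := I.K) g₁ hfit.2.1 (by norm_num)
    (by norm_num) (fun s' hfr => ?_) (by simpa using hK) hKb (fun k hk => ?_) (by simp)) ?_
  · rw [Expr.eval_var, hfr.1 3 (by simp)]
    simpa using hr
  · refine (bits_mono ?_).trans B.bits_pow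
    exact_mod_cast Nat.pow_le_pow_right ok.r_pos hk
  intro s₁ g₂ hfr₁ h11
  refine Spec.assign_seq (z := 1) rfl h1 (by norm_num) ?_
  have g₃ : Good ℓ Y (s₁.setVar 12 1) := g₂.setVar h1 (by norm_num)
  refine (Spec.frame hfit.2.2.2 g₃ (Spec.power (b := I.Δ) (K := I.K) g₃ hfit.2.2.2 (by norm_num)
    (by norm_num) (fun s' hfr => rfl) ?_ hKb (fun k hk => ?_) (by simp))).mono le_rfl ?_
  · simp [hfr₁.1 8 (by simp [Stmt.vars]), hK]
  · exact bits_le_of_le_pow (abs_scale_le B hk) (by omega)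
  · rintro s' ⟨_, hfr, h12⟩
    refine ⟨?_, h12⟩
    rw [hfr.1 11 (by simp [Stmt.vars])]
    simpa using h11

/-- Scaling by `n` makes the centered points integral. The zero padding of the points and of the
indicator is not written: cells beyond the input keep their initial value, which is why `h5` and
`h6` are required. -/
theorem centerStmt_spec (B : I.Bounds c h ℓ Y) {s : Store} (hs : Good ℓ Y s)
    (hn : s.var 0 = I.n) (hd : s.var 1 = I.d) (hb : s.var 10 = I.base)
    (hx : ∀ i < I.n, ∀ j < I.d, s.arr 0 ((i * I.d + j : ℕ) : ℤ) = I.x i j)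
    (h5 : ∀ k, s.arr 5 k = 0) (h6 : ∀ k, s.arr 6 k = 0) :
    Spec ℓ Y centerStmt s (5 + I.n * 2 + I.n * I.d * 2 + I.maxExp * 2) fun s' =>
      s'.var 5 = I.maxExp ∧
      (∀ i, ∀ j < I.d, s'.arr 5 ((i * I.d + j : ℕ) : ℤ) = I.cen i j) ∧
      (∀ i : ℕ, s'.arr 6 (i : ℤ) = I.unit i) ∧
      ∀ i ≤ I.maxExp, s'.arr 7 (i : ℤ) = (I.base : ℤ) ^ i := by
  have hY := B.Y_ge
  have hℓ := B.ℓ_ge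
  have hfit := centerStmt_fits
  have h1 : bits 1 ≤ ℓ := B.bits_le_of_le_Y (by simp; omega)
  have bb : ∀ k ≤ I.maxExp, bits ((I.base : ℤ) ^ k) ≤ ℓ := fun k hk =>
    bits_le_of_le_pow (k := (4 * I.g + 1) * I.maxExp)
      (by rw [abs_of_nonneg (by positivity)]; exact base_pow_le hk) (by omega)
  refine Spec.mono (n := (1 + I.n * 2) + ((1 + I.n * I.d * 2) + (1 + (1 + (1 + I.maxExp * 2)))))
    (Spec.seq hfit.1 hs (Spec.fill (N := I.n) (off := 0) (f := fun _ => 1)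
      hfit.1.2.2.2 (by norm_num) hs hn (B.bits_natCast_le (by omega)) (fun _ _ => h1)
      fun i _ s' _ h30 _ _ => ⟨by simp [h30], rfl⟩) ?_) (by omega) fun _ h => h
  intro s₁ g₁ hfr₁ ⟨hu, hu'⟩
  have hunit : ∀ i : ℕ, s₁.arr 6 (i : ℤ) = I.unit i := by
    intro i
    rw [Inst.unit]
    split_ifs with h
    · exact hu i h
    · rw [hu' i fun k hk e => by push_cast at e; omega, h6]
  refine Spec.seq hfit.2.1 g₁ (Spec.fill (N := I.n * I.d) (off := 0)
    (f := fun k => I.cen (k / I.d) (k % I.d)) hfit.2.1.2.2.2 (by norm_num) g₁ ?_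
    (B.bits_natCast_le (by omega)) (fun k hk => B.bits_le_of_le_Y ?_) ?_) ?_
  · simp [hfr₁.1 0 (by simp [Stmt.vars]), hfr₁.1 1 (by simp [Stmt.vars]), hn, hd]
  · have hd0 : 0 < I.d := Nat.pos_of_ne_zero fun h => by simp [h] at hk
    exact (Inst.abs_cen_le (Nat.mod_lt _ hd0)).trans (by exact_mod_cast (by omega))
  · intro k hk s' hfr h30 _ _
    have hd0 : 0 < I.d := Nat.pos_of_ne_zero fun h => by simp [h] at hk
    have hj := Nat.mod_lt k hd0
    have hi : k / I.d < I.n := Nat.div_lt_of_lt_mul (by rwa [mul_comm])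
    have e0 : s'.var 0 = I.n := by
      rw [hfr.1 0 (by simp), hfr₁.1 0 (by simp [Stmt.vars]), hn]
    have e1 : s'.var 1 = I.d := by
      rw [hfr.1 1 (by simp), hfr₁.1 1 (by simp [Stmt.vars]), hd]
    have ex : ∀ i < I.n, ∀ j < I.d, s'.arr 0 ((i * I.d + j : ℕ) : ℤ) = I.x i j := by
      rw [hfr.2 0 (by simp), hfr₁.2 0 (by simp [Stmt.arrs])]
      exact hx
    refine ⟨by simp [h30], ?_⟩
    have eS : Expr.eval (.sum 40 0 (.read 0 (.var 40 * .var 1 + (Expr.var 30).rem (.var 1)))) s' =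
        ∑ i' ∈ Finset.range I.n, I.x i' (k % I.d) := by
      refine eval_sum_of e0 fun i' hi' => ?_
      have := ex i' hi' _ hj
      push_cast at this
      simp [Expr.eval_rem, h30, e1, this]
    have ek : s'.arr 0 (k : ℤ) = I.x (k / I.d) (k % I.d) := by
      rw [← ex _ hi _ hj, mul_comm, Nat.div_add_mod]
    rw [Expr.eval_sub, eS, Inst.cen, if_pos hi]
    simp [h30, e0, ek]
  intro s₂ g₂ hfr₂ ⟨hc, hc'⟩
  have hcen : ∀ i, ∀ j < I.d, s₂.arr 5 ((i * I.d + j : ℕ) : ℤ) = I.cen i j := by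
    intro i j hj
    by_cases hi : i < I.n
    · have := hc (i * I.d + j) (by nlinarith)
      rw [add_zero] at this
      rw [this, mul_comm, Nat.mul_add_div (by omega), Nat.mul_add_mod, Nat.div_eq_of_lt hj,
        Nat.mod_eq_of_lt hj, add_zero]
    · rw [Inst.cen_eq_zero (not_lt.1 hi), hc' _ fun k hk e => ?_,
        hfr₁.2 5 (by simp [Stmt.arrs]), h5]
      have e' : i * I.d + j = k := by exact_mod_cast e
      nlinarith [Nat.mul_le_mul_right I.d (not_lt.1 hi)]
  have v0 : s₂.var 0 = I.n := by
    rw [hfr₂.1 0 (by simp [Stmt.vars]), hfr₁.1 0 (by simp [Stmt.vars]), hn]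
  have v1 : s₂.var 1 = I.d := by
    rw [hfr₂.1 1 (by simp [Stmt.vars]), hfr₁.1 1 (by simp [Stmt.vars]), hd]
  have v10 : s₂.var 10 = I.base := by
    rw [hfr₂.1 10 (by simp [Stmt.vars]), hfr₁.1 10 (by simp [Stmt.vars]), hb]
  have eH : ∀ j < I.d, Expr.eval (.sum 40 0 (pointE (.var 40) * pointE (.var 40)))
      (s₂.setVar 41 j) = ∑ i ∈ Finset.range I.n, I.cen i j * I.cen i j := by
    intro j hj
    refine eval_sum_of (by simpa using v0) fun i _ => ?_
    have := hcen i j hj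
    push_cast at this
    simp [pointE, v1, this]
  refine Spec.assign_seq (z := I.maxExp) ?_ (B.bits_natCast_le (by omega)) (fun _ => by omega) ?_
  · rw [Inst.maxExp_cast, Expr.eval_mul, eval_sum_of v1 fun j hj => by
      rw [Expr.eval_mul, eH j hj]]
    rfl
  have g₃ : Good ℓ Y (s₂.setVar 5 I.maxExp) :=
    g₂.setVar (B.bits_natCast_le (by omega)) (fun _ => by omega)
  refine Spec.write_seq (j := 0) (z := 1) rfl rfl h1 ?_
  have g₄ := g₃.setArr (a := 7) (i := 0) h1
  set s₄ := (s₂.setVar 5 I.maxExp).setArr 7 0 1 with hs₄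
  have e70 : s₄.arr 7 0 = 1 := by simp [hs₄, Store.setArr_arr]
  refine (Spec.frame hfit.2.2.2.2 g₄ (Spec.fill (N := I.maxExp) (off := 1)
    (f := fun k => (I.base : ℤ) ^ (k + 1)) hfit.2.2.2.2.2.2.2 (by norm_num) g₄ (by simp [hs₄])
    (B.bits_natCast_le (by omega)) (fun k hk => bb _ hk) ?_)).mono le_rfl ?_
  · intro k hk s' hfr h30 hp hr
    have e10 : s'.var 10 = I.base := by
      rw [hfr.1 10 (by simp)]
      simpa [hs₄] using v10
    refine ⟨by simp [h30], ?_⟩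
    simp only [Expr.eval_mul, Expr.eval_read, Expr.eval_var, h30, e10]
    rcases k with _ | k
    · rw [Nat.cast_zero, hr 0 (by simp), e70]; ring
    · rw [hp k (Nat.lt_succ_self k)]; ring
  · rintro s' ⟨_, hfr, hp, hr⟩
    refine ⟨?_, ?_, ?_, ?_⟩
    · rw [hfr.1 5 (by simp [Stmt.vars])]
      simp [hs₄]
    · rw [hfr.2 5 (by simp [Stmt.arrs])]
      simpa [hs₄, Store.setArr_arr] using hcen
    · rw [hfr.2 6 (by simp [Stmt.arrs])]
      have e6 : s₄.arr 6 = s₂.arr 6 := by funext j; simp [hs₄, Store.setArr_arr]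
      rw [e6, hfr₂.2 6 (by simp [Stmt.arrs])]
      exact hunit
    · intro i hi
      rcases i with _ | i
      · rw [Nat.cast_zero, hr 0 fun k _ h => by push_cast at h; omega, e70, pow_zero]
      · exact hp i (by omega)

/-! ## The whole program -/

/-- The memory at the beginning. -/
structure Start (I : Inst) (s : Store) : Prop where
  n : s.var 0 = I.n
  d : s.var 1 = I.d
  x : ∀ i < I.n, ∀ j < I.d, s.arr 0 ((i * I.d + j : ℕ) : ℤ) = I.x i j
  zero : ∀ a, a ≠ 0 → ∀ k, s.arr a k = 0

/-- Apart from the search, every phase is polynomial or linear in `size ≤ r ^ K`; the search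
contributes `(g + 1) * (K + 1) * r ^ K` up to a constant. -/
theorem mainStmt_spec (ok : I.Ok) (B : I.Bounds c h ℓ Y)
    (hK : I.K = (I.n + (3 * I.p - 1)) / (3 * I.p)) {s : Store} (hs : Good ℓ Y s) (S : Start I s) :
    Spec ℓ Y (mainStmt I.p I.r I.F I.G I.W I.Δ) s (200 * (Y + 1) ^ 2 * I.r ^ I.K) fun s' =>
      ∃ z y : ℕ, (∀ z' < I.size, ∀ y', Cand I z' y' → Proper I z' y' → Proper I z y ∧
          spread I z' y' * selPairs I z y ≤ spread I z y * selPairs I z' y') ∧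
      (∀ i < I.n, s'.arr 1 (i : ℤ) = labelOf I.p z y i) ∧
      s'.arr 2 0 = I.n - labelCount I z y + (if I.n - labelCount I z y = 0 then 1 else 0) ∧
      s'.arr 2 1 = labelCount I z y + (if labelCount I z y = 0 then 1 else 0) ∧
      (∀ l < I.d, s'.arr 3 (l : ℤ) =
        ∑ i ∈ Finset.range I.n, (1 - labelOf I.p z y i) * I.x i l) ∧
      ∀ l < I.d, s'.arr 3 ((l + I.d : ℕ) : ℤ) =
        ∑ i ∈ Finset.range I.n, labelOf I.p z y i * I.x i l := by
  have hY := B.Y_ge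
  have hℓ := B.ℓ_ge
  have hfit := mainStmt_fits I.p I.r I.F I.G I.W I.Δ
  have hR : 1 ≤ I.r ^ I.K := Nat.one_le_pow _ _ ok.r_pos
  have hcb : ∀ z : ℤ, |z| ≤ c → bits z ≤ ℓ := fun z hz => bits_le_of_le_pow (k := h) (hz.trans (by
    exact_mod_cast (Nat.le_mul_of_pos_left c ok.r_pos).trans B.mul_le)) (by omega)
  have hsteps : (I.r * I.Q + 1) + ((I.r * I.Q + 1) + ((I.Q * I.r + 1) + ((10 + I.g * 8) +
      ((4 + I.K * 4) + ((5 + I.n * 2 + I.n * I.d * 2 + I.maxExp * 2) +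
      (46 * ((I.g + 1) * ((I.K + 1) * I.r ^ I.K)) + ((2 + I.size * 3) +
        (6 + I.g * 6 + I.d * 4)))))))) ≤ 200 * (Y + 1) ^ 2 * I.r ^ I.K := by
    have e1 : I.r * I.Q ≤ (Y + 1) ^ 2 := by
      rw [sq]; exact Nat.mul_le_mul (by omega) (by omega)
    have e2 : (I.g + 1) * (I.K + 1) ≤ (Y + 1) ^ 2 := by
      rw [sq]; exact Nat.mul_le_mul (by omega) (by omega)
    have e3 := ok.size_le
    have e4 : Y + 1 ≤ (Y + 1) ^ 2 := Nat.le_self_pow (by norm_num) _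
    have e5 : I.Q * I.r = I.r * I.Q := mul_comm _ _
    set V := (Y + 1) ^ 2
    have e6 : V * 1 ≤ V * I.r ^ I.K := Nat.mul_le_mul_left V hR
    have e7 : 1 * I.r ^ I.K ≤ V * I.r ^ I.K := Nat.mul_le_mul_right _ (by omega)
    have e8 : (I.g + 1) * ((I.K + 1) * I.r ^ I.K) ≤ V * I.r ^ I.K := by
      rw [← mul_assoc]; exact Nat.mul_le_mul_right _ e2
    rw [mul_assoc 200]
    omega
  refine Spec.mono (Spec.seq hfit.1 hs (table_spec hs 8 Inst.Q_pos fun l hl x hx =>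
    hcb _ (B.F_le l hl x hx)) fun s₁ g₁ hfr₁ t₁ => ?_) hsteps fun _ h => h
  have ns₁ : ∀ a, a ≠ 8 → s₁.arr a = s.arr a := fun a ha =>
    hfr₁.2 a fun h => ha (mem_tableStmt_arrs h)
  have nv₁ : s₁.var = s.var := funext fun v => hfr₁.1 v (by rw [tableStmt_vars]; simp)
  refine Spec.seq hfit.2.1 g₁ (table_spec g₁ 9 Inst.Q_pos fun l hl x hx =>
    hcb _ (B.G_le l hl x hx)) fun s₂ g₂ hfr₂ t₂ => ?_
  have ns₂ : ∀ a, a ≠ 9 → s₂.arr a = s₁.arr a := fun a ha =>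
    hfr₂.2 a fun h => ha (mem_tableStmt_arrs h)
  have nv₂ : s₂.var = s₁.var := funext fun v => hfr₂.1 v (by rw [tableStmt_vars]; simp)
  refine Spec.seq hfit.2.2.1 g₂ (table_spec g₂ 10 ok.r_pos fun l hl x hx =>
    hcb _ (B.W_le l hl x hx)) fun s₃ g₃ hfr₃ t₃ => ?_
  have ns₃ : ∀ a, a ≠ 10 → s₃.arr a = s₂.arr a := fun a ha =>
    hfr₃.2 a fun h => ha (mem_tableStmt_arrs h)
  have nv₃ : s₃.var = s₂.var := funext fun v => hfr₃.1 v (by rw [tableStmt_vars]; simp)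
  have v₃ : s₃.var = s.var := nv₃.trans (nv₂.trans nv₁)
  have a₃ : ∀ a, a ≠ 8 → a ≠ 9 → a ≠ 10 → s₃.arr a = s.arr a := fun a h8 h9 h10 => by
    rw [ns₃ a h10, ns₂ a h9, ns₁ a h8]
  refine Spec.seq hfit.2.2.2.1 g₃ (paramStmt_spec ok B hK g₃ (by rw [v₃, S.n]))
    fun s₄ g₄ hfr₄ ⟨⟨q2, q3, q4, q8⟩, q9, q10, qtwo⟩ => ?_
  have v₄ : ∀ x, x ∉ [2, 3, 4, 8, 9, 10, 30] → s₄.var x = s.var x := fun x hx => by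
    rw [hfr₄.1 x (by simp [paramStmt, Stmt.vars] at hx ⊢; tauto), v₃]
  have a₄ : ∀ a, a ≠ 4 → s₄.arr a = s₃.arr a := fun a ha =>
    hfr₄.2 a (by simpa [paramStmt, Stmt.arrs] using ha)
  refine Spec.seq hfit.2.2.2.2.1 g₄ (powerStmt_spec ok B g₄ q3 q8)
    fun s₅ g₅ hfr₅ ⟨q11, q12⟩ => ?_
  have v₅ : ∀ x, x ∉ [11, 12, 30] → s₅.var x = s₄.var x := fun x hx =>
    hfr₅.1 x (by simp [powerStmt, Stmt.vars] at hx ⊢; tauto)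
  have a₅ : s₅.arr = s₄.arr := funext fun a => hfr₅.2 a (by simp [powerStmt, Stmt.arrs])
  have a₅' : ∀ a, a ∉ [4, 8, 9, 10] → s₅.arr a = s.arr a := fun a ha => by
    simp only [List.mem_cons, List.not_mem_nil, or_false, not_or] at ha
    rw [a₅, a₄ a ha.1, a₃ a ha.2.1 ha.2.2.1 ha.2.2.2]
  have v₅' : ∀ x, x ∉ [2, 3, 4, 8, 9, 10, 11, 12, 30] → s₅.var x = s.var x := fun x hx => by
    simp only [List.mem_cons, List.not_mem_nil, or_false, not_or] at hx
    rw [v₅ x (by simp [hx]), v₄ x (by simp [hx])]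
  refine Spec.seq hfit.2.2.2.2.2.1 g₅ (centerStmt_spec B g₅ (by rw [v₅' 0 (by decide), S.n])
    (by rw [v₅' 1 (by decide), S.d]) (by rw [v₅ 10 (by decide), q10])
    (by rw [a₅' 0 (by decide)]; exact S.x)
    (by rw [a₅' 5 (by decide)]; exact S.zero 5 (by norm_num))
    (by rw [a₅' 6 (by decide)]; exact S.zero 6 (by norm_num)))
    fun s₆ g₆ hfr₆ ⟨w5, wcen, wunit, wbase⟩ => ?_
  have v₆ : ∀ x, x ∉ [5, 30] → s₆.var x = s₅.var x := fun x hx =>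
    hfr₆.1 x (by simp [centerStmt, Stmt.vars] at hx ⊢; tauto)
  have a₆ : ∀ a, a ∉ [5, 6, 7] → s₆.arr a = s₅.arr a := fun a ha =>
    hfr₆.2 a (by simp [centerStmt, Stmt.arrs] at ha ⊢; tauto)
  have E₆ : Env I s₆ := by
    constructor
    · rw [v₆ 0 (by decide), v₅' 0 (by decide), S.n]
    · rw [v₆ 1 (by decide), v₅' 1 (by decide), S.d]
    · rw [v₆ 2 (by decide), v₅ 2 (by decide), q2]
    · rw [v₆ 3 (by decide), v₅ 3 (by decide), q3]
    · rw [v₆ 4 (by decide), v₅ 4 (by decide), q4]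
    · exact w5
    · rw [v₆ 8 (by decide), v₅ 8 (by decide), q8]
    · rw [v₆ 9 (by decide), v₅ 9 (by decide), q9]
    · rw [v₆ 11 (by decide), q11]
    · rw [v₆ 12 (by decide), q12]
    · rw [a₆ 0 (by decide), a₅' 0 (by decide)]; exact S.x
    · rw [a₆ 4 (by decide), a₅]; exact qtwo
    · exact wcen
    · exact wunit
    · exact wbase
    · rw [a₆ 8 (by decide), a₅, a₄ 8 (by decide), ns₃ 8 (by decide), ns₂ 8 (by decide)]; exact t₁
    · rw [a₆ 9 (by decide), a₅, a₄ 9 (by decide), ns₃ 9 (by decide)]; exact t₂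
    · rw [a₆ 10 (by decide), a₅, a₄ 10 (by decide)]; exact t₃
  refine Spec.seq hfit.2.2.2.2.2.2.1 g₆ (searchStmt_spec ok B E₆ g₆) fun s₇ g₇ hfr₇ hbest => ?_
  have E₇ : Env I s₇ := E₆.frame hfr₇
    (by simp [searchStmt, productStmt, updateStmt, transformStmt, Stmt.vars])
    (by simp [searchStmt, productStmt, updateStmt, transformStmt, Stmt.arrs])
  refine Spec.seq hfit.2.2.2.2.2.2.2.1 g₇ (thirdStmt_spec ok B E₇ g₇ hbest)
    fun s₈ g₈ hfr₈ ⟨z, y, hz, hy, hopt⟩ => ?_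
  have E₈ : Env I s₈ := E₇.frame hfr₈ (by simp [thirdStmt, Stmt.vars])
    (by simp [thirdStmt, Stmt.arrs])
  exact (outputStmt_spec ok B E₈ g₈ hz hy).mono le_rfl fun s' h => ⟨z, y, hopt, h⟩

end Setup

open RAM

/-! ## Optimality of the output -/

section Optimality

variable {I : Inst}

theorem selSize_eq (ok : I.Ok) (z y : ℕ) : selSize I z y = labelCount I z y := by
  have := sum_labelOf_mul I.p I.g ok.n_le (f := I.unit) (fun i hi => if_neg (not_lt.2 hi)) z y
  rw [selSize, pairSize, thirdSize, ← Finset.sum_add_distrib, this, labelCount]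
  exact Finset.sum_congr rfl fun i hi => by
    rw [Inst.unit, if_pos (Finset.mem_range.1 hi), mul_one]

variable {z y : ℕ} {c : Fin I.n → Fin 2}

theorem clusterSize_eq (hc : ∀ i, ((c i : ℕ) : ℤ) = labelOf I.p z y i) :
    clusterSize c = labelCount I z y := by
  rw [clusterSize, labelCount, Finset.sum_range]
  exact Finset.sum_congr rfl fun i _ => hc i

theorem two_mul_clusterSpread (ok : I.Ok) (hc : ∀ i, ((c i : ℕ) : ℤ) = labelOf I.p z y i) :
    2 * clusterSpread (fun i (j : Fin I.d) => I.x i j) c = spread I z y := by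
  rw [clusterSpread, spread, tripleWeight, Finset.sum_range]
  congr 1
  refine Finset.sum_congr rfl fun l _ => ?_
  rw [tripleVec, sum_labelOf_mul I.p I.g ok.n_le (f := fun i => I.cen i l)
    (fun i hi => Inst.cen_eq_zero hi l), Finset.sum_range, sq]
  have : ∀ i : Fin I.n, ((c i : ℕ) : ℤ) * (I.n * I.x i l - ∑ i' : Fin I.n, I.x i' l) =
      labelOf I.p z y i * I.cen i l := fun i => by
    rw [hc, Inst.cen, if_pos i.2, Finset.sum_range]
  simp only [this]

/-- Row and column bits can be prescribed freely: `z` receives the labels of parts one and two, `y`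
those of three and two, `x` those of one and three, which makes them compatible. So the search
misses no clustering. -/
theorem exists_cand (ok : I.Ok) (c : Fin I.n → Fin 2) : ∃ z < I.size, ∃ y, Cand I z y ∧
    ∀ i, ((c i : ℕ) : ℤ) = labelOf I.p z y i := by
  let f : ℕ → Bool := fun i => if h : i < I.n then c ⟨i, h⟩ = 1 else false
  obtain ⟨z, hz, hz'⟩ := exists_testBit ok.p_pos I.K (fun b => f (3 * b)) fun b => f (3 * b + 1)
  obtain ⟨y, hy, hy'⟩ := exists_testBit ok.p_pos I.K (fun b => f (3 * b + 2)) fun b => f (3 * b + 1)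
  obtain ⟨x, hx, hx'⟩ := exists_testBit ok.p_pos I.K (fun b => f (3 * b)) fun b => f (3 * b + 2)
  refine ⟨z, hz, y, ⟨hy, x, hx, fun b hb => ?_⟩, fun i => ?_⟩
  · rw [(hz' b hb).1, (hz' b hb).2, (hx' b hb).1, (hx' b hb).2, (hy' b hb).1, (hy' b hb).2]
    exact ⟨rfl, rfl, rfl⟩
  · have hi : (i : ℕ) / 3 < I.p * I.K := by
      have := ok.n_le
      have := i.2
      unfold Inst.g at *
      omega
    have hf : ((c i : ℕ) : ℤ) = ((f i).toNat : ℤ) := by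
      have h2 : c i = 0 ∨ c i = 1 := by omega
      rcases h2 with h | h <;> simp [f, h]
    rw [hf, labelOf]
    simp only [bitAt, (hz' _ hi).1, (hz' _ hi).2, (hy' _ hi).1]
    split_ifs with h0 h1
    · rw [show 3 * ((i : ℕ) / 3) = i by omega]
    · rw [show 3 * ((i : ℕ) / 3) + 1 = i by omega]
    · rw [show 3 * ((i : ℕ) / 3) + 2 = i by omega]

theorem isKMeansSolution_of_search (ok : I.Ok) {μ : Fin 2 → EuclideanSpace ℝ (Fin I.d)}
    (hopt : ∀ z' < I.size, ∀ y', Cand I z' y' → Proper I z' y' → Proper I z y ∧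
      spread I z' y' * selPairs I z y ≤ spread I z y * selPairs I z' y')
    (hc : ∀ i, ((c i : ℕ) : ℤ) = labelOf I.p z y i)
    (h0 : ∀ l, μ 0 l * ∑ i, (1 - ((c i : ℕ) : ℝ)) = ∑ i, (1 - ((c i : ℕ) : ℝ)) * (I.x i l : ℝ))
    (h1 : ∀ l, μ 1 l * ∑ i, ((c i : ℕ) : ℝ) = ∑ i, ((c i : ℕ) : ℝ) * (I.x i l : ℝ)) :
    IsKMeansSolution (toPoints fun i (j : Fin I.d) => I.x i j) c μ := by
  have key : ∀ c' : Fin I.n → Fin 2, 0 < clusterSize c' → clusterSize c' < I.n → Proper I z y ∧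
      clusterSpread (fun i (j : Fin I.d) => I.x i j) c' * (clusterSize c * (I.n - clusterSize c)) ≤
        clusterSpread (fun i (j : Fin I.d) => I.x i j) c *
          (clusterSize c' * (I.n - clusterSize c')) := by
    intro c' hc1 hc2
    obtain ⟨z', hz', y', hC, hc'⟩ := exists_cand ok c'
    have hp : Proper I z' y' := by
      rw [Proper, selSize_eq ok, ← clusterSize_eq hc']
      exact ⟨hc1, by omega⟩
    obtain ⟨h1, h2⟩ := hopt z' hz' y' hC hp
    refine ⟨h1, ?_⟩
    rw [selPairs, selPairs, selSize_eq ok, selSize_eq ok, ← clusterSize_eq hc',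
      ← clusterSize_eq hc, ← two_mul_clusterSpread ok hc', ← two_mul_clusterSpread ok hc] at h2
    linarith
  refine isKMeansSolution_of_spread h0 h1 (fun hn => ?_) fun c' h h' => (key c' h h').2
  -- For `n ≥ 2` a cluster consisting of one point is a proper competitor, and its existence forces
  -- the clustering found to be proper.
  have hs : clusterSize (fun i : Fin I.n => if (i : ℕ) = 0 then (1 : Fin 2) else 0) = 1 := by
    rw [clusterSize, Finset.sum_eq_single ⟨0, by omega⟩]
    · simp
    · intro i _ hi
      have : (i : ℕ) ≠ 0 := fun h => hi (Fin.ext h)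
      simp [this]
    · simp
  have := (key _ (by rw [hs]; norm_num) (by rw [hs]; omega)).1
  rw [Proper, selSize_eq ok, ← clusterSize_eq hc] at this
  exact ⟨this.1, by omega⟩

end Optimality

/-- For an empty cluster the weighted sum vanishes, so both sides are `0` whatever the center is;
otherwise the denominator is the size and cancels. -/
theorem div_mul_sum_eq {n : ℕ} {w y : Fin n → ℤ} (hw : ∀ i, 0 ≤ w i) {a m k : ℤ}
    (hk : k = ∑ i, w i) (ha : a = ∑ i, w i * y i) (hm : m = k + if k = 0 then 1 else 0) :
    (a : ℝ) / m * ∑ i, (w i : ℝ) = ∑ i, (w i : ℝ) * (y i : ℝ) := by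
  have ha' : (a : ℝ) = ∑ i, (w i : ℝ) * (y i : ℝ) := by rw [ha]; push_cast; rfl
  have hk' : (k : ℝ) = ∑ i, (w i : ℝ) := by rw [hk]; push_cast; rfl
  rw [← ha', ← hk']
  split_ifs at hm with h
  · have := sum_mul_eq_zero (w := fun i => (w i : ℝ)) (fun i => by exact_mod_cast hw i)
      (by rw [← hk', h]; simp) fun i => (y i : ℝ)
    rw [ha', this, h]
    simp
  · rw [hm, add_zero, div_mul_cancel₀]
    exact_mod_cast h

theorem exists_output {I : Inst} (ok : I.Ok) {s : Store} {z y : ℕ}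
    (hopt : ∀ z' < I.size, ∀ y', Cand I z' y' → Proper I z' y' → Proper I z y ∧
      spread I z' y' * selPairs I z y ≤ spread I z y * selPairs I z' y')
    (hl : ∀ i < I.n, s.arr 1 (i : ℤ) = labelOf I.p z y i)
    (h0 : s.arr 2 0 = I.n - labelCount I z y + if I.n - labelCount I z y = 0 then 1 else 0)
    (h1 : s.arr 2 1 = labelCount I z y + if labelCount I z y = 0 then 1 else 0)
    (hc0 : ∀ l < I.d, s.arr 3 (l : ℤ) =
      ∑ i ∈ Finset.range I.n, (1 - labelOf I.p z y i) * I.x i l)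
    (hc1 : ∀ l < I.d, s.arr 3 ((l + I.d : ℕ) : ℤ) =
      ∑ i ∈ Finset.range I.n, labelOf I.p z y i * I.x i l) :
    ∃ (c : Fin I.n → Fin 2) (μ : Fin 2 → EuclideanSpace ℝ (Fin I.d)),
      IsOutput s c μ ∧ IsKMeansSolution (toPoints fun i (j : Fin I.d) => I.x i j) c μ := by
  let c : Fin I.n → Fin 2 := fun i => if labelOf I.p z y i = 0 then 0 else 1
  have hc : ∀ i, ((c i : ℕ) : ℤ) = labelOf I.p z y i := fun i => by
    rcases labelOf_eq_zero_or_one I.p z y i with h | h <;> simp [c, h]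
  have hcR : ∀ i, ((c i : ℕ) : ℝ) = ((labelOf I.p z y i : ℤ) : ℝ) := fun i => by
    rw [← hc]; simp
  have hb := labelCount_bounds (I := I) z y
  refine ⟨c, fun j => WithLp.toLp 2 fun l =>
    (s.arr 3 (((j : ℕ) * I.d + (l : ℕ) : ℕ) : ℤ) : ℝ) / (s.arr 2 (j : ℕ) : ℝ),
    ⟨fun i => by rw [hl i i.2, hc], fun j => ?_, fun _ _ => rfl⟩,
    isKMeansSolution_of_search ok hopt hc (fun l => ?_) fun l => ?_⟩
  · have hj : j = 0 ∨ j = 1 := by omega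
    rcases hj with rfl | rfl
    · change 0 < s.arr 2 0
      rw [h0]; split_ifs <;> omega
    · change 0 < s.arr 2 1
      rw [h1]; split_ifs <;> omega
  · have := div_mul_sum_eq (w := fun i : Fin I.n => 1 - labelOf I.p z y i) (y := fun i => I.x i l)
      (fun i => by rcases labelOf_eq_zero_or_one I.p z y i with h | h <;> simp [h])
      (a := s.arr 3 (l : ℤ)) (k := I.n - labelCount I z y) (by simp [labelCount, Finset.sum_range])
      (by rw [hc0 l l.2, Finset.sum_range]) h0
    simpa [hcR] using this
  · have := div_mul_sum_eq (w := fun i : Fin I.n => labelOf I.p z y i) (y := fun i => I.x i l)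
      (fun i => by rcases labelOf_eq_zero_or_one I.p z y i with h | h <;> simp [h])
      (a := s.arr 3 ((l + I.d : ℕ) : ℤ)) (k := labelCount I z y)
      (by simp [labelCount, Finset.sum_range]) (by rw [hc1 l l.2, Finset.sum_range]) h1
    simpa [hcR, add_comm] using this

/-! ## The running time -/

section Time

variable {I : Inst}

/-- Centered coordinates are at most `2 n M`, a coordinate's sum of squares at most `n (2 n M)²`,
and squaring and summing over `d` coordinates gives degree `1 + 2 * 5`. The weights are exponents
and so enter the bit length linearly; this is why the coordinates have to be polynomially bounded.
-/
theorem maxExp_le (hx : ∀ i < I.n, ∀ j < I.d, |I.x i j| ≤ I.M) :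
    I.maxExp ≤ 288 * (I.n + I.d + I.M + 1) ^ 11 := by
  have hcen : ∀ i < I.n, ∀ j < I.d, |I.cen i j| ≤ 2 * (I.n * I.M) := fun i hi j hj => by
    rw [Inst.cen, if_pos hi, two_mul]
    refine (abs_sub _ _).trans (add_le_add ?_ ?_)
    · rw [abs_mul, abs_of_nonneg (by positivity : (0 : ℤ) ≤ I.n)]
      exact mul_le_mul_of_nonneg_left (hx i hi j hj) (by positivity)
    · refine (Finset.abs_sum_le_sum_abs _ _).trans ((Finset.sum_le_card_nsmul _ _ (I.M : ℤ)
        fun i' hi' => hx i' (Finset.mem_range.1 hi') j hj).trans (by simp))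
  have hH : ∀ j < I.d, ∑ i ∈ Finset.range I.n, I.cen i j * I.cen i j ≤
      I.n * (2 * (I.n * I.M)) ^ 2 := fun j hj => by
    refine (Finset.sum_le_card_nsmul _ _ ((2 * (I.n * I.M) : ℤ) ^ 2) fun i hi => ?_).trans (by simp)
    rw [← sq, ← sq_abs]
    exact pow_le_pow_left₀ (abs_nonneg _) (hcen i (Finset.mem_range.1 hi) j hj) 2
  have h1 : (I.maxExp : ℤ) ≤ 18 * (I.d * (I.n * (2 * (I.n * I.M)) ^ 2) ^ 2) := by
    rw [Inst.maxExp_cast]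
    refine mul_le_mul_of_nonneg_left ((Finset.sum_le_card_nsmul _ _
      (((I.n : ℤ) * (2 * (I.n * I.M)) ^ 2) ^ 2) fun j hj => ?_).trans (by simp)) (by norm_num)
    rw [← sq]
    exact pow_le_pow_left₀ (Finset.sum_nonneg fun _ _ => mul_self_nonneg _)
      (hH j (Finset.mem_range.1 hj)) 2
  have h2 : I.maxExp ≤ 18 * (I.d * (I.n * (2 * (I.n * I.M)) ^ 2) ^ 2) := by exact_mod_cast h1
  set N := I.n + I.d + I.M + 1 with hN
  clear_value N
  calc I.maxExp ≤ 18 * (N * (N * (2 * (N * N)) ^ 2) ^ 2) := h2.trans (by gcongr <;> omega)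
    _ = 288 * N ^ 11 := by ring

/-- The smallest admissible bound for the small values. -/
def Inst.small (I : Inst) : ℕ :=
  4 * I.maxExp + I.n * I.n + I.n * I.d + I.n * I.M + 5 * I.g + I.K + I.Q + I.r + I.n + I.d + I.M + 1

/-- The smallest admissible bound for the bit lengths. -/
def Inst.bitLength (I : Inst) (h : ℕ) : ℕ :=
  I.small + h + 3 * (h * I.K) + 2 * ((4 * I.g + 1) * I.maxExp) + 1

theorem parts_le (hp : 0 < I.p) (hK : I.K = (I.n + (3 * I.p - 1)) / (3 * I.p)) :
    I.n ≤ 3 * I.g ∧ 3 * I.g ≤ I.n + 3 * I.p ∧ I.K ≤ I.g := by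
  have h1 := Nat.div_add_mod (I.n + (3 * I.p - 1)) (3 * I.p)
  have h2 := Nat.mod_lt (I.n + (3 * I.p - 1)) (show 0 < 3 * I.p by omega)
  rw [← hK, mul_assoc] at h1
  rw [Inst.g]
  exact ⟨by omega, by omega, Nat.le_mul_of_pos_left _ hp⟩

theorem small_le (hx : ∀ i < I.n, ∀ j < I.d, |I.x i j| ≤ I.M) (hp : 0 < I.p)
    (hK : I.K = (I.n + (3 * I.p - 1)) / (3 * I.p)) :
    I.small ≤ (1170 + 18 * I.p + I.Q + I.r) * (I.n + I.d + I.M + 1) ^ 11 := by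
  have h1 := maxExp_le hx
  obtain ⟨-, h2, h3⟩ := parts_le hp hK
  unfold Inst.small
  set N := I.n + I.d + I.M + 1 with hN
  clear_value N
  have n1 : 1 ≤ N ^ 11 := Nat.one_le_pow _ _ (by omega)
  have n2 : N ^ 2 ≤ N ^ 11 := Nat.pow_le_pow_right (by omega) (by norm_num)
  have n3 : N ≤ N ^ 11 := Nat.le_self_pow (by norm_num) N
  have e1 : I.n * I.n + I.n * I.d + I.n * I.M ≤ N ^ 2 := by rw [hN]; nlinarith
  have e2 := Nat.mul_le_mul_left (18 * I.p + I.Q + I.r) n1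
  nlinarith

theorem bitLength_le (h : ℕ) (hx : ∀ i < I.n, ∀ j < I.d, |I.x i j| ≤ I.M) (hp : 0 < I.p)
    (hK : I.K = (I.n + (3 * I.p - 1)) / (3 * I.p)) :
    I.bitLength h ≤ (1170 + 18 * I.p + I.Q + I.r + 4 * h + 3 * (h * I.p) + 2 * 288 *
      (5 + 4 * I.p) + 1) * (I.n + I.d + I.M + 1) ^ 12 := by
  have h1 := maxExp_le hx
  obtain ⟨-, h2, h3⟩ := parts_le hp hK
  have h4 := small_le hx hp hK
  unfold Inst.bitLength
  set N := I.n + I.d + I.M + 1 with hN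
  clear_value N
  have n1 : 1 ≤ N ^ 12 := Nat.one_le_pow _ _ (by omega)
  have n2 : N ^ 11 ≤ N ^ 12 := Nat.pow_le_pow_right (by omega) (by norm_num)
  have n3 : N ≤ N ^ 12 := Nat.le_self_pow (by norm_num) N
  have n4 : N ^ 12 = N * N ^ 11 := by ring
  have hg : I.g ≤ N + I.p := by omega
  have e1 : (4 * I.g + 1) * I.maxExp ≤ ((5 + 4 * I.p) * N) * (288 * N ^ 11) := by
    refine Nat.mul_le_mul ?_ h1
    have : I.p * 1 ≤ I.p * N := Nat.mul_le_mul_left _ (by omega)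
    nlinarith
  have e2 : ((5 + 4 * I.p) * N) * (288 * N ^ 11) = 288 * (5 + 4 * I.p) * N ^ 12 := by ring
  have e3 : h * I.K ≤ h * N ^ 12 + h * I.p * N ^ 12 := by
    calc h * I.K ≤ h * (N ^ 12 + I.p * N ^ 12) := Nat.mul_le_mul_left _ (by nlinarith)
      _ = _ := by ring
  have e4 : h * 1 ≤ h * N ^ 12 := Nat.mul_le_mul_left h n1
  have e5 := Nat.mul_le_mul_left (1170 + 18 * I.p + I.Q + I.r) n2
  have e6 := e1.trans_eq e2
  generalize 1170 + 18 * I.p + I.Q + I.r = A at *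
  generalize N ^ 12 = V at *
  generalize 5 + 4 * I.p = q at *
  calc _ ≤ A * V + h * V + 3 * (h * V + h * I.p * V) + 2 * (288 * q * V) + V := by omega
    _ = (A + 4 * h + 3 * (h * I.p) + 2 * 288 * q + 1) * V := by ring

end Time

/-! ### Choice of the constants and the main theorem. -/

theorem exists_abs_le (T : ℕ → ℕ → ℤ) (N m : ℕ) : ∃ c : ℕ, ∀ l < N, ∀ x < m, |T l x| ≤ c := by
  refine ⟨∑ l ∈ Finset.range N, ∑ x ∈ Finset.range m, (T l x).natAbs, fun l hl x hx => ?_⟩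
  rw [Int.abs_eq_natAbs]
  exact_mod_cast (Finset.single_le_sum (f := fun x => (T l x).natAbs) (fun _ _ => Nat.zero_le _)
    (Finset.mem_range.2 hx)).trans (Finset.single_le_sum
      (f := fun l => ∑ x ∈ Finset.range m, (T l x).natAbs) (fun _ _ => Nat.zero_le _)
      (Finset.mem_range.2 hl))

/-- The scheme is fixed before the input, so its size and coefficients go into the program text and
the constant `C`; the only exponential factor is `r ^ K`. -/
theorem exists_program {p r : ℕ} {F G W : ℕ → ℕ → ℤ} {Δ : ℤ} (hp : 0 < p) (hΔ : Δ ≠ 0)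
    (hr : 2 ^ p * 2 ^ p ≤ r) (hscheme : ∀ x < 2 ^ p * 2 ^ p, ∀ y < 2 ^ p * 2 ^ p,
      ∀ z < 2 ^ p * 2 ^ p, ∑ l ∈ Finset.range r, W z l * F l x * G l y =
        Δ * mulTensor (2 ^ p) x y z) :
    ∃ (P : Prog) (C e : ℕ), ∀ (n d M : ℕ) (x : Fin n → Fin d → ℤ), (∀ i j, |x i j| ≤ (M : ℤ)) →
      ∃ (s : Store) (t : ℕ) (c : Fin n → Fin 2) (μ : Fin 2 → EuclideanSpace ℝ (Fin d)),
        Runs P (inputStore x) s t ∧ IsOutput s c μ ∧ IsKMeansSolution (toPoints x) c μ ∧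
        t ≤ C * (n + d + M + 1) ^ e * r ^ ((n + (3 * p - 1)) / (3 * p)) := by
  obtain ⟨cF, hF⟩ := exists_abs_le F r (2 ^ p * 2 ^ p)
  obtain ⟨cG, hG⟩ := exists_abs_le G r (2 ^ p * 2 ^ p)
  obtain ⟨cW, hW⟩ := exists_abs_le W (2 ^ p * 2 ^ p) r
  obtain ⟨C, D, hrun⟩ := (mainStmt p r F G W Δ).compile_spec (mainStmt_fits p r F G W Δ)
  set c := cF + cG + cW + 1 with hc
  -- Since `k < 2 ^ k`, the power `2 ^ h` bounds both `r * c` and `|Δ|`.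
  set h := r * c + Δ.natAbs with hh
  set A := 1170 + 18 * p + 2 ^ p * 2 ^ p + r with hA
  set A' := A + 4 * h + 3 * (h * p) + 2 * 288 * (5 + 4 * p) + 1 with hA'
  -- Compilation costs `(small + 1) ^ D * bitLength ^ 2` per step, and the number of steps has
  -- another `(small + 1) ^ 2`; these quantities have degree `11` and `12`, whence `11 * (D + 2) +
  -- 24`.
  refine ⟨(mainStmt p r F G W Δ).compile 64, C * (A + 1) ^ (D + 2) * A' ^ 2 * 200,
    11 * (D + 2) + 24, fun n d M x hx => ?_⟩
  let I : Inst := { n := n, d := d, p := p, r := r, K := (n + (3 * p - 1)) / (3 * p), M := M, Δ := Δ,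
                    F := F, G := G, W := W,
                    x := fun i j => if h : i < n ∧ j < d then x ⟨i, h.1⟩ ⟨j, h.2⟩ else 0 }
  have hK : I.K = (I.n + (3 * I.p - 1)) / (3 * I.p) := rfl
  have hIx : (fun (i : Fin n) (j : Fin d) => I.x i j) = x := by
    funext i j
    simp [I]
  have hxM : ∀ i < I.n, ∀ j < I.d, |I.x i j| ≤ I.M := fun i hi j hj => by
    have := hx ⟨i, hi⟩ ⟨j, hj⟩
    rwa [← hIx] at this
  have ok : I.Ok := ⟨hp, hr, (parts_le hp hK).1, hΔ, hscheme⟩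
  have B : I.Bounds c h (I.bitLength h) I.small := by
    refine ⟨hxM, fun l hl x hx => (hF l hl x hx).trans ?_, fun l hl x hx => (hG l hl x hx).trans ?_,
      fun x hx l hl => (hW x hx l hl).trans ?_, by omega, ?_, ?_, le_rfl, le_rfl⟩
    · exact_mod_cast (by omega)
    · exact_mod_cast (by omega)
    · exact_mod_cast (by omega)
    · exact (Nat.le_add_right _ _).trans Nat.lt_two_pow_self.le
    · rw [Int.abs_eq_natAbs]
      exact_mod_cast (Nat.le_add_left Δ.natAbs (r * c)).trans Nat.lt_two_pow_self.le
  have hY := B.Y_ge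
  have S : Start I (inputStore x) := by
    refine ⟨rfl, rfl, fun i hi j hj => ?_, fun a ha k => by simp [inputStore, ha]⟩
    have hlt : i * d + j < n * d := by
      change i < n at hi
      change j < d at hj
      nlinarith
    have he : finProdFinEquiv.symm ⟨i * d + j, hlt⟩ = (⟨i, hi⟩, ⟨j, hj⟩) := by
      rw [Equiv.symm_apply_eq]
      ext
      simp [finProdFinEquiv, mul_comm, add_comm]
    change (if h : (0 = 0 ∧ (0 : ℤ) ≤ ((i * d + j : ℕ) : ℤ) ∧
      ((i * d + j : ℕ) : ℤ).toNat < n * d) then _ else 0) = _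
    rw [dif_pos ⟨rfl, by positivity, by rwa [Int.toNat_natCast]⟩]
    simp only [Int.toNat_natCast, he, I]
    rw [dif_pos ⟨hi, hj⟩]
  have hgood : Good (I.bitLength h) I.small (inputStore x) := by
    have hn : I.n ≤ I.small := by omega
    have hd : I.d ≤ I.small := by omega
    have hM : I.M ≤ I.small := by omega
    refine ⟨fun v => ?_, fun a k => ?_, fun v _ => ?_⟩
    · simp only [inputStore]
      split_ifs
      exacts [B.bits_natCast_le hn, B.bits_natCast_le hd, B.bits_le_of_le_Y (by simp)]
    · simp only [inputStore]
      split_ifs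
      exacts [B.bits_le_of_le_Y ((hx _ _).trans (by exact_mod_cast hM)), B.bits_le_of_le_Y (by simp)]
    · simp only [inputStore]
      split_ifs
      exacts [by exact_mod_cast hn, by exact_mod_cast hd, by positivity]
  obtain ⟨s', hexec, z, y, hopt, hl, h0, h1, hc0, hc1⟩ := mainStmt_spec ok B hK hgood S
  obtain ⟨σ, τ, hruns, -, harr, -, hτ⟩ := hrun 64 _ _ _ _ (inputStore x) _ le_rfl
    (by have := B.ℓ_ge; omega) hgood (fun _ _ => rfl) rfl hexec
  rw [← harr] at hl h0 h1 hc0 hc1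
  obtain ⟨cl, μ, hout, hsol⟩ := exists_output ok hopt hl h0 h1 hc0 hc1
  refine ⟨σ, τ, cl, μ, hruns, hout, hIx ▸ hsol, hτ.trans ?_⟩
  have b1 : I.small + 1 ≤ (A + 1) * (n + d + M + 1) ^ 11 := by
    have := small_le hxM hp hK
    have h1 : 1 ≤ (n + d + M + 1) ^ 11 := Nat.one_le_pow _ _ (by omega)
    rw [Nat.add_mul]
    exact add_le_add this (by omega)
  have b2 : I.bitLength h ≤ A' * (n + d + M + 1) ^ 12 := bitLength_le h hxM hp hK
  set N := n + d + M + 1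
  change C * (I.small + 1) ^ D * I.bitLength h ^ 2 * (200 * (I.small + 1) ^ 2 * r ^ I.K) ≤
    _ * r ^ I.K
  calc C * (I.small + 1) ^ D * I.bitLength h ^ 2 * (200 * (I.small + 1) ^ 2 * r ^ I.K)
      ≤ C * ((A + 1) * N ^ 11) ^ D * (A' * N ^ 12) ^ 2 *
        (200 * ((A + 1) * N ^ 11) ^ 2 * r ^ I.K) := by gcongr
    _ = C * (A + 1) ^ (D + 2) * A' ^ 2 * 200 * N ^ (11 * (D + 2) + 24) * r ^ I.K := by
      generalize A + 1 = a
      clear_value A' N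
      rw [mul_pow, mul_pow, mul_pow, ← pow_mul, ← pow_mul, ← pow_mul, pow_add a, pow_add N,
        mul_add, pow_add N]
      ring

theorem mainTheorem2 :
    ∀ ε : ℝ, 0 < ε → ∃ (P : RAM.Prog) (C e : ℕ),
      ∀ (n d M : ℕ) (x : Fin n → Fin d → ℤ), (∀ i j, |x i j| ≤ (M : ℤ)) →
        ∃ (s : RAM.Store) (t : ℕ) (c : Fin n → Fin 2) (μ : Fin 2 → EuclideanSpace ℝ (Fin d)),
          RAM.Runs P (inputStore x) s t ∧
          IsOutput s c μ ∧
          IsKMeansSolution (toPoints x) c μ ∧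
          (t : ℝ) ≤ (2 : ℝ) ^ ((matMulExponent ℚ + ε) * (n : ℝ) / 3) *
            ((C : ℝ) * ((n : ℝ) + (d : ℝ) + (M : ℝ) + 1) ^ e) := by
  intro ε hε
  obtain ⟨p, r, hp, hdec, hr⟩ := exists_hasMatMulDecomposition ℚ hε
  obtain ⟨F, G, W, Δ, hΔ, hscheme⟩ := hdec.exists_integral
  obtain ⟨P, C, e, hP⟩ := exists_program hp hΔ hdec.sq_le hscheme
  set τ := matMulExponent ℚ + ε with hτ
  -- A scheme needs at least one product, so `r ≤ (2 ^ p) ^ τ` rules out a negative `τ`. The sign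
  -- matters when `p * K` is replaced by its upper bound in the exponent.
  have hτ0 : 0 ≤ τ := by
    by_contra hneg
    have h1 : (1 : ℝ) ≤ r := by
      exact_mod_cast (Nat.one_le_iff_ne_zero.2 (by positivity)).trans hdec.sq_le
    have h2 : ((2 : ℝ) ^ p) ^ τ < 1 :=
      Real.rpow_lt_one_of_one_lt_of_neg (one_lt_pow₀ (by norm_num) (by omega)) (not_le.1 hneg)
    linarith
  refine ⟨P, ⌈(2 : ℝ) ^ (p * τ)⌉₊ * C, e, fun n d M x hx => ?_⟩
  obtain ⟨s, t, c, μ, h1, h2, h3, h4⟩ := hP n d M x hx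
  refine ⟨s, t, c, μ, h1, h2, h3, ?_⟩
  set K := (n + (3 * p - 1)) / (3 * p) with hK
  -- Rounding up to a multiple of `3 * p` adds at most `p` to the exponent before multiplication by
  -- `τ`, a constant factor `2 ^ (p * τ)` that goes into `C`.
  have hpK : (p * K : ℝ) ≤ n / 3 + p := by
    have := Nat.div_mul_le_self (n + (3 * p - 1)) (3 * p)
    rw [← hK] at this
    have h' : K * (3 * p) ≤ n + 3 * p := by omega
    have h'' : (K * (3 * p) : ℝ) ≤ n + 3 * p := by exact_mod_cast h'
    linarith
  have hrK : (r : ℝ) ^ K ≤ (2 : ℝ) ^ (τ * n / 3) * ⌈(2 : ℝ) ^ (p * τ)⌉₊ := by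
    calc (r : ℝ) ^ K ≤ (((2 : ℝ) ^ p) ^ τ) ^ K := pow_le_pow_left₀ (by positivity) hr K
      _ = (2 : ℝ) ^ (p * K * τ) := by
        rw [← Real.rpow_natCast, ← Real.rpow_natCast, ← Real.rpow_mul (by norm_num),
          ← Real.rpow_mul (by norm_num)]
        ring_nf
      _ ≤ (2 : ℝ) ^ (τ * n / 3 + p * τ) := by
        refine Real.rpow_le_rpow_of_exponent_le (by norm_num) ?_
        nlinarith
      _ = (2 : ℝ) ^ (τ * n / 3) * (2 : ℝ) ^ (p * τ) := Real.rpow_add (by norm_num) _ _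
      _ ≤ _ := by gcongr; exact Nat.le_ceil _
  have h4' : (t : ℝ) ≤ C * (n + d + M + 1) ^ e * r ^ K := by exact_mod_cast h4
  calc (t : ℝ) ≤ C * (n + d + M + 1) ^ e * r ^ K := h4'
    _ ≤ C * (n + d + M + 1) ^ e * ((2 : ℝ) ^ (τ * n / 3) * ⌈(2 : ℝ) ^ (p * τ)⌉₊) := by gcongr
    _ = _ := by push_cast; ring
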